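/- Let $\mathcal V$ be a complete symmetric monoidal closed category. "Small" $\mathcal V$-categories are those with a small set of objects. An index for limits is a $\mathcal V$-functor $K\to\mathcal V$ and an index for colimits is a $\mathcal V$-functor $K^{op}\to\mathcal V$, with $K$ a small $\mathcal V$-category; $\{W,L\}$ and $W*D$ denote indexed (weighted) limits and colimits. For a family $\mathcal Q$ of indexes, a $\mathcal Q$-(co)limit is a (co)limit with index in $\mathcal Q$. Let $\mathcal P$ be any family of indexes for limits. For a small $\mathcal V$-category $A$, a presheaf $F:A^{op}\to\mathcal V$ is $\mathcal P$-flat if its left Kan extension along the Yoneda embedding, $F*-:[A,\mathcal V]\to\mathcal V$, exists (that is, the colimit $F*G$ exists for every $\mathcal V$-functor $G:A\to\mathcal V$; this is automatic if $\mathcal V$ is cocomplete) and preserves all $\mathcal P$-limits. Let $\mathrm{Flat}_{\mathcal P}$ be the family of all $\mathcal P$-flat presheaves on small $\mathcal V$-categories, and let $\mathrm{Flat}_{\mathcal P}(A)$ be the full sub-$\mathcal V$-category of $[A^{op},\mathcal V]$ whose objects are the $\mathcal P$-flat presheaves on $A$. Put $\mathcal Q=\mathrm{Flat}_{\mathcal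 P}$. An object $g$ of a $\mathcal V$-category $M$ is $\mathcal Q$-presentable if $M(g,-):M\to\mathcal V$ preserves all $\mathcal Q$-colimits. A (possibly large) $\mathcal V$-category $M$ is $\mathcal Q$-accessible if 1. $M$ has all $\mathcal Q$-colimits; and there is a small set $G$ of $\mathcal Q$-presentable objects of $M$ such that, with $i$ the inclusion into $M$ of the full subcategory generated by $G$, 2. $i$ is dense, i.e. the $\mathcal V$-functor $M\to[G^{op},\mathcal V]$, $m\mapsto M(i-,m)$, is fully faithful; and 3. every object $m$ of $M$ is a colimit $q*i$ for some $q:G^{op}\to\mathcal V$ in $\mathcal Q$. **Theorem.** For every (possibly large) $\mathcal V$-category $M$, the following are equivalent: (1) $M$ is $\mathcal Q$-accessible; (2) $M$ is equivalent, as a $\mathcal V$-category, to $\mathrm{Flat}_{\mathcal P}(A)$ for some small $\mathcal V$-category $A$. -/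

import Mathlib

open CategoryTheory MonoidalCategory BraidedCategory Limits Opposite
open scoped MonoidalClosed

set_option linter.unusedSectionVars false

universe v u w w₁ w₂ w₃

noncomputable section

namespace EnrichedFlat

section Basics

variable {V : Type u} [Category.{v} V] [MonoidalCategory V] [MonoidalClosed V]

/-- The hom-object in `V` of a `V`-category. -/
abbrev vHom (V : Type u) [Category.{v} V] [MonoidalCategory V] {C : Type w}
    [EnrichedCategory V C] (X Y : C) : V := EnrichedCategory.Hom X Y

/-- Composition in a `V`-category of generalized elements `f : X ⟶ C(a, b)`, `g : Y ⟶ C(b, c)`. -/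
def vComp {C : Type w} [EnrichedCategory V C] {a b c : C} {X Y : V} (f : X ⟶ vHom V a b)
    (g : Y ⟶ vHom V b c) : X ⊗ Y ⟶ vHom V a c :=
  (f ⊗ₘ g) ≫ eComp V a b c

section

variable {C : Type w} [EnrichedCategory V C] {a b c d : C} {X Y Z X' Y' : V}

lemma comp_vComp (u : X' ⟶ X) (u' : Y' ⟶ Y) (f : X ⟶ vHom V a b) (g : Y ⟶ vHom V b c) :
    vComp (u ≫ f) (u' ≫ g) = (u ⊗ₘ u') ≫ vComp f g := by
  simp [vComp]

lemma comp_vComp_left (u : X' ⟶ X) (f : X ⟶ vHom V a b) (g : Y ⟶ vHom V b c) :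
    vComp (u ≫ f) g = u ▷ Y ≫ vComp f g := by
  rw [← Category.id_comp g, comp_vComp, tensorHom_id, Category.id_comp]

lemma comp_vComp_right (u' : Y' ⟶ Y) (f : X ⟶ vHom V a b) (g : Y ⟶ vHom V b c) :
    vComp f (u' ≫ g) = X ◁ u' ≫ vComp f g := by
  rw [← Category.id_comp f, comp_vComp, id_tensorHom, Category.id_comp]

lemma vComp_assoc (f : X ⟶ vHom V a b) (g : Y ⟶ vHom V b c) (h : Z ⟶ vHom V c d) :
    vComp (vComp f g) h = (α_ X Y Z).hom ≫ vComp f (vComp g h) := by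
  have e := e_assoc V a b c d
  rw [Iso.inv_comp_eq] at e
  simp only [vComp]
  calc _ = ((f ⊗ₘ g) ⊗ₘ h) ≫ eComp V a b c ▷ _ ≫ eComp V a c d := by
        rw [← tensorHom_id, tensorHom_comp_tensorHom_assoc, Category.comp_id]
    _ = (α_ X Y Z).hom ≫ (f ⊗ₘ g ⊗ₘ h) ≫ _ ◁ eComp V b c d ≫ eComp V a b d := by
        rw [e, associator_naturality_assoc]
    _ = _ := by
        rw [← id_tensorHom, tensorHom_comp_tensorHom_assoc, Category.comp_id]

lemma vComp_assoc' (f : X ⟶ vHom V a b) (g : Y ⟶ vHom V b c) (h : Z ⟶ vHom V c d) :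
    vComp f (vComp g h) = (α_ X Y Z).inv ≫ vComp (vComp f g) h := by
  rw [vComp_assoc, Iso.inv_hom_id_assoc]

lemma id_vComp (f : X ⟶ vHom V a b) : vComp (eId V a) f = (λ_ X).hom ≫ f := by
  have e := e_id_comp V a b
  rw [Iso.inv_comp_eq, Category.comp_id] at e
  calc _ = 𝟙_ V ◁ f ≫ eId V a ▷ _ ≫ eComp V a a b := by
        rw [vComp, MonoidalCategory.tensorHom_def', Category.assoc]
    _ = _ := by rw [e, leftUnitor_naturality]

lemma vComp_id (f : X ⟶ vHom V a b) : vComp f (eId V b) = (ρ_ X).hom ≫ f := by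
  have e := e_comp_id V a b
  rw [Iso.inv_comp_eq, Category.comp_id] at e
  calc _ = f ▷ 𝟙_ V ≫ _ ◁ eId V b ≫ eComp V a b b := by
        rw [vComp, MonoidalCategory.tensorHom_def, Category.assoc]
    _ = _ := by rw [e, rightUnitor_naturality]

end

/-- Currying, with values in the hom-object of the self-enrichment of `V`. -/
def eCurry {A X B : V} (f : A ⊗ X ⟶ B) : X ⟶ vHom V A B := MonoidalClosed.curry f

/-- Uncurrying, from the hom-object of the self-enrichment of `V`. -/
def eUncurry {A X B : V} (f : X ⟶ vHom V A B) : A ⊗ X ⟶ B := MonoidalClosed.uncurry f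

lemma eUncurry_eCurry {A X B : V} (f : A ⊗ X ⟶ B) : eUncurry (eCurry f) = f :=
  MonoidalClosed.uncurry_curry f

lemma eCurry_eUncurry {A X B : V} (f : X ⟶ vHom V A B) : eCurry (eUncurry f) = f :=
  MonoidalClosed.curry_uncurry f

lemma eUncurry_injective {A X B : V} {f g : X ⟶ vHom V A B} (h : eUncurry f = eUncurry g) :
    f = g := MonoidalClosed.uncurry_injective h

lemma eUncurry_comp {A X Y B : V} (g : X ⟶ Y) (f : Y ⟶ vHom V A B) :
    eUncurry (g ≫ f) = A ◁ g ≫ eUncurry f :=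
  MonoidalClosed.uncurry_natural_left g f

lemma eUncurry_eId (A : V) : eUncurry (eId V A) = (ρ_ A).hom :=
  MonoidalClosed.uncurry_curry _

/-- Composition in the self-enrichment of `V`, on generalized elements. -/
lemma eUncurry_tensor_eComp {A B C X Y : V} (f : X ⟶ vHom V A B) (g : Y ⟶ vHom V B C) :
    eUncurry ((f ⊗ₘ g) ≫ eComp V A B C) =
      (α_ A X Y).inv ≫ eUncurry f ▷ Y ≫ eUncurry g := by
  have h : eUncurry (eComp V A B C) = (α_ _ _ _).inv ≫
      eUncurry (𝟙 (vHom V A B)) ▷ _ ≫ eUncurry (𝟙 (vHom V B C)) := by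
    refine (MonoidalClosed.uncurry_curry _).trans ?_
    change MonoidalClosed.compTranspose A B C = (α_ _ _ _).inv ≫
      MonoidalClosed.uncurry (𝟙 _) ▷ _ ≫ MonoidalClosed.uncurry (𝟙 _)
    rw [MonoidalClosed.uncurry_id_eq_ev, MonoidalClosed.uncurry_id_eq_ev]
    rfl
  have hf : eUncurry f = A ◁ f ≫ eUncurry (𝟙 _) := by rw [← eUncurry_comp, Category.comp_id]
  have hg : eUncurry g = B ◁ g ≫ eUncurry (𝟙 _) := by rw [← eUncurry_comp, Category.comp_id]
  rw [eUncurry_comp, h, hf, hg]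
  simp only [MonoidalCategory.tensorHom_def, comp_whiskerRight, MonoidalCategory.whiskerLeft_comp,
    Category.assoc]
  rw [associator_inv_naturality_right_assoc, whisker_exchange_assoc,
    associator_inv_naturality_middle_assoc]

end Basics

section HomFunctors

variable {V : Type u} [Category.{v} V] [MonoidalCategory V] [MonoidalClosed V]
variable {K : Type w₁} [EnrichedCategory V K] {M : Type w₂} [EnrichedCategory V M]
  {N : Type w₃} [EnrichedCategory V N]

/-- The action `F k ⊗ K(k, k') ⟶ F k'` of the hom-objects of `K` on a `V`-functor `F : K → V`. -/
def act (F : EnrichedFunctor V K V) (k k' : K) : F.obj k ⊗ vHom V k k' ⟶ F.obj k' :=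
  eUncurry (F.map k k')

/-- The covariant hom `V`-functor `M(m, -) : M → V`. -/
def homFrom (m : M) : EnrichedFunctor V M V where
  obj x := vHom V m x
  map x y := eCurry (eComp V m x y)
  map_id x := eUncurry_injective (by
    rw [eUncurry_comp, eUncurry_eCurry, eUncurry_eId]
    have := e_comp_id V m x
    rwa [Iso.inv_comp_eq, Category.comp_id] at this)
  map_comp x y z := eUncurry_injective (by
    rw [eUncurry_comp, eUncurry_eCurry, eUncurry_tensor_eComp, eUncurry_eCurry, eUncurry_eCurry]
    exact (e_assoc V m x y z).symm)

end HomFunctors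

section Limits

variable {V : Type u} [Category.{v} V] [MonoidalCategory V] [MonoidalClosed V]
variable {K : Type w₁} [EnrichedCategory V K] {M : Type w₂} [EnrichedCategory V M]
  {N : Type w₃} [EnrichedCategory V N]

/-- The generalized elements of stage `X` of the object `[K, V](P, M(m, L-))` of `V`-natural
transformations: families `X ⊗ P k ⟶ M(m, L k)` that are `V`-natural in `k`. -/
structure Family (X : V) (P : EnrichedFunctor V K V) (L : EnrichedFunctor V K M) (m : M) where
  app : ∀ k : K, X ⊗ P.obj k ⟶ vHom V m (L.obj k)
  naturality : ∀ k k' : K,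
    vComp (app k) (L.map k k') = (α_ _ _ _).hom ≫ X ◁ act P k k' ≫ app k'

/-- A `V`-natural transformation `P ⟶ M(m, L-)`, that is, a cylinder over `L` with vertex `m`,
weighted by `P`. -/
structure Cylinder (P : EnrichedFunctor V K V) (L : EnrichedFunctor V K M) (m : M) where
  app : ∀ k : K, P.obj k ⟶ vHom V m (L.obj k)
  naturality : ∀ k k' : K, vComp (app k) (L.map k k') = act P k k' ≫ app k'

/-- The cylinder `η : P ⟶ M(l, L-)` exhibits `l` as the limit `{P, L}` of `L` indexed by `P`:
composing with `η` gives, for every `m`, an isomorphism `M(m, l) ≅ [K, V](P, M(m, L-))` in `V`.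
This is spelled out on generalized elements `X ⟶ M(m, l)`. -/
def IsLim (P : EnrichedFunctor V K V) (L : EnrichedFunctor V K M) (l : M)
    (η : Cylinder P L l) : Prop :=
  ∀ (m : M) (X : V) (σ : Family X P L m),
    ∃! f : X ⟶ vHom V m l, ∀ k, vComp f (η.app k) = σ.app k

/-- The image of a cylinder under a `V`-functor. -/
def Cylinder.mapCyl {P : EnrichedFunctor V K V} {L : EnrichedFunctor V K M} {m : M}
    (η : Cylinder P L m) (T : EnrichedFunctor V M N) : Cylinder P (L.comp V T) (T.obj m) where
  app k := η.app k ≫ T.map m (L.obj k)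
  naturality k k' := by
    have h := η.naturality k k' =≫ T.map m (L.obj k')
    simp only [vComp] at h ⊢
    rw [Category.assoc, T.map_comp, tensorHom_comp_tensorHom_assoc, Category.assoc] at h
    exact h

/-- `T` preserves every limit of `L` indexed by `P`. -/
def PreservesLim (T : EnrichedFunctor V M N) (P : EnrichedFunctor V K V)
    (L : EnrichedFunctor V K M) : Prop :=
  ∀ (l : M) (η : Cylinder P L l), IsLim P L l η → IsLim P (L.comp V T) (T.obj l) (η.mapCyl T)

end Limits

section Colimits

variable {V : Type u} [Category.{v} V] [MonoidalCategory V] [SymmetricCategory V]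
  [MonoidalClosed V]
variable {K : Type w₁} [EnrichedCategory V K] {M : Type w₂} [EnrichedCategory V M]
  {N : Type w₃} [EnrichedCategory V N]

/-- The action `K(k, k') ⊗ W k' ⟶ W k` of the hom-objects of `K` on a presheaf `W : Kᵒᵖ → V`. -/
def coact (W : EnrichedFunctor V Kᵒᵖ V) (k k' : K) :
    vHom V k k' ⊗ W.obj (op k') ⟶ W.obj (op k) :=
  (β_ _ _).hom ≫ eUncurry (X := vHom V k k') (W.map (op k') (op k))

/-- The generalized elements of stage `X` of the object `[Kᵒᵖ, V](W, M(D-, m))` of `V`-natural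
transformations: families `W k ⊗ X ⟶ M(D k, m)` that are `V`-natural in `k`. -/
structure Cofamily (X : V) (W : EnrichedFunctor V Kᵒᵖ V) (D : EnrichedFunctor V K M) (m : M) where
  app : ∀ k : K, W.obj (op k) ⊗ X ⟶ vHom V (D.obj k) m
  naturality : ∀ k k' : K,
    vComp (D.map k k') (app k') = (α_ _ _ _).inv ≫ coact W k k' ▷ X ≫ app k

/-- A `V`-natural transformation `W ⟶ M(D-, m)` of presheaves on `K`, that is, a cocylinder
under `D` with vertex `m`, weighted by `W`. -/
structure Cocylinder (W : EnrichedFunctor V Kᵒᵖ V) (D : EnrichedFunctor V K M) (m : M) where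
  app : ∀ k : K, W.obj (op k) ⟶ vHom V (D.obj k) m
  naturality : ∀ k k' : K, vComp (D.map k k') (app k') = coact W k k' ≫ app k

/-- The cocylinder `η : W ⟶ M(D-, c)` exhibits `c` as the colimit `W * D` of `D` indexed by `W`:
composing with `η` gives, for every `m`, an isomorphism `M(c, m) ≅ [Kᵒᵖ, V](W, M(D-, m))` in `V`.
This is spelled out on generalized elements `X ⟶ M(c, m)`. -/
def IsColim (W : EnrichedFunctor V Kᵒᵖ V) (D : EnrichedFunctor V K M) (c : M)
    (η : Cocylinder W D c) : Prop :=
  ∀ (m : M) (X : V) (σ : Cofamily X W D m),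
    ∃! f : X ⟶ vHom V c m, ∀ k, vComp (η.app k) f = σ.app k

lemma IsColim.hom_ext {W : EnrichedFunctor V Kᵒᵖ V} {D : EnrichedFunctor V K M} {c : M}
    {η : Cocylinder W D c} (h : IsColim W D c η) {m : M} {X : V} {f g : X ⟶ vHom V c m}
    (e : ∀ k, vComp (η.app k) f = vComp (η.app k) g) : f = g := by
  have hσ : ∀ k k' : K, vComp (D.map k k') (vComp (η.app k') f) =
      (α_ _ _ _).inv ≫ coact W k k' ▷ X ≫ vComp (η.app k) f := by
    intro k k'
    rw [vComp_assoc', η.naturality, comp_vComp_left]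
  exact (h m X ⟨fun k => vComp (η.app k) f, hσ⟩).unique (fun _ => rfl) (fun k => (e k).symm)

/-- The image of a cocylinder under a `V`-functor. -/
def Cocylinder.mapCyl {W : EnrichedFunctor V Kᵒᵖ V} {D : EnrichedFunctor V K M} {m : M}
    (η : Cocylinder W D m) (T : EnrichedFunctor V M N) : Cocylinder W (D.comp V T) (T.obj m) where
  app k := η.app k ≫ T.map (D.obj k) m
  naturality k k' := by
    have h := η.naturality k k' =≫ T.map (D.obj k) m
    simp only [vComp] at h ⊢
    rw [Category.assoc, T.map_comp, tensorHom_comp_tensorHom_assoc, Category.assoc] at h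
    exact h

/-- `T` preserves every colimit of `D` indexed by `W`. -/
def PreservesColim (T : EnrichedFunctor V M N) (W : EnrichedFunctor V Kᵒᵖ V)
    (D : EnrichedFunctor V K M) : Prop :=
  ∀ (c : M) (η : Cocylinder W D c), IsColim W D c η →
    IsColim W (D.comp V T) (T.obj c) (η.mapCyl T)

end Colimits

section FunctorCategory

variable {V : Type u} [Category.{v} V] [MonoidalCategory V] [SymmetricCategory V]
  [MonoidalClosed V]
variable {K : Type v} [EnrichedCategory V K] {N : Type w₃} [EnrichedCategory V N]

/-- `V`-naturality of a family `X ⟶ N(F k, G k)` of generalized elements. -/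
def IsNat (F G : EnrichedFunctor V K N) {X : V} (app : ∀ k, X ⟶ vHom V (F.obj k) (G.obj k)) :
    Prop :=
  ∀ k k' : K, (β_ X (vHom V k k')).hom ≫ vComp (F.map k k') (app k') =
    vComp (app k) (G.map k k')

variable [HasLimits V]

/-- One of the two maps whose equalizer is the hom-object of the functor category. -/
def funHomLeft (F G : EnrichedFunctor V K N) :
    (∏ᶜ fun k : K => vHom V (F.obj k) (G.obj k)) ⟶
      ∏ᶜ fun p : K × K => vHom V (vHom V p.1 p.2) (vHom V (F.obj p.1) (G.obj p.2)) :=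
  Pi.lift fun p => eCurry (vComp (F.map p.1 p.2) (Pi.π _ p.2))

/-- The other map whose equalizer is the hom-object of the functor category. -/
def funHomRight (F G : EnrichedFunctor V K N) :
    (∏ᶜ fun k : K => vHom V (F.obj k) (G.obj k)) ⟶
      ∏ᶜ fun p : K × K => vHom V (vHom V p.1 p.2) (vHom V (F.obj p.1) (G.obj p.2)) :=
  Pi.lift fun p => eCurry ((β_ _ _).hom ≫ vComp (Pi.π _ p.1) (G.map p.1 p.2))

/-- The object `[K, N](F, G)` of `V` of `V`-natural transformations, as the end of
`N(F k, G k)` over `k`. -/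
def FunHom (F G : EnrichedFunctor V K N) : V := equalizer (funHomLeft F G) (funHomRight F G)

namespace FunHom

variable {F G : EnrichedFunctor V K N}

/-- The projections (counit) of the end. -/
def proj (F G : EnrichedFunctor V K N) (k : K) : FunHom F G ⟶ vHom V (F.obj k) (G.obj k) :=
  equalizer.ι (funHomLeft F G) (funHomRight F G) ≫ Pi.π _ k

lemma eCurry_comp {A X Y B : V} (g : X ⟶ Y) (f : A ⊗ Y ⟶ B) :
    g ≫ eCurry f = eCurry (A ◁ g ≫ f) :=
  (MonoidalClosed.curry_natural_left g f).symm

lemma isNat_aux {X : V} (g : X ⟶ ∏ᶜ fun k : K => vHom V (F.obj k) (G.obj k)) :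
    g ≫ funHomLeft F G = g ≫ funHomRight F G ↔ IsNat F G (fun k => g ≫ Pi.π _ k) := by
  have key : ∀ k k' : K, (eCurry (vComp (F.map k k') (g ≫ Pi.π _ k')) =
      eCurry ((β_ _ _).hom ≫ vComp (g ≫ Pi.π _ k) (G.map k k'))) ↔
      (β_ X (vHom V k k')).hom ≫ vComp (F.map k k') (g ≫ Pi.π _ k') =
        vComp (g ≫ Pi.π _ k) (G.map k k') := by
    intro k k'
    constructor
    · intro h
      have h' := congrArg eUncurry h
      rw [eUncurry_eCurry, eUncurry_eCurry] at h'
      rw [h', SymmetricCategory.symmetry_assoc]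
    · intro h
      rw [← h, SymmetricCategory.symmetry_assoc]
  constructor
  · intro h k k'
    refine (key k k').1 ?_
    have h' := h =≫ Pi.π _ (k, k')
    simp only [funHomLeft, funHomRight, Category.assoc, Pi.lift_π, eCurry_comp] at h'
    rw [comp_vComp_right, comp_vComp_left, ← braiding_naturality_right_assoc]
    exact h'
  · intro h
    refine Pi.hom_ext _ _ fun p => ?_
    have h' := (key p.1 p.2).2 (h p.1 p.2)
    simp only [funHomLeft, funHomRight, Category.assoc, Pi.lift_π, eCurry_comp]
    rw [comp_vComp_right, comp_vComp_left, ← braiding_naturality_right_assoc] at h'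
    exact h'

lemma proj_isNat (F G : EnrichedFunctor V K N) : IsNat F G (proj F G) :=
  (isNat_aux _).1 (equalizer.condition _ _)

/-- The universal property of the end: existence. -/
def lift {X : V} (app : ∀ k, X ⟶ vHom V (F.obj k) (G.obj k)) (h : IsNat F G app) :
    X ⟶ FunHom F G :=
  equalizer.lift (Pi.lift app) ((isNat_aux _).2 (by simpa using h))

lemma lift_proj {X : V} (app : ∀ k, X ⟶ vHom V (F.obj k) (G.obj k)) (h : IsNat F G app) (k : K) :
    lift app h ≫ proj F G k = app k := by
  exact (equalizer.lift_ι_assoc (Pi.lift app) ((isNat_aux _).2 (by simpa using h)) _).trans (Pi.lift_π _ _)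

/-- The universal property of the end: uniqueness. -/
lemma hom_ext {X : V} {f g : X ⟶ FunHom F G} (h : ∀ k, f ≫ proj F G k = g ≫ proj F G k) :
    f = g := by
  refine equalizer.hom_ext (Pi.hom_ext _ _ fun k => ?_)
  exact (Category.assoc _ _ _).trans ((h k).trans (Category.assoc _ _ _).symm)

end FunHom

lemma isNat_id (F : EnrichedFunctor V K N) : IsNat F F (fun k => eId V (F.obj k)) := by
  intro k k'
  rw [id_vComp, vComp_id]
  simp

lemma isNat_vComp {F G H : EnrichedFunctor V K N} {X Y : V}
    {a : ∀ k, X ⟶ vHom V (F.obj k) (G.obj k)} {b : ∀ k, Y ⟶ vHom V (G.obj k) (H.obj k)}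
    (ha : IsNat F G a) (hb : IsNat G H b) : IsNat F H (fun k => vComp (a k) (b k)) := by
  intro k k'
  rw [vComp_assoc, ← hb k k', comp_vComp_right, vComp_assoc', vComp_assoc', ← ha k k',
    comp_vComp_left,
    braiding_tensor_left_hom]
  simp only [Category.assoc, Iso.hom_inv_id_assoc]

/-- The `V`-category `[K, N]` of `V`-functors on a small `V`-category `K`. -/
instance functorCategory : EnrichedCategory V (EnrichedFunctor V K N) where
  Hom F G := FunHom F G
  id F := FunHom.lift (fun k => eId V (F.obj k)) (isNat_id F)
  comp F G H := FunHom.lift (fun k => vComp (FunHom.proj F G k) (FunHom.proj G H k))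
    (isNat_vComp (FunHom.proj_isNat F G) (FunHom.proj_isNat G H))
  id_comp F G := FunHom.hom_ext fun k => by
    simp only [Category.assoc, FunHom.lift_proj, Category.id_comp]
    rw [← comp_vComp_left, FunHom.lift_proj, id_vComp, Iso.inv_hom_id_assoc]
  comp_id F G := FunHom.hom_ext fun k => by
    simp only [Category.assoc, FunHom.lift_proj, Category.id_comp]
    rw [← comp_vComp_right, FunHom.lift_proj, vComp_id, Iso.inv_hom_id_assoc]
  assoc F G H L := FunHom.hom_ext fun k => by
    simp only [Category.assoc, FunHom.lift_proj]
    rw [← comp_vComp_left, ← comp_vComp_right, FunHom.lift_proj, FunHom.lift_proj, vComp_assoc,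
      Iso.inv_hom_id_assoc]

/-- The projection `[K, N](F, G) ⟶ N(F k, G k)`. -/
def natProj (F G : EnrichedFunctor V K N) (k : K) : vHom V F G ⟶ vHom V (F.obj k) (G.obj k) :=
  FunHom.proj F G k

/-- The morphism `X ⟶ [K, N](F, G)` induced by a `V`-natural family `X ⟶ N(F k, G k)`. -/
def natLift {F G : EnrichedFunctor V K N} {X : V}
    (app : ∀ k, X ⟶ vHom V (F.obj k) (G.obj k)) (h : IsNat F G app) : X ⟶ vHom V F G :=
  FunHom.lift app h

lemma natLift_proj {F G : EnrichedFunctor V K N} {X : V}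
    (app : ∀ k, X ⟶ vHom V (F.obj k) (G.obj k)) (h : IsNat F G app) (k : K) :
    natLift app h ≫ natProj F G k = app k :=
  FunHom.lift_proj app h k

lemma nat_hom_ext {F G : EnrichedFunctor V K N} {X : V} {f g : X ⟶ vHom V F G}
    (h : ∀ k, f ≫ natProj F G k = g ≫ natProj F G k) : f = g :=
  FunHom.hom_ext h

lemma natProj_isNat (F G : EnrichedFunctor V K N) : IsNat F G (natProj F G) :=
  FunHom.proj_isNat F G

lemma eComp_natProj (F G H : EnrichedFunctor V K N) (k : K) :
    eComp V F G H ≫ natProj F H k = vComp (natProj F G k) (natProj G H k) :=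
  FunHom.lift_proj _ (isNat_vComp (FunHom.proj_isNat F G) (FunHom.proj_isNat G H)) k

lemma vComp_natProj {F G H : EnrichedFunctor V K N} {X Y : V} (f : X ⟶ vHom V F G)
    (g : Y ⟶ vHom V G H) (k : K) :
    vComp f g ≫ natProj F H k = vComp (f ≫ natProj F G k) (g ≫ natProj G H k) := by
  rw [comp_vComp, ← eComp_natProj, vComp, Category.assoc]

lemma eId_natProj (F : EnrichedFunctor V K N) (k : K) :
    eId V F ≫ natProj F F k = eId V (F.obj k) :=
  FunHom.lift_proj _ (isNat_id F) k

end FunctorCategory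

section RestrictedYoneda

lemma braiding_coherence {V : Type u} [Category.{v} V] [MonoidalCategory V] [SymmetricCategory V]
    (A P Q : V) : A ◁ (β_ P Q).hom ≫ (β_ A (Q ⊗ P)).hom =
      (α_ A P Q).inv ≫ (β_ A P).hom ▷ Q ≫ (β_ (P ⊗ A) Q).hom ≫ (α_ Q P A).inv := by
  rw [braiding_naturality_right, braiding_tensor_right_hom, braiding_tensor_left_hom]
  simp only [Category.assoc, Iso.hom_inv_id, Category.comp_id]

lemma braiding_coherence' {V : Type u} [Category.{v} V] [MonoidalCategory V] [SymmetricCategory V]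
    (A X Q : V) : A ◁ (β_ X Q).hom ≫ (α_ A Q X).inv ≫ (β_ A Q).hom ▷ X =
      (α_ A X Q).inv ≫ (β_ (A ⊗ X) Q).hom ≫ (α_ Q A X).inv := by
  rw [braiding_tensor_left_hom]
  simp

variable {V : Type u} [Category.{v} V] [MonoidalCategory V] [SymmetricCategory V]
  [MonoidalClosed V]

section

variable {J : Type w₁} [EnrichedCategory V J] {M : Type w₂} [EnrichedCategory V M]

lemma map_vComp (T : EnrichedFunctor V J M) {a b c : J} {X Y : V} (f : X ⟶ vHom V a b)
    (g : Y ⟶ vHom V b c) :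
    vComp f g ≫ T.map a c = vComp (f ≫ T.map a b) (g ≫ T.map b c) := by
  rw [vComp, Category.assoc, T.map_comp, comp_vComp]
  rfl

/-- For `i : J → M`, the presheaf `M(i-, m)` on `J`. -/
def restrictedHom (i : EnrichedFunctor V J M) (m : M) : EnrichedFunctor V Jᵒᵖ V where
  obj j := vHom V (i.obj j.unop) m
  map j j' := eCurry (X := vHom V j'.unop j.unop)
    ((β_ _ _).hom ≫ vComp (i.map j'.unop j.unop) (𝟙 (vHom V (i.obj j.unop) m)))
  map_id j := eUncurry_injective (by
    refine (eUncurry_comp (eId V j.unop) _).trans ?_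
    rw [eUncurry_eCurry, eUncurry_eId, braiding_naturality_right_assoc, ← comp_vComp_left,
      i.map_id, id_vComp]
    simp)
  map_comp x y z := eUncurry_injective (by
    refine (eUncurry_comp (X := vHom V y.unop x.unop ⊗ vHom V z.unop y.unop)
      (Y := vHom V z.unop x.unop) _ _).trans ?_
    refine Eq.trans ?_ (eUncurry_tensor_eComp (X := vHom V y.unop x.unop)
      (Y := vHom V z.unop y.unop) _ _).symm
    rw [eUncurry_eCurry, eUncurry_eCurry, eUncurry_eCurry, eComp_op_eq]
    have e : eComp V z.unop y.unop x.unop ≫ i.map z.unop x.unop =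
        vComp (i.map z.unop y.unop) (i.map y.unop x.unop) := i.map_comp _ _ _
    rw [MonoidalCategory.whiskerLeft_comp, Category.assoc, braiding_naturality_right_assoc,
      ← comp_vComp_left, e, comp_whiskerRight, Category.assoc, braiding_naturality_left_assoc,
      ← comp_vComp_right, Category.comp_id]
    have e2 : vComp (i.map z.unop y.unop) (vComp (i.map y.unop x.unop)
        (𝟙 (vHom V (i.obj x.unop) m))) = (α_ _ _ _).inv ≫ vComp (vComp (i.map z.unop y.unop)
          (i.map y.unop x.unop)) (𝟙 (vHom V (i.obj x.unop) m)) := vComp_assoc' _ _ _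
    rw [e2]
    have e3 := braiding_coherence (vHom V (i.obj x.unop) m) (vHom V y.unop x.unop)
      (vHom V z.unop y.unop) =≫ vComp (vComp (i.map z.unop y.unop)
          (i.map y.unop x.unop)) (𝟙 (vHom V (i.obj x.unop) m))
    simp only [Category.assoc] at e3
    exact e3)

lemma coact_restrictedHom (i : EnrichedFunctor V J M) (m : M) (j j' : J) :
    coact (restrictedHom i m) j j' = vComp (i.map j j') (𝟙 (vHom V (i.obj j') m)) := by
  rw [coact]
  refine (congrArg (fun t => (β_ _ _).hom ≫ t) (eUncurry_eCurry _)).trans ?_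
  exact SymmetricCategory.symmetry_assoc _ _ _

end

lemma whisker_vComp_id {M : Type w₂} [EnrichedCategory V M] {a b c : M} {X Y : V} (t : X ⟶ Y)
    (f : Y ⟶ vHom V a b) :
    (t ≫ f) ▷ vHom V b c ≫ vComp (𝟙 (vHom V a b)) (𝟙 (vHom V b c)) =
      t ▷ vHom V b c ≫ vComp f (𝟙 (vHom V b c)) := by
  rw [← comp_vComp_left, Category.comp_id, comp_vComp_left]

lemma whisker_braiding_vComp {M : Type w₂} [EnrichedCategory V M] {x y m n : M} {Q : V}
    (f : Q ⟶ vHom V y x) :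
    vComp (𝟙 (vHom V x m)) (𝟙 (vHom V m n)) ▷ Q ≫ (β_ _ _).hom ≫ vComp f (𝟙 (vHom V x n)) =
      (β_ _ _).hom ≫ (α_ _ _ _).inv ≫ vComp (vComp f (𝟙 (vHom V x m))) (𝟙 (vHom V m n)) := by
  rw [braiding_naturality_left_assoc, ← comp_vComp_right, Category.comp_id, vComp_assoc']

variable [HasLimits V]
variable {J : Type v} [EnrichedCategory V J] {M : Type w₂} [EnrichedCategory V M]

/-- The component at `j` of the action `M(m, n) ⟶ [Jᵒᵖ, V](M(i-, m), M(i-, n))`. -/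
def restrictedApp (i : EnrichedFunctor V J M) (m n : M) (j : Jᵒᵖ) :
    vHom V m n ⟶ vHom V ((restrictedHom i m).obj j) ((restrictedHom i n).obj j) :=
  (homFrom (i.obj j.unop)).map m n

lemma restrictedApp_isNat (i : EnrichedFunctor V J M) (m n : M) :
    IsNat (restrictedHom i m) (restrictedHom i n) (restrictedApp i m n) := by
  intro j j'
  refine eUncurry_injective ?_
  refine (eUncurry_comp (X := vHom V m n ⊗ vHom V j'.unop j.unop) _ _).trans ?_
  refine (congrArg (fun t => _ ◁ (β_ (vHom V m n) (vHom V j'.unop j.unop)).hom ≫ t)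
    (eUncurry_tensor_eComp (X := vHom V j'.unop j.unop) _ _)).trans ?_
  refine Eq.trans ?_ (eUncurry_tensor_eComp (Y := vHom V j'.unop j.unop) _ _).symm
  have h1 : ∀ k : J, eUncurry (restrictedApp i m n (op k)) =
      vComp (𝟙 (vHom V (i.obj k) m)) (𝟙 (vHom V m n)) := fun k => by
    refine (eUncurry_eCurry _).trans ?_
    rw [vComp, id_tensorHom_id, Category.id_comp]
  have h2 : ∀ x : M, eUncurry (X := vHom V j'.unop j.unop) ((restrictedHom i x).map j j') =
      (β_ _ _).hom ≫ vComp (i.map j'.unop j.unop) (𝟙 (vHom V (i.obj j.unop) x)) := fun x =>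
    eUncurry_eCurry _
  rw [h2, h2]
  set A := vHom V (i.obj j.unop) m
  set Q := vHom V j'.unop j.unop
  set c := vComp (vComp (i.map j'.unop j.unop) (𝟙 A)) (𝟙 (vHom V m n))
  have e1 : ((β_ A Q).hom ≫ vComp (i.map j'.unop j.unop) (𝟙 A)) ▷ vHom V m n ≫
      eUncurry (restrictedApp i m n j') = (β_ A Q).hom ▷ vHom V m n ≫ c := by
    exact (congrArg (fun t => _ ≫ t) (h1 j'.unop)).trans (whisker_vComp_id _ _)
  have e2 : eUncurry (restrictedApp i m n j) ▷ Q ≫ (β_ _ _).hom ≫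
      vComp (i.map j'.unop j.unop) (𝟙 (vHom V (i.obj j.unop) n)) =
      (β_ _ _).hom ≫ (α_ _ _ _).inv ≫ c := by
    refine (congrArg (fun t => t ▷ Q ≫ (β_ _ _).hom ≫
      vComp (i.map j'.unop j.unop) (𝟙 (vHom V (i.obj j.unop) n))) (h1 j.unop)).trans ?_
    exact whisker_braiding_vComp _
  refine (congrArg (fun t => A ◁ (β_ (vHom V m n) Q).hom ≫ (α_ _ _ _).inv ≫ t) e1).trans ?_
  refine Eq.trans ?_ (congrArg (fun t => (α_ _ _ _).inv ≫ t) e2).symm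
  have e3 := braiding_coherence' A (vHom V m n) Q =≫ c
  simp only [Category.assoc] at e3
  exact e3

/-- For `i : J → M` with `J` small, the `V`-functor `M → [Jᵒᵖ, V]`, `m ↦ M(i-, m)`. -/
def restrictedYoneda (i : EnrichedFunctor V J M) :
    EnrichedFunctor V M (EnrichedFunctor V Jᵒᵖ V) where
  obj m := restrictedHom i m
  map m n := natLift (restrictedApp i m n) (restrictedApp_isNat i m n)
  map_id m := nat_hom_ext fun j => by
    rw [Category.assoc, natLift_proj, eId_natProj]
    exact EnrichedFunctor.map_id (homFrom (i.obj j.unop)) m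
  map_comp x y z := nat_hom_ext fun j => by
    rw [Category.assoc, natLift_proj, Category.assoc, eComp_natProj, ← comp_vComp, natLift_proj,
      natLift_proj]
    exact EnrichedFunctor.map_comp (homFrom (i.obj j.unop)) x y z

end RestrictedYoneda

section Tensor

variable {V : Type u} [Category.{v} V] [MonoidalCategory V] [SymmetricCategory V]
  [MonoidalClosed V]
variable {A : Type v} [EnrichedCategory V A]

/-- All the colimits `F * G` in `V`, for `G : A → V`, exist. -/
def HasTensors (F : EnrichedFunctor V Aᵒᵖ V) : Prop :=
  ∀ G : EnrichedFunctor V A V, ∃ (c : V) (η : Cocylinder F G c), IsColim F G c η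

variable {F : EnrichedFunctor V Aᵒᵖ V} (h : HasTensors F)

/-- A choice of the colimit `F * G`. -/
def tensorObj (G : EnrichedFunctor V A V) : V := (h G).choose

/-- The unit of the colimit `F * G`. -/
def tensorUnit (G : EnrichedFunctor V A V) : Cocylinder F G (tensorObj h G) :=
  (h G).choose_spec.choose

lemma isColim_tensor (G : EnrichedFunctor V A V) :
    IsColim F G (tensorObj h G) (tensorUnit h G) :=
  (h G).choose_spec.choose_spec

variable [HasLimits V]

/-- The family inducing the action of `F * -` on hom-objects. -/
def tensorFamily (G H : EnrichedFunctor V A V) :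
    Cofamily (vHom V G H) F G (tensorObj h H) where
  app a := (β_ _ _).hom ≫ vComp (natProj G H a) ((tensorUnit h H).app a)
  naturality a a' := by
    rw [comp_vComp_right, vComp_assoc']
    have e := natProj_isNat G H a a'
    rw [← SymmetricCategory.symmetry_assoc (vHom V a a') (vHom V G H)
      (vComp (G.map a a') (natProj G H a')), e]
    rw [comp_vComp_left, vComp_assoc, (tensorUnit h H).naturality, comp_vComp_right,
      braiding_naturality_left_assoc, braiding_tensor_left_hom]
    simp only [Category.assoc, Iso.inv_hom_id_assoc]

/-- The action of `F * -` on hom-objects. -/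
def tensorMap (G H : EnrichedFunctor V A V) :
    vHom V G H ⟶ vHom V (tensorObj h G) (tensorObj h H) :=
  (isColim_tensor h G (tensorObj h H) (vHom V G H) (tensorFamily h G H)).choose

lemma unit_tensorMap (G H : EnrichedFunctor V A V) (a : A) :
    vComp ((tensorUnit h G).app a) (tensorMap h G H) =
      (β_ _ _).hom ≫ vComp (natProj G H a) ((tensorUnit h H).app a) :=
  (isColim_tensor h G (tensorObj h H) (vHom V G H) (tensorFamily h G H)).choose_spec.1 a

/-- The `V`-functor `F * - : [A, V] → V`, the left Kan extension of `F` along the Yoneda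
embedding `Aᵒᵖ → [A, V]`. -/
def tensorFunctor : EnrichedFunctor V (EnrichedFunctor V A V) V where
  obj G := tensorObj h G
  map G H := tensorMap h G H
  map_id G := (isColim_tensor h G).hom_ext fun a => by
    rw [comp_vComp_right, unit_tensorMap, braiding_naturality_right_assoc, ← comp_vComp_left,
      eId_natProj, id_vComp, vComp_id]
    simp
  map_comp G H L := (isColim_tensor h G).hom_ext fun a => by
    have e : (tensorMap h G H ⊗ₘ tensorMap h H L) ≫ eComp V _ _ _ =
      vComp (tensorMap h G H) (tensorMap h H L) := rfl
    rw [e, comp_vComp_right, unit_tensorMap, braiding_naturality_right_assoc, ← comp_vComp_left,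
      eComp_natProj, vComp_assoc', unit_tensorMap, comp_vComp_left, vComp_assoc, vComp_assoc,
      unit_tensorMap, comp_vComp_right, braiding_tensor_right_hom]
    simp only [Category.assoc, Iso.inv_hom_id_assoc]

end Tensor

section Flat

variable (V : Type u) [Category.{v} V] [MonoidalCategory V] [SymmetricCategory V]
  [MonoidalClosed V]

/-- A family of indexes for limits: a class of `V`-functors `K → V` on small `V`-categories. -/
abbrev LimIndexes := ∀ (K : Type v) [EnrichedCategory V K], EnrichedFunctor V K V → Prop

/-- A family of indexes for colimits: a class of presheaves `Kᵒᵖ → V` on small `V`-categories. -/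
abbrev ColimIndexes := ∀ (K : Type v) [EnrichedCategory V K], EnrichedFunctor V Kᵒᵖ V → Prop

variable {V}

/-- A presheaf `F : Aᵒᵖ → V` is `P`-flat when its left Kan extension along the Yoneda embedding,
`F * - : [A, V] → V`, preserves all `P`-limits. The colimits `F * G` are required to exist, which
is automatic when `V` is cocomplete. -/
def Flat [HasLimits V] (P : LimIndexes V) : ColimIndexes V := fun A _ F =>
  ∃ h : HasTensors F, ∀ (K : Type v) [EnrichedCategory V K] (W : EnrichedFunctor V K V),
    P K W → ∀ L : EnrichedFunctor V K (EnrichedFunctor V A V), PreservesLim (tensorFunctor h) W L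

/-- The type `J` with the `V`-category structure induced by a map `g : J → M`. -/
@[nolint unusedArguments]
def Induced {J : Type w₁} {M : Type w₂} (_g : J → M) : Type w₁ := J

instance {J : Type w₁} {M : Type w₂} [EnrichedCategory V M] (g : J → M) :
    EnrichedCategory V (Induced g) where
  Hom x y := vHom V (g x) (g y)
  id x := eId V (g x)
  comp x y z := eComp V (g x) (g y) (g z)
  id_comp x y := e_id_comp V (g x) (g y)
  comp_id x y := e_comp_id V (g x) (g y)
  assoc x y z t := e_assoc V (g x) (g y) (g z) (g t)

/-- The fully faithful `V`-functor `Induced g → M`. -/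
def inclusion {J : Type w₁} {M : Type w₂} [EnrichedCategory V M] (g : J → M) :
    EnrichedFunctor V (Induced g) M where
  obj x := g x
  map x y := 𝟙 (vHom V (g x) (g y))
  map_id x := Category.comp_id _
  map_comp x y z := by
    have h : ∀ {A B C : V} (t : A ⊗ B ⟶ C), t ≫ 𝟙 C = (𝟙 A ⊗ₘ 𝟙 B) ≫ t := fun t => by simp
    exact h (eComp V (g x) (g y) (g z))

/-- The full subcategory `Flat_P(A)` of `[Aᵒᵖ, V]` with objects the `P`-flat presheaves. -/
abbrev FlatCat [HasLimits V] (P : LimIndexes V) (A : Type v) [EnrichedCategory V A] :=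
  Induced (Subtype.val : {F : EnrichedFunctor V Aᵒᵖ V // Flat P A F} → EnrichedFunctor V Aᵒᵖ V)

/-- A `V`-functor is fully faithful when it is invertible on hom-objects. -/
def FullyFaithful {M : Type w₁} [EnrichedCategory V M] {N : Type w₂} [EnrichedCategory V N]
    (T : EnrichedFunctor V M N) : Prop :=
  ∀ x y : M, IsIso (T.map x y)

variable (V) in
/-- `M` and `N` are equivalent `V`-categories: there is a fully faithful `V`-functor `M → N` that
is essentially surjective on the underlying categories. -/
def EquivalentCats (M : Type w₁) [EnrichedCategory V M] (N : Type w₂) [EnrichedCategory V N] :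
    Prop :=
  ∃ T : EnrichedFunctor V M N, FullyFaithful T ∧ T.forget.EssSurj

/-- `M` has `Q`-colimits. -/
def HasColims (Q : ColimIndexes V) (M : Type w₁) [EnrichedCategory V M] : Prop :=
  ∀ (K : Type v) [EnrichedCategory V K] (W : EnrichedFunctor V Kᵒᵖ V), Q K W →
    ∀ D : EnrichedFunctor V K M, ∃ (c : M) (η : Cocylinder W D c), IsColim W D c η

/-- A `V`-functor is `Q`-cocontinuous when it preserves `Q`-colimits. -/
def Cocontinuous (Q : ColimIndexes V) {M : Type w₁} [EnrichedCategory V M] {N : Type w₂}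
    [EnrichedCategory V N] (T : EnrichedFunctor V M N) : Prop :=
  ∀ (K : Type v) [EnrichedCategory V K] (W : EnrichedFunctor V Kᵒᵖ V), Q K W →
    ∀ D : EnrichedFunctor V K M, PreservesColim T W D

/-- An object `g` of `M` is `Q`-presentable when `M(g, -)` is `Q`-cocontinuous. -/
def Presentable (Q : ColimIndexes V) {M : Type w₁} [EnrichedCategory V M] (g : M) : Prop :=
  Cocontinuous Q (homFrom (V := V) g)

/-- A `V`-functor `i : J → M` with `J` small is dense when `m ↦ M(i-, m)` is fully faithful. -/
def Dense [HasLimits V] {J : Type v} [EnrichedCategory V J] {M : Type w₁} [EnrichedCategory V M]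
    (i : EnrichedFunctor V J M) : Prop :=
  FullyFaithful (restrictedYoneda i)

/-- `M` is `Q`-accessible: it has `Q`-colimits, and a small set of `Q`-presentable objects,
given as a family `g : J → M` with `J` small, such that the inclusion `i` of the full
subcategory that it generates is dense and every object of `M` is a `Q`-colimit `q * i`.
(Repetitions in the family change the generated subcategory only up to equivalence.) -/
def Accessible [HasLimits V] (Q : ColimIndexes V) (M : Type w₁) [EnrichedCategory V M] : Prop :=
  HasColims Q M ∧ ∃ (J : Type v) (g : J → M),
    (∀ j, Presentable Q (g j)) ∧ Dense (inclusion (V := V) g) ∧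
    ∀ m : M, ∃ q : EnrichedFunctor V (Induced g)ᵒᵖ V, Q (Induced g) q ∧
      ∃ η : Cocylinder q (inclusion g) m, IsColim q (inclusion g) m η

end Flat

end EnrichedFlat

end

noncomputable section

namespace EnrichedFlat

/-! ### Hom-object actions attached to `V`-valued functors -/

section Actions

variable {V : Type u} [Category.{v} V] [MonoidalCategory V] [MonoidalClosed V]
variable {K : Type w₁} [EnrichedCategory V K] {M : Type w₂} [EnrichedCategory V M]
  {N : Type w₃} [EnrichedCategory V N]

/-! Accessible implies flat. Let `i` be the inclusion of the generators. Density says that `m ↦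
M(i-, m)` is fully faithful, so only its essential image has to be found. If `m = q * i` with `q`
flat, presentability of the generators lets `M(i j, -)` pass through the colimit, and since `i` is
fully faithful, the co-Yoneda formula gives `M(i j, m) ≅ q * M(i j, i-) ≅ q j`. Thus the unit `q ⟶
M(i-, m)` is invertible (`IsColim.isIso_app`). Applied to the presentation of an arbitrary `m`, this
shows that `M(i-, m)` is flat; applied to the colimit `F * i` of an arbitrary flat `F`, it shows
that `F` lies in the image.

Flat implies accessible. Regard `M` as a full subcategory `U : M → [Aᵒᵖ, V]` whose objects are, up
to isomorphism, the flat presheaves. The main point is that flat presheaves are closed under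
flat-indexed colimits (`flat_of_pointwise`): from `(W * D) * G ≅ W * (D - * G)`, the functor `(W *
D) * -` is a composite `[A, V] → [K, V] → V`, whose first factor preserves `P`-limits because each
`D k` is flat, and whose second factor does so because `W` is flat. Hence `M` has flat-indexed
colimits and `U` preserves them. Representables are flat, because tensoring with one is evaluation,
which preserves every limit (`preservesLim_evalFunctor`). They serve as generators: by Yoneda `M(g
a, -)` is `U` followed by evaluation at `a`, and evaluation preserves flat-indexed colimits because
these are pointwise; a natural transformation `M(i-, m) ⟶ M(i-, m')` is the same as one `U m ⟶ U
m'`, so each `m` is the canonical colimit of generators, which also gives density. Its weight `M(i-,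
m)` is `U m` carried along the isomorphism from `A` to the category of generators, and so it is flat
(`Flat.reindex`).

Cocompleteness of `V` is never needed. Flatness of a weight `W` includes the existence of all
colimits `W * G` in `V`, and from these the pointwise colimits in presheaf categories are built
(`HasTensors.exists_pointwise_isColim`).

All universal properties are stated on generalized elements. For diagrams in `V` they are reduced to
ordinary universal properties by `isColim_iff` and `isLim_iff`. -/

lemma eCurry_injective {A X B : V} {f g : A ⊗ X ⟶ B} (h : eCurry f = eCurry g) : f = g := by
  rw [← eUncurry_eCurry f, h, eUncurry_eCurry]

lemma eUncurry_vComp {A B C X Y : V} (f : X ⟶ vHom V A B) (g : Y ⟶ vHom V B C) :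
    eUncurry (vComp f g) = (α_ A X Y).inv ≫ eUncurry f ▷ Y ≫ eUncurry g :=
  eUncurry_tensor_eComp f g

lemma eUncurry_comp_map (F : EnrichedFunctor V K V) {k k' : K} {X : V} (f : X ⟶ vHom V k k') :
    eUncurry (f ≫ F.map k k') = F.obj k ◁ f ≫ act F k k' :=
  eUncurry_comp _ _

lemma act_id (F : EnrichedFunctor V K V) (k : K) :
    F.obj k ◁ eId V k ≫ act F k k = (ρ_ (F.obj k)).hom := by
  rw [← eUncurry_comp_map, F.map_id, eUncurry_eId]

lemma act_comp (F : EnrichedFunctor V K V) (a b c : K) :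
    F.obj a ◁ eComp V a b c ≫ act F a c =
      (α_ _ _ _).inv ≫ act F a b ▷ vHom V b c ≫ act F b c := by
  rw [← eUncurry_comp_map, F.map_comp]
  exact eUncurry_tensor_eComp _ _

lemma act_functorComp (D : EnrichedFunctor V K M) (T : EnrichedFunctor V M V) (k k' : K) :
    act (D.comp V T) k k' = T.obj (D.obj k) ◁ D.map k k' ≫ act T (D.obj k) (D.obj k') :=
  eUncurry_comp _ _

lemma act_homFrom (m x y : M) : act (homFrom (V := V) m) x y = eComp V m x y :=
  eUncurry_eCurry _

end Actions

section Braiding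

variable {V : Type u} [Category.{v} V] [MonoidalCategory V] [SymmetricCategory V]

lemma braiding_whiskerRight_cancel (X Y : V) {Z W : V} (h : (X ⊗ Y) ⊗ Z ⟶ W) :
    (β_ X Y).hom ▷ Z ≫ (β_ Y X).hom ▷ Z ≫ h = h := by
  rw [← comp_whiskerRight_assoc, SymmetricCategory.symmetry, id_whiskerRight, Category.id_comp]

lemma braiding_whiskerLeft_cancel (X Y : V) {Z W : V} (h : Z ⊗ X ⊗ Y ⟶ W) :
    Z ◁ (β_ X Y).hom ≫ Z ◁ (β_ Y X).hom ≫ h = h := by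
  rw [← MonoidalCategory.whiskerLeft_comp_assoc, SymmetricCategory.symmetry,
    MonoidalCategory.whiskerLeft_id, Category.id_comp]

end Braiding

/-! ### Left actions on presheaves, and colimits in `V` as universal balanced families -/

section Presheaves

variable {V : Type u} [Category.{v} V] [MonoidalCategory V] [SymmetricCategory V]
  [MonoidalClosed V]
variable {K : Type w₁} [EnrichedCategory V K] {M : Type w₂} [EnrichedCategory V M]

lemma coact_eq (W : EnrichedFunctor V Kᵒᵖ V) (k k' : K) :
    coact W k k' = (β_ (vHom V k k') (W.obj (op k'))).hom ≫ act W (op k') (op k) := rfl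

lemma act_op_eq (W : EnrichedFunctor V Kᵒᵖ V) (k k' : K) :
    act W (op k') (op k) = (β_ (W.obj (op k')) (vHom V k k')).hom ≫ coact W k k' :=
  (SymmetricCategory.symmetry_assoc _ _ _).symm

lemma coact_id (W : EnrichedFunctor V Kᵒᵖ V) (k : K) :
    eId V k ▷ W.obj (op k) ≫ coact W k k = (λ_ (W.obj (op k))).hom := by
  have h : W.obj (op k) ◁ eId V k ≫ act W (op k) (op k) = (ρ_ (W.obj (op k))).hom :=
    act_id W (op k)
  rw [coact_eq, braiding_naturality_left_assoc, h, braiding_rightUnitor]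

/-- This is functoriality of `W` with the braiding in the composition of `Kᵒᵖ` absorbed: in the form
`coact` it becomes plain associativity of a left action. -/
lemma coact_comp (W : EnrichedFunctor V Kᵒᵖ V) (a b c : K) :
    eComp V a b c ▷ W.obj (op c) ≫ coact W a c =
      (α_ _ _ _).hom ≫ vHom V a b ◁ coact W b c ≫ coact W a b := by
  have h : W.obj (op c) ◁ ((β_ (vHom V b c) (vHom V a b)).hom ≫ eComp V a b c) ≫
      act W (op c) (op a) = (α_ _ (vHom V b c) (vHom V a b)).inv ≫
        act W (op c) (op b) ▷ vHom V a b ≫ act W (op b) (op a) := act_comp W (op c) (op b) (op a)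
  rw [coact_eq W a c, braiding_naturality_left_assoc]
  have h' : W.obj (op c) ◁ eComp V a b c ≫ act W (op c) (op a) =
      W.obj (op c) ◁ (β_ (vHom V a b) (vHom V b c)).hom ≫ (α_ _ (vHom V b c) (vHom V a b)).inv ≫
        act W (op c) (op b) ▷ vHom V a b ≫ act W (op b) (op a) := by
    rw [← h, ← MonoidalCategory.whiskerLeft_comp_assoc, SymmetricCategory.symmetry_assoc]
  rw [h', act_op_eq W b c, act_op_eq W a b, comp_whiskerRight, Category.assoc,
    braiding_naturality_left_assoc]
  -- The braidings compose to the identity permutation of the three factors, so only the associator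
  -- remains.
  have e : (β_ (vHom V a b ⊗ vHom V b c) (W.obj (op c))).hom ≫
      W.obj (op c) ◁ (β_ (vHom V a b) (vHom V b c)).hom ≫ (α_ _ _ _).inv ≫
      (β_ (W.obj (op c)) (vHom V b c)).hom ▷ vHom V a b ≫
      (β_ (vHom V b c ⊗ W.obj (op c)) (vHom V a b)).hom = (α_ _ _ _).hom := by
    rw [braiding_tensor_left_hom (vHom V b c), ← braiding_naturality_left_assoc]
    simp only [braiding_tensor_left_hom, Category.assoc, Iso.hom_inv_id_assoc]
    simp [braiding_whiskerLeft_cancel, ← comp_whiskerRight_assoc]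
  rw [← e]
  simp only [Category.assoc]

/-- After uncurrying, both sides of the naturality square begin with the same invertible braiding;
cancelling it leaves equivariance for the left actions, where `X` stays on the right and no braiding
occurs. -/
lemma isNat_iff_coact {K : Type v} [EnrichedCategory V K] {F G : EnrichedFunctor V Kᵒᵖ V} {X : V}
    (app : ∀ k, X ⟶ vHom V (F.obj k) (G.obj k)) :
    IsNat F G app ↔ ∀ k k' : K, coact F k k' ▷ X ≫ eUncurry (app (op k)) =
      (α_ _ _ _).hom ≫ vHom V k k' ◁ eUncurry (app (op k')) ≫ coact G k k' := by
  have key : ∀ k k' : K, ((β_ X (vHom V k k')).hom ≫ vComp (X := vHom V k k')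
      (F.map (op k') (op k)) (app (op k)) =
      vComp (Y := vHom V k k') (app (op k')) (G.map (op k') (op k))) ↔
      coact F k k' ▷ X ≫ eUncurry (app (op k)) =
      (α_ _ _ _).hom ≫ vHom V k k' ◁ eUncurry (app (op k')) ≫ coact G k k' := by
    intro k k'
    have e1 : eUncurry ((β_ X (vHom V k k')).hom ≫ vComp (X := vHom V k k')
        (F.map (op k') (op k)) (app (op k))) =
        (α_ _ _ _).inv ≫ (β_ (F.obj (op k') ⊗ X) (vHom V k k')).hom ≫ (α_ _ _ _).inv ≫
          coact F k k' ▷ X ≫ eUncurry (app (op k)) := by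
      have h : eUncurry (X := vHom V k k') (F.map (op k') (op k)) =
        (β_ (F.obj (op k')) (vHom V k k')).hom ≫ coact F k k' := act_op_eq F k k'
      rw [eUncurry_comp, eUncurry_vComp, h, comp_whiskerRight]
      have e := braiding_coherence' (F.obj (op k')) X (vHom V k k')
      rw [← reassoc_of% e]
      simp only [Category.assoc]
    have e2 : eUncurry (vComp (Y := vHom V k k') (app (op k')) (G.map (op k') (op k))) =
        (α_ _ _ _).inv ≫ (β_ (F.obj (op k') ⊗ X) (vHom V k k')).hom ≫
          vHom V k k' ◁ eUncurry (app (op k')) ≫ coact G k k' := by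
      have h : eUncurry (X := vHom V k k') (G.map (op k') (op k)) =
        (β_ (G.obj (op k')) (vHom V k k')).hom ≫ coact G k k' := act_op_eq G k k'
      rw [eUncurry_vComp, h, braiding_naturality_left_assoc]
    constructor
    · intro h
      have h' := congrArg eUncurry h
      rw [e1, e2, cancel_epi, cancel_epi, Iso.inv_comp_eq] at h'
      exact h'
    · intro h
      apply eUncurry_injective
      rw [e1, e2, cancel_epi, cancel_epi, Iso.inv_comp_eq]
      exact h
  exact ⟨fun h k k' => (key k k').1 (h (op k') (op k)), fun h k k' => (key k'.unop k.unop).2 (h _ _)⟩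

/-- Currying in the other variable. -/
def swapCurry {A X B : V} (f : A ⊗ X ⟶ B) : A ⟶ vHom V X B := eCurry ((β_ X A).hom ≫ f)

/-- Uncurrying in the other variable. -/
def swapUncurry {A X B : V} (f : A ⟶ vHom V X B) : A ⊗ X ⟶ B := (β_ A X).hom ≫ eUncurry f

lemma swapUncurry_swapCurry {A X B : V} (f : A ⊗ X ⟶ B) : swapUncurry (swapCurry f) = f := by
  rw [swapUncurry, swapCurry, eUncurry_eCurry, SymmetricCategory.symmetry_assoc]

lemma swapCurry_swapUncurry {A X B : V} (f : A ⟶ vHom V X B) : swapCurry (swapUncurry f) = f := by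
  rw [swapUncurry, swapCurry, SymmetricCategory.symmetry_assoc, eCurry_eUncurry]

lemma swapUncurry_comp {A A' X B : V} (g : A' ⟶ A) (f : A ⟶ vHom V X B) :
    swapUncurry (g ≫ f) = g ▷ X ≫ swapUncurry f := by
  rw [swapUncurry, swapUncurry, eUncurry_comp, braiding_naturality_left_assoc]

lemma swapUncurry_injective {A X B : V} {f g : A ⟶ vHom V X B}
    (h : swapUncurry f = swapUncurry g) : f = g := by
  rw [← swapCurry_swapUncurry f, h, swapCurry_swapUncurry]

/-- A family `D k ⊗ W k ⟶ Y` coequalizes the two actions of the hom-objects of `K`. -/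
def Balanced (W : EnrichedFunctor V Kᵒᵖ V) (D : EnrichedFunctor V K V) {Y : V}
    (s : ∀ k, D.obj k ⊗ W.obj (op k) ⟶ Y) : Prop :=
  ∀ k k' : K, (α_ _ _ _).inv ≫ act D k k' ▷ W.obj (op k') ≫ s k' = D.obj k ◁ coact W k k' ≫ s k

lemma Cocylinder.balanced {W : EnrichedFunctor V Kᵒᵖ V} {D : EnrichedFunctor V K V} {c : V}
    (η : Cocylinder W D c) : Balanced W D (fun k => eUncurry (η.app k)) := by
  intro k k'
  have h := congrArg eUncurry (η.naturality k k')
  rwa [eUncurry_vComp, eUncurry_comp] at h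

/-- The cocylinder given by a balanced family. -/
def Balanced.cocylinder {W : EnrichedFunctor V Kᵒᵖ V} {D : EnrichedFunctor V K V} {Y : V}
    {s : ∀ k, D.obj k ⊗ W.obj (op k) ⟶ Y} (hs : Balanced W D s) : Cocylinder W D Y where
  app k := eCurry (s k)
  naturality k k' := eUncurry_injective (by
    rw [eUncurry_vComp, eUncurry_comp, eUncurry_eCurry, eUncurry_eCurry]
    exact hs k k')

lemma Balanced.comp {W : EnrichedFunctor V Kᵒᵖ V} {D : EnrichedFunctor V K V} {Y Z : V}
    {s : ∀ k, D.obj k ⊗ W.obj (op k) ⟶ Y} (hs : Balanced W D s) (f : Y ⟶ Z) :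
    Balanced W D (fun k => s k ≫ f) := by
  intro k k'
  have h := hs k k' =≫ f
  simpa only [Category.assoc] using h

/-- Colimits in `V`, in terms of balanced families. -/
lemma isColim_iff {W : EnrichedFunctor V Kᵒᵖ V} {D : EnrichedFunctor V K V} {c : V}
    {η : Cocylinder W D c} : IsColim W D c η ↔
      ∀ (Y : V) (s : ∀ k, D.obj k ⊗ W.obj (op k) ⟶ Y), Balanced W D s →
        ∃! f : c ⟶ Y, ∀ k, eUncurry (η.app k) ≫ f = s k := by
  constructor
  · intro h Y s hs
    -- Morphisms `c ⟶ Y` are the elements of `[c, Y]` of stage `𝟙_ V`, so the universal property at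
    -- that single stage is enough here.
    have e : ∀ (f : 𝟙_ V ⟶ vHom V c Y) (k : K), vComp (η.app k) f = (ρ_ _).hom ≫ eCurry (s k) ↔
        eUncurry (η.app k) ≫ (ρ_ _).inv ≫ eUncurry f = s k := by
      intro f k
      have e1 : eUncurry (vComp (η.app k) f) =
          D.obj k ◁ (ρ_ _).hom ≫ eUncurry (η.app k) ≫ (ρ_ _).inv ≫ eUncurry f := by
        rw [eUncurry_vComp]
        simp
      have e2 : eUncurry ((ρ_ _).hom ≫ eCurry (s k)) = D.obj k ◁ (ρ_ _).hom ≫ s k := by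
        rw [eUncurry_comp, eUncurry_eCurry]
      constructor
      · intro h
        have h' := congrArg eUncurry h
        rwa [e1, e2, cancel_epi] at h'
      · intro h
        apply eUncurry_injective
        rw [e1, e2, h]
    have hσ : ∀ k k' : K, vComp (D.map k k') ((ρ_ _).hom ≫ eCurry (s k')) =
        (α_ _ _ _).inv ≫ coact W k k' ▷ 𝟙_ V ≫ (ρ_ _).hom ≫ eCurry (s k) := by
      intro k k'
      have := hs.cocylinder.naturality k k'
      rw [comp_vComp_right, rightUnitor_naturality_assoc]
      refine (congrArg (fun t => _ ≫ t) this).trans ?_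
      simp [Balanced.cocylinder]
    obtain ⟨f, hf, hf'⟩ := h Y (𝟙_ V) ⟨fun k => (ρ_ _).hom ≫ eCurry (s k), hσ⟩
    refine ⟨(ρ_ _).inv ≫ eUncurry f, fun k => (e f k).1 (hf k), fun g hg => ?_⟩
    rw [← hf' (eCurry ((ρ_ _).hom ≫ g)) fun k => (e _ k).2 ?_, eUncurry_eCurry,
      Iso.inv_hom_id_assoc]
    rw [eUncurry_eCurry, Iso.inv_hom_id_assoc, hg]
  · intro h m X σ
    -- The stage `X` is moved into the codomain: a cofamily of stage `X` with vertex `m` is a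
    -- balanced family with values in `[X, m]`.
    let s : ∀ k, D.obj k ⊗ W.obj (op k) ⟶ vHom V X m := fun k =>
      swapCurry ((α_ _ _ _).hom ≫ eUncurry (σ.app k))
    have e : ∀ (f : c ⟶ vHom V X m) (k : K), eUncurry (η.app k) ≫ f = s k ↔
        vComp (η.app k) (eCurry (swapUncurry f)) = σ.app k := by
      intro f k
      have e1 : eUncurry (vComp (η.app k) (eCurry (swapUncurry f))) =
          (α_ _ _ _).inv ≫ swapUncurry (eUncurry (η.app k) ≫ f) := by
        rw [eUncurry_vComp, eUncurry_eCurry, swapUncurry_comp]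
      have e2 : eUncurry (σ.app k) = (α_ _ _ _).inv ≫ swapUncurry (s k) := by
        simp [s, swapUncurry_swapCurry]
      constructor
      · intro h
        apply eUncurry_injective
        rw [e1, h, e2]
      · intro h
        have h' := congrArg eUncurry h
        rw [e1, e2, cancel_epi] at h'
        exact swapUncurry_injective h'
    have hs : Balanced W D s := by
      intro k k'
      have h := congrArg eUncurry (σ.naturality k k')
      rw [eUncurry_vComp, eUncurry_comp, eUncurry_comp] at h
      apply swapUncurry_injective
      simp only [s, swapUncurry_comp, swapUncurry_swapCurry]
      refine Eq.trans ?_ ((((α_ _ _ _).hom ≫ _ ◁ (α_ _ _ _).hom) ≫= h).trans ?_)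
      · simp [act]
      · simp
    obtain ⟨f, hf, hf'⟩ := h _ s hs
    refine ⟨eCurry (swapUncurry f), fun k => (e f k).1 (hf k), fun g hg => ?_⟩
    rw [← hf' (swapCurry (eUncurry g)) fun k => (e _ k).2 ?_, swapUncurry_swapCurry,
      eCurry_eUncurry]
    rw [swapUncurry_swapCurry, eCurry_eUncurry, hg]

end Presheaves

/-! ### Limits in `V` as universal natural families -/

section LimitsInV

variable {V : Type u} [Category.{v} V] [MonoidalCategory V] [MonoidalClosed V]
variable {K : Type w₁} [EnrichedCategory V K]

/-- Limits in `V`, in terms of natural families. -/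
lemma isLim_iff {P : EnrichedFunctor V K V} {L : EnrichedFunctor V K V} {l : V}
    {η : Cylinder P L l} : IsLim P L l η ↔
      ∀ (Y : V) (s : ∀ k, Y ⊗ P.obj k ⟶ L.obj k), (∀ k k', s k ▷ vHom V k k' ≫ act L k k' =
        (α_ _ _ _).hom ≫ Y ◁ act P k k' ≫ s k') →
        ∃! f : Y ⟶ l, ∀ k, f ▷ P.obj k ≫ eUncurry (η.app k) = s k := by
  constructor
  · intro h Y s hs
    have e : ∀ (f : 𝟙_ V ⟶ vHom V Y l) (k : K), vComp f (η.app k) = (λ_ _).hom ≫ eCurry (s k) ↔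
        ((ρ_ _).inv ≫ eUncurry f) ▷ P.obj k ≫ eUncurry (η.app k) = s k := by
      intro f k
      have e1 : eUncurry (vComp f (η.app k)) = Y ◁ (λ_ _).hom ≫
          ((ρ_ _).inv ≫ eUncurry f) ▷ P.obj k ≫ eUncurry (η.app k) := by
        have t : Y ◁ (λ_ (P.obj k)).hom ≫ (ρ_ Y).inv ▷ P.obj k = (α_ _ _ _).inv := by
          rw [← triangle_assoc_comp_right, Category.assoc, hom_inv_whiskerRight, Category.comp_id]
        rw [eUncurry_vComp, comp_whiskerRight, Category.assoc, reassoc_of% t]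
      have e2 : eUncurry ((λ_ _).hom ≫ eCurry (s k)) = Y ◁ (λ_ _).hom ≫ s k := by
        rw [eUncurry_comp, eUncurry_eCurry]
      constructor
      · intro h
        have h' := congrArg eUncurry h
        rwa [e1, e2, cancel_epi] at h'
      · intro h
        apply eUncurry_injective
        rw [e1, e2, h]
    have hσ : ∀ k k' : K, vComp ((λ_ _).hom ≫ eCurry (s k)) (L.map k k') =
        (α_ _ _ _).hom ≫ 𝟙_ V ◁ act P k k' ≫ (λ_ _).hom ≫ eCurry (s k') := by
      intro k k'
      apply eUncurry_injective
      rw [eUncurry_vComp, eUncurry_comp, eUncurry_comp, eUncurry_comp, eUncurry_comp,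
        eUncurry_eCurry, eUncurry_eCurry]
      refine Eq.trans ?_ (((Y ◁ (λ_ _).hom ▷ _ ≫ (α_ _ _ _).inv) ≫= hs k k').trans ?_)
      · simp [act]
      · simp
    obtain ⟨f, hf, hf'⟩ := h Y (𝟙_ V) ⟨fun k => (λ_ _).hom ≫ eCurry (s k), hσ⟩
    refine ⟨(ρ_ _).inv ≫ eUncurry f, fun k => (e f k).1 (hf k), fun g hg => ?_⟩
    rw [← hf' (eCurry ((ρ_ _).hom ≫ g)) fun k => (e _ k).2 ?_, eUncurry_eCurry,
      Iso.inv_hom_id_assoc]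
    rw [eUncurry_eCurry, Iso.inv_hom_id_assoc, hg]
  · intro h m X σ
    -- Dually to the case of colimits, the stage is absorbed into the source: a family of stage `X`
    -- and vertex `m` has ordinary source `m ⊗ X`.
    let s : ∀ k, (m ⊗ X) ⊗ P.obj k ⟶ L.obj k := fun k => (α_ _ _ _).hom ≫ eUncurry (σ.app k)
    have e : ∀ (f : m ⊗ X ⟶ l) (k : K), f ▷ P.obj k ≫ eUncurry (η.app k) = s k ↔
        vComp (eCurry f) (η.app k) = σ.app k := by
      intro f k
      have e1 : eUncurry (vComp (eCurry f) (η.app k)) =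
          (α_ _ _ _).inv ≫ f ▷ P.obj k ≫ eUncurry (η.app k) := by
        rw [eUncurry_vComp, eUncurry_eCurry]
      have e2 : eUncurry (σ.app k) = (α_ _ _ _).inv ≫ s k := by simp [s]
      constructor
      · intro h
        apply eUncurry_injective
        rw [e1, h, e2]
      · intro h
        have h' := congrArg eUncurry h
        rwa [e1, e2, cancel_epi] at h'
    have hs : ∀ k k', s k ▷ vHom V k k' ≫ act L k k' =
        (α_ _ _ _).hom ≫ (m ⊗ X) ◁ act P k k' ≫ s k' := by
      intro k k'
      have h := congrArg eUncurry (σ.naturality k k')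
      rw [eUncurry_vComp, eUncurry_comp, eUncurry_comp] at h
      refine Eq.trans ?_ ((((α_ _ _ _).hom ▷ _ ≫ (α_ _ _ _).hom) ≫= h).trans ?_)
      · simp [s, act]
      · simp [s]
    obtain ⟨f, hf, hf'⟩ := h _ s hs
    refine ⟨eCurry f, fun k => (e f k).1 (hf k), fun g hg => ?_⟩
    rw [← hf' (eUncurry g) fun k => (e _ k).2 ?_, eCurry_eUncurry]
    rw [eCurry_eUncurry, hg]

end LimitsInV

/-! ### Isomorphisms inside a `V`-category -/

section EnrichedIso

variable {V : Type u} [Category.{v} V] [MonoidalCategory V] [SymmetricCategory V]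
  [MonoidalClosed V]
variable {M : Type w₂} [EnrichedCategory V M] {N : Type w₃} [EnrichedCategory V N]

/-- Composition of a generalized element with an element of stage `𝟙_ V`, on the right. -/
def postcomp {b c : M} (f : 𝟙_ V ⟶ vHom V b c) (a : M) : vHom V a b ⟶ vHom V a c :=
  (ρ_ _).inv ≫ vComp (𝟙 _) f

/-- Composition of a generalized element with an element of stage `𝟙_ V`, on the left. -/
def precomp {a b : M} (f : 𝟙_ V ⟶ vHom V a b) (c : M) : vHom V b c ⟶ vHom V a c :=
  (λ_ _).inv ≫ vComp f (𝟙 _)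

lemma comp_postcomp {a b c : M} {X : V} (x : X ⟶ vHom V a b) (f : 𝟙_ V ⟶ vHom V b c) :
    x ≫ postcomp f a = (ρ_ _).inv ≫ vComp x f := by
  rw [postcomp, rightUnitor_inv_naturality_assoc, ← comp_vComp_left, Category.comp_id]

lemma comp_precomp {a b c : M} {X : V} (x : X ⟶ vHom V b c) (f : 𝟙_ V ⟶ vHom V a b) :
    x ≫ precomp f c = (λ_ _).inv ≫ vComp f x := by
  rw [precomp, leftUnitor_inv_naturality_assoc, ← comp_vComp_right, Category.comp_id]

/-- Associativity with a middle factor of stage `𝟙_ V`. It lets an isomorphism of vertices be moved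
between a cocylinder and the maps out of its vertex. -/
lemma vComp_comp_precomp {a b c d : M} {X Y : V} (x : X ⟶ vHom V a b) (f : 𝟙_ V ⟶ vHom V b c)
    (y : Y ⟶ vHom V c d) :
    vComp x (y ≫ precomp f d) = vComp (x ≫ postcomp f a) y := by
  rw [comp_precomp, comp_postcomp, comp_vComp_right, comp_vComp_left, vComp_assoc]
  simp

lemma vComp_comp_postcomp {a b c d : M} {X Y : V} (x : X ⟶ vHom V a b) (y : Y ⟶ vHom V b c)
    (f : 𝟙_ V ⟶ vHom V c d) :
    vComp x (y ≫ postcomp f b) = vComp x y ≫ postcomp f a := by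
  rw [comp_postcomp, comp_postcomp, comp_vComp_right, vComp_assoc]
  simp

lemma postcomp_eId (a b : M) : postcomp (eId V b) a = 𝟙 (vHom V a b) := by
  rw [postcomp, vComp_id]
  simp

lemma precomp_eId (a b : M) : precomp (eId V a) b = 𝟙 (vHom V a b) := by
  rw [precomp, id_vComp]
  simp

lemma postcomp_comp_postcomp {a b c d : M} (f : 𝟙_ V ⟶ vHom V b c) (g : 𝟙_ V ⟶ vHom V c d) :
    postcomp f a ≫ postcomp g a = postcomp ((λ_ _).inv ≫ vComp f g) a := by
  rw [comp_postcomp, postcomp, postcomp, comp_vComp_left, comp_vComp_right, vComp_assoc]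
  simp [unitors_inv_equal]

lemma precomp_comp_precomp {a b c d : M} (f : 𝟙_ V ⟶ vHom V a b) (g : 𝟙_ V ⟶ vHom V b c) :
    precomp g d ≫ precomp f d = precomp ((λ_ _).inv ≫ vComp f g) d := by
  rw [comp_precomp, precomp, precomp, comp_vComp_left, comp_vComp_right, vComp_assoc]
  simp

lemma postcomp_map (T : EnrichedFunctor V M N) {b c : M} (f : 𝟙_ V ⟶ vHom V b c) (a : M) :
    postcomp f a ≫ T.map a c = T.map a b ≫ postcomp (f ≫ T.map b c) (T.obj a) := by
  rw [comp_postcomp, postcomp, Category.assoc, map_vComp, Category.id_comp]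

/-- An isomorphism between two objects of a `V`-category. -/
structure EIso (V : Type u) [Category.{v} V] [MonoidalCategory V] {M : Type w₂}
    [EnrichedCategory V M] (b c : M) where
  hom : 𝟙_ V ⟶ vHom V b c
  inv : 𝟙_ V ⟶ vHom V c b
  hom_inv : (λ_ _).inv ≫ vComp hom inv = eId V b
  inv_hom : (λ_ _).inv ≫ vComp inv hom = eId V c

namespace EIso

/-- The inverse isomorphism. -/
def symm {b c : M} (e : EIso V b c) : EIso V c b := ⟨e.inv, e.hom, e.inv_hom, e.hom_inv⟩

/-- The image of an isomorphism under a `V`-functor. -/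
def map {b c : M} (e : EIso V b c) (T : EnrichedFunctor V M N) :
    EIso V (T.obj b) (T.obj c) where
  hom := e.hom ≫ T.map b c
  inv := e.inv ≫ T.map c b
  hom_inv := by rw [← map_vComp, ← Category.assoc, e.hom_inv, T.map_id]
  inv_hom := by rw [← map_vComp, ← Category.assoc, e.inv_hom, T.map_id]

/-- Composition with an isomorphism, on the left. -/
def pre {b c : M} (e : EIso V b c) (d : M) : vHom V c d ≅ vHom V b d where
  hom := precomp e.hom d
  inv := precomp e.inv d
  hom_inv_id := by rw [precomp_comp_precomp, e.inv_hom, precomp_eId]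
  inv_hom_id := by rw [precomp_comp_precomp, e.hom_inv, precomp_eId]

/-- An isomorphism in the underlying category. -/
def ofIso {b c : M} (e : ForgetEnrichment.of V b ≅ ForgetEnrichment.of V c) : EIso V b c where
  hom := ForgetEnrichment.homTo V e.hom
  inv := ForgetEnrichment.homTo V e.inv
  hom_inv := by
    have h := congrArg (ForgetEnrichment.homTo V) e.hom_inv_id
    rw [ForgetEnrichment.homTo_comp, ForgetEnrichment.homTo_id, Category.assoc] at h
    exact h
  inv_hom := by
    have h := congrArg (ForgetEnrichment.homTo V) e.inv_hom_id
    rw [ForgetEnrichment.homTo_comp, ForgetEnrichment.homTo_id, Category.assoc] at h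
    exact h

/-- The isomorphism in the underlying category. -/
def toIso {b c : M} (e : EIso V b c) : ForgetEnrichment.of V b ≅ ForgetEnrichment.of V c where
  hom := ForgetEnrichment.homOf V e.hom
  inv := ForgetEnrichment.homOf V e.inv
  hom_inv_id := by
    rw [← ForgetEnrichment.homOf_comp, ← ForgetEnrichment.homOf_eId]
    exact congrArg _ e.hom_inv
  inv_hom_id := by
    rw [← ForgetEnrichment.homOf_comp, ← ForgetEnrichment.homOf_eId]
    exact congrArg _ e.inv_hom

end EIso

end EnrichedIso

/-! ### Formal properties of limits and of their preservation -/

section Universality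

variable {V : Type u} [Category.{v} V] [MonoidalCategory V] [MonoidalClosed V]
variable {K : Type w₁} [EnrichedCategory V K] {M : Type w₂} [EnrichedCategory V M]
  {N : Type w₃} [EnrichedCategory V N]

lemma IsLim.hom_ext {P : EnrichedFunctor V K V} {L : EnrichedFunctor V K M} {l : M}
    {η : Cylinder P L l} (h : IsLim P L l η) {m : M} {X : V} {f g : X ⟶ vHom V m l}
    (e : ∀ k, vComp f (η.app k) = vComp g (η.app k)) : f = g := by
  have hσ : ∀ k k' : K, vComp (vComp f (η.app k)) (L.map k k') =
      (α_ _ _ _).hom ≫ X ◁ act P k k' ≫ vComp f (η.app k') := by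
    intro k k'
    rw [vComp_assoc, η.naturality, comp_vComp_right]
  exact (h m X ⟨fun k => vComp f (η.app k), hσ⟩).unique (fun _ => rfl) (fun k => (e k).symm)

/-- Composition of `V`-functors is used up to a propositional equality, as in `functorComp_assoc`;
this lemma carries a limit along such an equality. -/
lemma IsLim.congr {P : EnrichedFunctor V K V} {L L' : EnrichedFunctor V K M} {l : M}
    {η : Cylinder P L l} {η' : Cylinder P L' l} (h : IsLim P L l η) (e : L = L')
    (e' : ∀ k, HEq (η.app k) (η'.app k)) : IsLim P L' l η' := by
  subst e
  have : η = η' := by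
    cases η; cases η'
    congr
    funext k
    exact eq_of_heq (e' k)
  rwa [← this]

lemma functorComp_assoc {N' : Type*} [EnrichedCategory V N'] (L : EnrichedFunctor V K M)
    (S : EnrichedFunctor V M N) (T : EnrichedFunctor V N N') :
    (L.comp V S).comp V T = L.comp V (S.comp V T) :=
  EnrichedFunctor.ext V (fun _ => rfl) (fun _ _ =>
    (Category.comp_id _).trans (Category.assoc _ _ _))

lemma PreservesLim.comp {P : EnrichedFunctor V K V} {L : EnrichedFunctor V K M}
    {S : EnrichedFunctor V M N} {N' : Type*} [EnrichedCategory V N'] {T : EnrichedFunctor V N N'}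
    (hS : PreservesLim S P L) (hT : PreservesLim T P (L.comp V S)) :
    PreservesLim (S.comp V T) P L := fun l η h =>
  (hT _ _ (hS l η h)).congr (functorComp_assoc _ _ _)
    (fun _ => heq_of_eq (Category.assoc _ _ _))

/-- Limits in `V` are invariant under natural isomorphism. -/
lemma IsLim.of_natIso {P : EnrichedFunctor V K V} {L L' : EnrichedFunctor V K V} {l l' : V}
    {η : Cylinder P L l} {η' : Cylinder P L' l'} (h : IsLim P L l η)
    (ψ : ∀ k, L.obj k ≅ L'.obj k)
    (hψ : ∀ k k', act L k k' ≫ (ψ k').hom = (ψ k).hom ▷ _ ≫ act L' k k') (e : l ≅ l')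
    (he : ∀ k, eUncurry (η.app k) ≫ (ψ k).hom = e.hom ▷ P.obj k ≫ eUncurry (η'.app k)) :
    IsLim P L' l' η' := by
  have hψ' : ∀ k k', act L' k k' ≫ (ψ k').inv = (ψ k).inv ▷ _ ≫ act L k k' := by
    intro k k'
    rw [Iso.comp_inv_eq, Category.assoc, hψ, inv_hom_whiskerRight_assoc]
  rw [isLim_iff] at h ⊢
  intro Y s hs
  have key : ∀ (f : Y ⟶ l) (k : K), f ▷ P.obj k ≫ eUncurry (η.app k) = s k ≫ (ψ k).inv ↔
      (f ≫ e.hom) ▷ P.obj k ≫ eUncurry (η'.app k) = s k := by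
    intro f k
    rw [comp_whiskerRight, Category.assoc, ← he, Iso.eq_comp_inv, Category.assoc]
  obtain ⟨f, hf, hf'⟩ := h Y (fun k => s k ≫ (ψ k).inv) (fun k k' => by
    have := hs k k' =≫ (ψ k').inv
    rw [Category.assoc, hψ'] at this
    rw [comp_whiskerRight, Category.assoc, this]
    simp only [Category.assoc])
  refine ⟨f ≫ e.hom, fun k => (key f k).1 (hf k), fun g hg => ?_⟩
  rw [← hf' (g ≫ e.inv) fun k => (key _ k).2 ?_]
  · simp
  · rw [Category.assoc, Iso.inv_hom_id, Category.comp_id, hg]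

lemma act_comp_natIso (L : EnrichedFunctor V K M) {T T' : EnrichedFunctor V M V}
    (φ : ∀ m, T.obj m ≅ T'.obj m)
    (hφ : ∀ m n, act T m n ≫ (φ n).hom = (φ m).hom ▷ _ ≫ act T' m n) (k k' : K) :
    act (L.comp V T) k k' ≫ (φ (L.obj k')).hom =
      (φ (L.obj k)).hom ▷ _ ≫ act (L.comp V T') k k' := by
  rw [act_functorComp, act_functorComp]
  have : (T.obj (L.obj k) ◁ L.map k k' ≫ act T (L.obj k) (L.obj k')) ≫ (φ (L.obj k')).hom =
      (φ (L.obj k)).hom ▷ _ ≫ T'.obj (L.obj k) ◁ L.map k k' ≫ act T' (L.obj k) (L.obj k') := by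
    rw [Category.assoc, hφ, whisker_exchange_assoc]
  exact this

/-- Preservation of limits by `V`-valued functors is invariant under natural isomorphism. -/
lemma PreservesLim.of_natIso {P : EnrichedFunctor V K V} {L : EnrichedFunctor V K M}
    {T T' : EnrichedFunctor V M V} (φ : ∀ m, T.obj m ≅ T'.obj m)
    (hφ : ∀ m n, act T m n ≫ (φ n).hom = (φ m).hom ▷ _ ≫ act T' m n)
    (h : PreservesLim T P L) : PreservesLim T' P L := fun l η hη =>
  (h l η hη).of_natIso (fun k => φ (L.obj k)) (act_comp_natIso L φ hφ) (φ l) fun k => by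
    have e : (T.obj l ◁ η.app k ≫ act T l (L.obj k)) ≫ (φ (L.obj k)).hom =
        (φ l).hom ▷ P.obj k ≫ T'.obj l ◁ η.app k ≫ act T' l (L.obj k) := by
      rw [Category.assoc, hφ, whisker_exchange_assoc]
    exact (congrArg (fun t => t ≫ (φ (L.obj k)).hom) (eUncurry_comp_map T (η.app k))).trans
      (e.trans (congrArg (fun t => (φ l).hom ▷ P.obj k ≫ t)
        (eUncurry_comp_map T' (η.app k)).symm))

end Universality

/-! ### Formal properties of colimits and of their preservation -/

section Colimits

variable {V : Type u} [Category.{v} V] [MonoidalCategory V] [SymmetricCategory V]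
  [MonoidalClosed V]
variable {K : Type w₁} [EnrichedCategory V K] {M : Type w₂} [EnrichedCategory V M]
  {N : Type w₃} [EnrichedCategory V N]

lemma IsColim.congr {W : EnrichedFunctor V Kᵒᵖ V} {D D' : EnrichedFunctor V K M} {c : M}
    {η : Cocylinder W D c} {η' : Cocylinder W D' c} (h : IsColim W D c η) (e : D = D')
    (e' : ∀ k, HEq (η.app k) (η'.app k)) : IsColim W D' c η' := by
  subst e
  have : η = η' := by
    cases η; cases η'
    congr
    funext k
    exact eq_of_heq (e' k)
  rwa [← this]

/-- A cocylinder with its vertex changed along an element of stage `𝟙_ V`. -/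
def Cocylinder.postcomp {W : EnrichedFunctor V Kᵒᵖ V} {D : EnrichedFunctor V K M} {c c' : M}
    (η : Cocylinder W D c) (f : 𝟙_ V ⟶ vHom V c c') : Cocylinder W D c' where
  app k := η.app k ≫ EnrichedFlat.postcomp f _
  naturality k k' := by rw [vComp_comp_postcomp, η.naturality, Category.assoc]

lemma IsColim.of_iso {W : EnrichedFunctor V Kᵒᵖ V} {D : EnrichedFunctor V K M} {c c' : M}
    {η : Cocylinder W D c} {η' : Cocylinder W D c'} (h : IsColim W D c η) (e : EIso V c c')
    (he : ∀ k, η.app k ≫ postcomp e.hom (D.obj k) = η'.app k) : IsColim W D c' η' := by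
  intro m X σ
  obtain ⟨r, hr, hr'⟩ := h m X σ
  refine ⟨r ≫ (e.pre m).inv, fun k => ?_, fun r' hr'' => ?_⟩
  · rw [← he, ← vComp_comp_precomp, Category.assoc]
    change vComp _ (r ≫ (e.pre m).inv ≫ (e.pre m).hom) = _
    rw [Iso.inv_hom_id, Category.comp_id, hr]
  · rw [Iso.eq_comp_inv]
    refine hr' _ fun k => ?_
    exact (vComp_comp_precomp _ _ _).trans ((congrArg (fun t => vComp t r') (he k)).trans (hr'' k))

/-- The cofamily of stage `𝟙_ V` of a cocylinder. -/
def Cocylinder.cofamily {W : EnrichedFunctor V Kᵒᵖ V} {D : EnrichedFunctor V K M} {c : M}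
    (η : Cocylinder W D c) : Cofamily (𝟙_ V) W D c where
  app k := (ρ_ _).hom ≫ η.app k
  naturality k k' := by
    rw [comp_vComp_right, η.naturality]
    simp

/-- A cocylinder factors through a colimit. -/
lemma IsColim.exists_desc {W : EnrichedFunctor V Kᵒᵖ V} {D : EnrichedFunctor V K M} {c c' : M}
    {η : Cocylinder W D c} (h : IsColim W D c η) (η' : Cocylinder W D c') :
    ∃ f : 𝟙_ V ⟶ vHom V c c', ∀ k, η.app k ≫ postcomp f (D.obj k) = η'.app k := by
  obtain ⟨f, hf, -⟩ := h c' (𝟙_ V) η'.cofamily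
  refine ⟨f, fun k => ?_⟩
  rw [comp_postcomp, hf]
  exact Iso.inv_hom_id_assoc _ _

lemma IsColim.postcomp_ext {W : EnrichedFunctor V Kᵒᵖ V} {D : EnrichedFunctor V K M} {c c' : M}
    {η : Cocylinder W D c} (h : IsColim W D c η) {f g : 𝟙_ V ⟶ vHom V c c'}
    (e : ∀ k, η.app k ≫ postcomp f (D.obj k) = η.app k ≫ postcomp g (D.obj k)) : f = g := by
  refine h.hom_ext fun k => ?_
  have := e k
  rwa [comp_postcomp, comp_postcomp, cancel_epi] at this

/-- The comparison isomorphism of two colimits. -/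
lemma IsColim.exists_iso {W : EnrichedFunctor V Kᵒᵖ V} {D : EnrichedFunctor V K M} {c c' : M}
    {η : Cocylinder W D c} {η' : Cocylinder W D c'} (h : IsColim W D c η)
    (h' : IsColim W D c' η') :
    ∃ e : EIso V c c', ∀ k, η.app k ≫ postcomp e.hom (D.obj k) = η'.app k := by
  obtain ⟨f, hf⟩ := h.exists_desc η'
  obtain ⟨g, hg⟩ := h'.exists_desc η
  refine ⟨⟨f, g, h.postcomp_ext fun k => ?_, h'.postcomp_ext fun k => ?_⟩, hf⟩
  · rw [← postcomp_comp_postcomp, reassoc_of% hf, hg, postcomp_eId, Category.comp_id]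
  · rw [← postcomp_comp_postcomp, reassoc_of% hg, hf, postcomp_eId, Category.comp_id]

/-- A `V`-functor preserves colimits as soon as it preserves one of them. -/
lemma IsColim.preservesColim {W : EnrichedFunctor V Kᵒᵖ V} {D : EnrichedFunctor V K M} {c : M}
    {η : Cocylinder W D c} (h : IsColim W D c η) {T : EnrichedFunctor V M N}
    (hT : IsColim W (D.comp V T) (T.obj c) (η.mapCyl T)) : PreservesColim T W D := by
  intro c' η' h'
  obtain ⟨e, he⟩ := h.exists_iso h'
  refine hT.of_iso (e.map T) fun k => ?_
  refine (Category.assoc _ _ _).trans ?_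
  refine (congrArg (fun t => η.app k ≫ t) (postcomp_map T e.hom _).symm).trans ?_
  rw [← Category.assoc, he]
  rfl

lemma PreservesColim.comp {W : EnrichedFunctor V Kᵒᵖ V} {D : EnrichedFunctor V K M}
    {S : EnrichedFunctor V M N} {N' : Type*} [EnrichedCategory V N'] {T : EnrichedFunctor V N N'}
    (hS : PreservesColim S W D) (hT : PreservesColim T W (D.comp V S)) :
    PreservesColim (S.comp V T) W D := fun c η h =>
  (hT _ _ (hS c η h)).congr (functorComp_assoc _ _ _)
    (fun _ => heq_of_eq (Category.assoc _ _ _))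

/-- Colimits in `V` are invariant under natural isomorphism. -/
lemma IsColim.of_natIso {W : EnrichedFunctor V Kᵒᵖ V} {D D' : EnrichedFunctor V K V} {c c' : V}
    {η : Cocylinder W D c} {η' : Cocylinder W D' c'} (h : IsColim W D c η)
    (ψ : ∀ k, D.obj k ≅ D'.obj k)
    (hψ : ∀ k k', act D k k' ≫ (ψ k').hom = (ψ k).hom ▷ _ ≫ act D' k k') (e : c ≅ c')
    (he : ∀ k, eUncurry (η.app k) ≫ e.hom = (ψ k).hom ▷ W.obj (op k) ≫ eUncurry (η'.app k)) :
    IsColim W D' c' η' := by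
  rw [isColim_iff] at h ⊢
  intro Y s hs
  have key : ∀ (f : c' ⟶ Y) (k : K),
      eUncurry (η.app k) ≫ e.hom ≫ f = (ψ k).hom ▷ W.obj (op k) ≫ s k ↔
      eUncurry (η'.app k) ≫ f = s k := by
    intro f k
    rw [reassoc_of% (he k), cancel_epi]
  obtain ⟨f, hf, hf'⟩ := h Y (fun k => (ψ k).hom ▷ W.obj (op k) ≫ s k) (fun k k' => by
    have := (ψ k).hom ▷ (vHom V k k' ⊗ W.obj (op k')) ≫= hs k k'
    dsimp only
    rw [← comp_whiskerRight_assoc, hψ, whisker_exchange_assoc, ← this]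
    simp)
  refine ⟨e.inv ≫ f, fun k => (key _ k).1 ?_, fun g hg => ?_⟩
  · rw [Iso.hom_inv_id_assoc, hf]
  · rw [← hf' (e.hom ≫ g) fun k => (key _ k).2 (hg k), Iso.inv_hom_id_assoc]

/-- Preservation of colimits by `V`-valued functors is invariant under natural isomorphism. -/
lemma PreservesColim.of_natIso {W : EnrichedFunctor V Kᵒᵖ V} {D : EnrichedFunctor V K M}
    {T T' : EnrichedFunctor V M V} (φ : ∀ m, T.obj m ≅ T'.obj m)
    (hφ : ∀ m n, act T m n ≫ (φ n).hom = (φ m).hom ▷ _ ≫ act T' m n)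
    (h : PreservesColim T W D) : PreservesColim T' W D := fun c η hη =>
  (h c η hη).of_natIso (fun k => φ (D.obj k)) (act_comp_natIso D φ hφ) (φ c) fun k => by
    have e : (T.obj (D.obj k) ◁ η.app k ≫ act T (D.obj k) c) ≫ (φ c).hom =
        (φ (D.obj k)).hom ▷ W.obj (op k) ≫ T'.obj (D.obj k) ◁ η.app k ≫ act T' (D.obj k) c := by
      rw [Category.assoc, hφ, whisker_exchange_assoc]
    exact (congrArg (fun t => t ≫ (φ c).hom) (eUncurry_comp_map T (η.app k))).trans
      (e.trans (congrArg (fun t => (φ (D.obj k)).hom ▷ W.obj (op k) ≫ t)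
        (eUncurry_comp_map T' (η.app k)).symm))

end Colimits

/-! ### Pointwise limits and colimits in functor categories -/

section Evaluation

variable {V : Type u} [Category.{v} V] [MonoidalCategory V] [SymmetricCategory V]
  [MonoidalClosed V] [HasLimits V]
variable {B : Type v} [EnrichedCategory V B] {K : Type w₁} [EnrichedCategory V K]
  {M : Type w₂} [EnrichedCategory V M] {N : Type w₃} [EnrichedCategory V N]

/-- Evaluation at an object, `[B, N] → N`. -/
def evalFunctor (N : Type w₃) [EnrichedCategory V N] (b : B) :
    EnrichedFunctor V (EnrichedFunctor V B N) N where
  obj F := F.obj b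
  map F G := natProj F G b
  map_id F := eId_natProj F b
  map_comp F G H := eComp_natProj F G H b

lemma isNat_comp_natProj {F G : EnrichedFunctor V B N} {X : V} (f : X ⟶ vHom V F G) :
    IsNat F G (fun b => f ≫ natProj F G b) := by
  intro b b'
  dsimp only
  rw [comp_vComp_left, ← natProj_isNat F G b b', comp_vComp_right,
    braiding_naturality_left_assoc]

lemma vComp_map_comp_natProj {F G : EnrichedFunctor V B N} {X : V} (f : X ⟶ vHom V F G) (b b' : B) :
    vComp (F.map b b') (f ≫ natProj F G b') =
      (β_ _ _).hom ≫ vComp (f ≫ natProj F G b) (G.map b b') := by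
  rw [← isNat_comp_natProj f b b', SymmetricCategory.symmetry_assoc]

/-- Limits in `[B, N]` are detected pointwise. -/
lemma isLim_of_eval {P : EnrichedFunctor V K V} {L : EnrichedFunctor V K (EnrichedFunctor V B N)}
    {l : EnrichedFunctor V B N} {η : Cylinder P L l}
    (h : ∀ b, IsLim P (L.comp V (evalFunctor N b)) (l.obj b) (η.mapCyl (evalFunctor N b))) :
    IsLim P L l η := by
  have h1 : ∀ (b : B) (m : N) (X : V) (σ : ∀ j, X ⊗ P.obj j ⟶ vHom V m ((L.obj j).obj b)),
      (∀ j j', vComp (σ j) (L.map j j' ≫ natProj _ _ b) =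
        (α_ _ _ _).hom ≫ X ◁ act P j j' ≫ σ j') →
      ∃! f : X ⟶ vHom V m (l.obj b), ∀ j, vComp f (η.app j ≫ natProj _ _ b) = σ j :=
    fun b m X σ hσ => h b m X ⟨σ, hσ⟩
  have h2 : ∀ (b : B) (m : N) (X : V) (f g : X ⟶ vHom V m (l.obj b)),
      (∀ j, vComp f (η.app j ≫ natProj _ _ b) = vComp g (η.app j ≫ natProj _ _ b)) → f = g :=
    fun b m X f g e => (h b).hom_ext e
  intro m X σ
  -- Factor separately at each `b`; uniqueness at `b'` then forces the factorizations to be natural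
  -- in `b`.
  have h3 : ∀ b, ∃ f : X ⟶ vHom V (m.obj b) (l.obj b), ∀ j,
      vComp f (η.app j ≫ natProj _ _ b) = σ.app j ≫ natProj _ _ b := fun b =>
    (h1 b (m.obj b) X (fun j => σ.app j ≫ natProj _ _ b) fun j j' => by
      rw [← vComp_natProj, σ.naturality]
      simp only [Category.assoc]).exists
  choose f hf using h3
  have hnat : IsNat m l f := by
    intro b b'
    refine h2 _ _ _ _ _ fun j => ?_
    rw [comp_vComp_left, vComp_assoc, vComp_assoc, hf, vComp_map_comp_natProj,
      vComp_map_comp_natProj, comp_vComp_right, vComp_assoc', hf]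
    simp [braiding_tensor_right_hom, braiding_whiskerRight_cancel]
  refine ⟨natLift f hnat, fun j => nat_hom_ext fun b => ?_, fun g hg => nat_hom_ext fun b => ?_⟩
  · rw [vComp_natProj, natLift_proj, hf]
  · rw [natLift_proj]
    refine h2 _ _ _ _ _ fun j => ?_
    rw [hf, ← vComp_natProj, hg]

/-- A `V`-functor into `[B, N]` preserves the limits that are preserved pointwise. -/
lemma preservesLim_of_eval {P : EnrichedFunctor V K V} {L : EnrichedFunctor V K M}
    {S : EnrichedFunctor V M (EnrichedFunctor V B N)}
    (h : ∀ b, PreservesLim (S.comp V (evalFunctor N b)) P L) : PreservesLim S P L :=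
  fun l η hη => isLim_of_eval fun b => (h b l η hη).congr (functorComp_assoc _ _ _).symm
    fun _ => heq_of_eq (Category.assoc _ _ _).symm

/-- Colimits in `[B, N]` are detected pointwise. -/
lemma isColim_of_eval {W : EnrichedFunctor V Kᵒᵖ V}
    {D : EnrichedFunctor V K (EnrichedFunctor V B N)}
    {c : EnrichedFunctor V B N} {η : Cocylinder W D c}
    (h : ∀ b, IsColim W (D.comp V (evalFunctor N b)) (c.obj b) (η.mapCyl (evalFunctor N b))) :
    IsColim W D c η := by
  have h1 : ∀ (b : B) (m : N) (X : V) (σ : ∀ j, W.obj (op j) ⊗ X ⟶ vHom V ((D.obj j).obj b) m),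
      (∀ j j', vComp (D.map j j' ≫ natProj _ _ b) (σ j') =
        (α_ _ _ _).inv ≫ coact W j j' ▷ X ≫ σ j) →
      ∃! f : X ⟶ vHom V (c.obj b) m, ∀ j, vComp (η.app j ≫ natProj _ _ b) f = σ j :=
    fun b m X σ hσ => h b m X ⟨σ, hσ⟩
  have h2 : ∀ (b : B) (m : N) (X : V) (f g : X ⟶ vHom V (c.obj b) m),
      (∀ j, vComp (η.app j ≫ natProj _ _ b) f = vComp (η.app j ≫ natProj _ _ b) g) → f = g :=
    fun b m X f g e => (h b).hom_ext e
  intro m X σ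
  have h3 : ∀ b, ∃ f : X ⟶ vHom V (c.obj b) (m.obj b), ∀ j,
      vComp (η.app j ≫ natProj _ _ b) f = σ.app j ≫ natProj _ _ b := fun b =>
    (h1 b (m.obj b) X (fun j => σ.app j ≫ natProj _ _ b) fun j j' => by
      rw [← vComp_natProj, σ.naturality]
      simp only [Category.assoc]).exists
  choose f hf using h3
  -- Both sides are elements of `[c b, m b']`, so it suffices to compare them after composition with
  -- the unit of the colimit at `b`.
  have hnat : IsNat c m f := by
    intro b b'
    refine h2 _ _ _ _ _ fun j => ?_
    rw [comp_vComp_right, vComp_assoc', vComp_assoc', hf, ← isNat_comp_natProj, comp_vComp_left,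
      vComp_assoc, hf, vComp_map_comp_natProj]
    simp [braiding_tensor_right_hom, braiding_whiskerRight_cancel,
      braiding_whiskerLeft_cancel]
  refine ⟨natLift f hnat, fun j => nat_hom_ext fun b => ?_, fun g hg => nat_hom_ext fun b => ?_⟩
  · rw [vComp_natProj, natLift_proj, hf]
  · rw [natLift_proj]
    refine h2 _ _ _ _ _ fun j => ?_
    rw [hf, ← vComp_natProj, hg]

/-- A `V`-functor `M → [B, N]` from a family of `V`-functors and compatible actions. -/
def ofFamily (obj : M → EnrichedFunctor V B N)
    (map : ∀ m m' b, vHom V m m' ⟶ vHom V ((obj m).obj b) ((obj m').obj b))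
    (nat : ∀ m m', IsNat (obj m) (obj m') (map m m'))
    (hid : ∀ m b, eId V m ≫ map m m b = eId V ((obj m).obj b))
    (hcomp : ∀ x y z b, eComp V x y z ≫ map x z b = vComp (map x y b) (map y z b)) :
    EnrichedFunctor V M (EnrichedFunctor V B N) where
  obj := obj
  map m m' := natLift (map m m') (nat m m')
  map_id m := nat_hom_ext fun b => by rw [Category.assoc, natLift_proj, hid, eId_natProj]
  map_comp x y z := nat_hom_ext fun b => by
    rw [Category.assoc, natLift_proj, hcomp, Category.assoc, eComp_natProj, ← comp_vComp,
      natLift_proj, natLift_proj]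

lemma ofFamily_map_natProj (obj : M → EnrichedFunctor V B N)
    (map : ∀ m m' b, vHom V m m' ⟶ vHom V ((obj m).obj b) ((obj m').obj b))
    (nat : ∀ m m', IsNat (obj m) (obj m') (map m m')) (hid hcomp) (m m' : M) (b : B) :
    (ofFamily obj map nat hid hcomp).map m m' ≫ natProj (obj m) (obj m') b = map m m' b :=
  natLift_proj _ (nat m m') b

end Evaluation

/-! ### The Yoneda lemma on generalized elements -/

section Yoneda

variable {V : Type u} [Category.{v} V] [MonoidalCategory V] [SymmetricCategory V]
  [MonoidalClosed V] [HasLimits V]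
variable {B : Type v} [EnrichedCategory V B] {K : Type w₁} [EnrichedCategory V K]

/-- An isomorphism `B(a, -) ≅ R`. -/
structure Representation (R : EnrichedFunctor V B V) (a : B) where
  iso : ∀ b, vHom V a b ≅ R.obj b
  nat : ∀ b b', eComp V a b b' ≫ (iso b').hom = (iso b).hom ▷ _ ≫ act R b b'

/-- The representation of `B(a, -)`. -/
def homFromRepresentation (a : B) : Representation (homFrom (V := V) a) a where
  iso b := Iso.refl _
  nat b b' := by
    have h : act (homFrom (V := V) a) b b' = eComp V a b b' := act_homFrom _ _ _
    rw [h]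
    exact (Category.comp_id _).trans ((congrArg (fun t => t ≫ eComp V a b b')
      (id_whiskerRight _ _)).trans (Category.id_comp _)).symm

namespace Representation

variable {R : EnrichedFunctor V B V} {a : B} (r : Representation R a)

lemma inv_nat (b b' : B) : act R b b' ≫ (r.iso b').inv = (r.iso b).inv ▷ _ ≫ eComp V a b b' := by
  rw [Iso.comp_inv_eq, Category.assoc, r.nat, inv_hom_whiskerRight_assoc]

lemma lift_isNat {G : EnrichedFunctor V B V} {Y : V} (y : Y ⟶ G.obj a) :
    IsNat R G (fun b => eCurry ((r.iso b).inv ▷ Y ≫ (β_ (vHom V a b) Y).hom ≫ y ▷ _ ≫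
      act G a b)) := by
  intro b b'
  apply eUncurry_injective
  have h1 : ∀ F : EnrichedFunctor V B V, eUncurry (F.map b b') = act F b b' := fun _ => rfl
  rw [eUncurry_comp, eUncurry_vComp, eUncurry_vComp, eUncurry_eCurry, eUncurry_eCurry, h1, h1]
  rw [← comp_whiskerRight_assoc, inv_nat, comp_whiskerRight, Category.assoc,
    braiding_naturality_left_assoc, whisker_exchange_assoc, act_comp]
  rw [← associator_inv_naturality_left_assoc, whisker_exchange_assoc, comp_whiskerRight,
    Category.assoc, ← associator_inv_naturality_left_assoc]
  refine congrArg (fun t => (r.iso b).inv ▷ _ ≫ t) ?_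
  simp [braiding_tensor_left_hom, braiding_whiskerLeft_cancel]

/-- The generalized element of `[B, V](R, G)` given by one of `G a`. -/
def lift {G : EnrichedFunctor V B V} {Y : V} (y : Y ⟶ G.obj a) : Y ⟶ vHom V R G :=
  natLift _ (r.lift_isNat y)

/-- The generalized element of `G a` given by one of `[B, V](R, G)`. -/
def eval {G : EnrichedFunctor V B V} {Y : V} (f : Y ⟶ vHom V R G) : Y ⟶ G.obj a :=
  (λ_ Y).inv ≫ (eId V a ≫ (r.iso a).hom) ▷ Y ≫ eUncurry (f ≫ natProj R G a)

lemma eval_lift {G : EnrichedFunctor V B V} {Y : V} (y : Y ⟶ G.obj a) :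
    r.eval (r.lift y) = y := by
  rw [eval, lift, natLift_proj, eUncurry_eCurry, comp_whiskerRight, Category.assoc,
    hom_inv_whiskerRight_assoc, braiding_naturality_left_assoc, whisker_exchange_assoc, act_id]
  simp

lemma eval_comp {G : EnrichedFunctor V B V} {Y Y' : V} (g : Y' ⟶ Y) (f : Y ⟶ vHom V R G) :
    r.eval (g ≫ f) = g ≫ r.eval f := by
  rw [eval, eval, Category.assoc, eUncurry_comp, ← whisker_exchange_assoc,
    leftUnitor_inv_naturality_assoc]

lemma eval_vComp {G H : EnrichedFunctor V B V} {Y Z : V} (f : Y ⟶ vHom V R G)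
    (g : Z ⟶ vHom V G H) :
    r.eval (vComp f g) = r.eval f ▷ Z ≫ eUncurry (g ≫ natProj G H a) := by
  rw [eval, vComp_natProj, eval, eUncurry_vComp]
  simp

/-- The uniqueness half of Yoneda: every element of `R b` is obtained by letting `B(a, b)` act on
the universal element of `R a`, so naturality determines `f` by its value there. -/
lemma eUncurry_natProj {G : EnrichedFunctor V B V} {Y : V} (f : Y ⟶ vHom V R G) (b : B) :
    eUncurry (f ≫ natProj R G b) =
      (r.iso b).inv ▷ Y ≫ (β_ (vHom V a b) Y).hom ≫ r.eval f ▷ _ ≫ act G a b := by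
  have h := congrArg eUncurry (isNat_comp_natProj f a b)
  have h1 : ∀ F : EnrichedFunctor V B V, eUncurry (F.map a b) = act F a b := fun _ => rfl
  rw [eUncurry_comp, eUncurry_vComp, eUncurry_vComp, h1, h1] at h
  have h' : R.obj a ◁ (β_ Y (vHom V a b)).hom ≫ (α_ _ _ _).inv ≫ act R a b ▷ Y ≫
      eUncurry (f ≫ natProj R G b) = (α_ _ _ _).inv ≫
      eUncurry (f ≫ natProj R G a) ▷ vHom V a b ≫ act G a b := h
  have e : (λ_ (vHom V a b)).inv ≫ (eId V a ≫ (r.iso a).hom) ▷ _ ≫ act R a b =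
      (r.iso b).hom := by
    rw [comp_whiskerRight, Category.assoc, ← r.nat]
    exact e_id_comp_assoc V a b _
  rw [← cancel_epi ((r.iso b).hom ▷ Y), hom_inv_whiskerRight_assoc, ← e]
  rw [← cancel_epi ((β_ Y (vHom V a b)).hom), SymmetricCategory.symmetry_assoc, eval]
  have h'' := (λ_ _).inv ≫= (eId V a ≫ (r.iso a).hom) ▷ _ ≫= h'
  rw [← whisker_exchange_assoc] at h''
  refine Eq.trans ?_ (h''.trans ?_)
  · simp
  · simp

lemma eval_injective {G : EnrichedFunctor V B V} {Y : V}
    {f g : Y ⟶ vHom V R G} (h : r.eval f = r.eval g) : f = g :=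
  nat_hom_ext fun b => eUncurry_injective (by rw [r.eUncurry_natProj, r.eUncurry_natProj, h])

end Representation

/-- Evaluation `[B, V] → V` preserves all limits. -/
lemma preservesLim_evalFunctor (a : B) (P : EnrichedFunctor V K V)
    (L : EnrichedFunctor V K (EnrichedFunctor V B V)) :
    PreservesLim (evalFunctor V a) P L := by
  intro l η hη
  suffices h : ∀ (Y : V) (s : ∀ j, Y ⊗ P.obj j ⟶ (L.obj j).obj a),
      (∀ j j', s j ▷ _ ≫ eUncurry (L.map j j' ≫ natProj _ _ a) =
        (α_ _ _ _).hom ≫ Y ◁ act P j j' ≫ s j') →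
      ∃! f : Y ⟶ l.obj a, ∀ j, f ▷ P.obj j ≫ eUncurry (η.app j ≫ natProj _ _ a) = s j from
    isLim_iff.2 h
  intro Y s hs
  -- Evaluation at `a` is represented by `B(a, -)`: testing the limit `l` against this one vertex
  -- gives the universal property of `l a`, without constructing any limit.
  let r : Representation _ a := homFromRepresentation (V := V) a
  obtain ⟨f, hf, hf'⟩ := hη (homFrom a) Y ⟨fun j => r.lift (s j), fun j j' => by
    apply r.eval_injective
    rw [r.eval_vComp, r.eval_comp, r.eval_comp, r.eval_lift, r.eval_lift, hs]⟩
  refine ⟨r.eval f, fun j => ?_, fun g hg => ?_⟩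
  · rw [← r.eval_vComp, hf, r.eval_lift]
  · rw [← hf' (r.lift g) fun j => r.eval_injective ?_, r.eval_lift]
    rw [r.eval_vComp, r.eval_lift, r.eval_lift, hg]

end Yoneda

/-! ### Joint epimorphy of the units of colimits in `V` -/

section ColimitsInV

variable {V : Type u} [Category.{v} V] [MonoidalCategory V] [SymmetricCategory V]
  [MonoidalClosed V]
variable {K : Type w₁} [EnrichedCategory V K]

/-- Transposing `c ⊗ X ⟶ Y` to an element of `[c, Y]` of stage `X` brings this under the uniqueness
already contained in the enriched universal property. -/
lemma IsColim.ext_whiskerRight {W : EnrichedFunctor V Kᵒᵖ V} {D : EnrichedFunctor V K V} {c : V}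
    {η : Cocylinder W D c} (h : IsColim W D c η) {X Y : V} {f g : c ⊗ X ⟶ Y}
    (e : ∀ k, eUncurry (η.app k) ▷ X ≫ f = eUncurry (η.app k) ▷ X ≫ g) : f = g := by
  refine eCurry_injective (h.hom_ext fun k => eUncurry_injective ?_)
  rw [eUncurry_vComp, eUncurry_vComp, eUncurry_eCurry, eUncurry_eCurry, e]

lemma IsColim.ext_whiskerLeft {W : EnrichedFunctor V Kᵒᵖ V} {D : EnrichedFunctor V K V} {c : V}
    {η : Cocylinder W D c} (h : IsColim W D c η) {X Y : V} {f g : X ⊗ c ⟶ Y}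
    (e : ∀ k, X ◁ eUncurry (η.app k) ≫ f = X ◁ eUncurry (η.app k) ≫ g) : f = g := by
  rw [← cancel_epi (β_ c X).hom]
  refine h.ext_whiskerRight fun k => ?_
  rw [braiding_naturality_left_assoc, braiding_naturality_left_assoc, e]

lemma IsColim.hom_ext_V {W : EnrichedFunctor V Kᵒᵖ V} {D : EnrichedFunctor V K V} {c : V}
    {η : Cocylinder W D c} (h : IsColim W D c η) {Y : V} {f g : c ⟶ Y}
    (e : ∀ k, eUncurry (η.app k) ≫ f = eUncurry (η.app k) ≫ g) : f = g :=
  (isColim_iff.1 h Y _ (η.balanced.comp f)).unique (fun _ => rfl) fun k => (e k).symm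

/-- The comparison isomorphism of two colimits in `V`. -/
lemma IsColim.exists_iso_V {W : EnrichedFunctor V Kᵒᵖ V} {D : EnrichedFunctor V K V} {c c' : V}
    {η : Cocylinder W D c} {η' : Cocylinder W D c'} (h : IsColim W D c η)
    (h' : IsColim W D c' η') : ∃ e : c ≅ c', ∀ k, eUncurry (η.app k) ≫ e.hom = eUncurry (η'.app k) := by
  obtain ⟨f, hf, -⟩ := isColim_iff.1 h c' _ η'.balanced
  obtain ⟨g, hg, -⟩ := isColim_iff.1 h' c _ η.balanced
  refine ⟨⟨f, g, h.hom_ext_V fun k => ?_, h'.hom_ext_V fun k => ?_⟩, hf⟩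
  · rw [reassoc_of% (hf k), hg, Category.comp_id]
  · rw [reassoc_of% (hg k), hf, Category.comp_id]

end ColimitsInV

/-! ### The tensor `F * G` as a `V`-functor of both variables -/

section TensorRight

variable {V : Type u} [Category.{v} V] [MonoidalCategory V] [SymmetricCategory V]
  [MonoidalClosed V] [HasLimits V]
variable {A : Type v} [EnrichedCategory V A]

lemma unit_comp_tensorMap {F : EnrichedFunctor V Aᵒᵖ V} (h : HasTensors F)
    (G H : EnrichedFunctor V A V) (a : A) {X : V} (f : X ⟶ vHom V G H) :
    vComp ((tensorUnit h G).app a) (f ≫ tensorMap h G H) =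
      (β_ _ _).hom ≫ vComp (f ≫ natProj G H a) ((tensorUnit h H).app a) := by
  rw [comp_vComp_right, comp_vComp_left, ← braiding_naturality_right_assoc, ← unit_tensorMap]

end TensorRight

section TensorLeft

variable {V : Type u} [Category.{v} V] [MonoidalCategory V] [SymmetricCategory V]
  [MonoidalClosed V] [HasLimits V]
variable {A : Type v} [EnrichedCategory V A]

lemma coact_eUncurry_natProj {F F' : EnrichedFunctor V Aᵒᵖ V} {X : V} (f : X ⟶ vHom V F F')
    (a a' : A) : coact F a a' ▷ X ≫ eUncurry (f ≫ natProj F F' (op a)) =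
      (α_ _ _ _).hom ≫ vHom V a a' ◁ eUncurry (f ≫ natProj F F' (op a')) ≫ coact F' a a' :=
  (isNat_iff_coact _).1 (isNat_comp_natProj f) a a'

variable {F F' F'' : EnrichedFunctor V Aᵒᵖ V} (h : HasTensors F) (h' : HasTensors F')
  (h'' : HasTensors F'')

/-- The family inducing the action of `- * G` on hom-objects. -/
def tensorLeftFamily (F : EnrichedFunctor V Aᵒᵖ V) (h' : HasTensors F')
    (G : EnrichedFunctor V A V) :
    Cofamily (vHom V F F') F G (tensorObj h' G) where
  app a := eUncurry (natProj F F' (op a)) ≫ (tensorUnit h' G).app a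
  naturality a a' := by
    have e := coact_eUncurry_natProj (𝟙 (vHom V F F')) a a'
    rw [Category.id_comp, Category.id_comp] at e
    rw [comp_vComp_right, (tensorUnit h' G).naturality, reassoc_of% e, Iso.inv_hom_id_assoc]

/-- The action of `- * G` on hom-objects. -/
def tensorLeft (G : EnrichedFunctor V A V) :
    vHom V F F' ⟶ vHom V (tensorObj h G) (tensorObj h' G) :=
  (isColim_tensor h G (tensorObj h' G) (vHom V F F') (tensorLeftFamily F h' G)).choose

lemma unit_tensorLeft (G : EnrichedFunctor V A V) (a : A) :
    vComp ((tensorUnit h G).app a) (tensorLeft h h' G) =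
      eUncurry (natProj F F' (op a)) ≫ (tensorUnit h' G).app a :=
  (isColim_tensor h G (tensorObj h' G) (vHom V F F') (tensorLeftFamily F h' G)).choose_spec.1 a

lemma unit_comp_tensorLeft (G : EnrichedFunctor V A V) (a : A) {X : V} (f : X ⟶ vHom V F F') :
    vComp ((tensorUnit h G).app a) (f ≫ tensorLeft h h' G) =
      eUncurry (f ≫ natProj F F' (op a)) ≫ (tensorUnit h' G).app a := by
  rw [comp_vComp_right, unit_tensorLeft, eUncurry_comp, Category.assoc]

lemma eId_tensorLeft (G : EnrichedFunctor V A V) :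
    eId V F ≫ tensorLeft h h G = eId V (tensorObj h G) :=
  (isColim_tensor h G).hom_ext fun a => by
    rw [unit_comp_tensorLeft, eId_natProj, eUncurry_eId, vComp_id]

lemma eComp_tensorLeft (G : EnrichedFunctor V A V) :
    eComp V F F' F'' ≫ tensorLeft h h'' G =
      vComp (tensorLeft h h' G) (tensorLeft h' h'' G) :=
  (isColim_tensor h G).hom_ext fun a => by
    rw [unit_comp_tensorLeft, eComp_natProj, eUncurry_vComp, vComp_assoc', unit_tensorLeft,
      comp_vComp_left, unit_tensorLeft, Category.assoc, Category.assoc]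

/-- The two partial actions of `F * G` commute. This interchange is what makes `D - * G ⟶ D - * H`
natural in the index of `D`. -/
lemma tensorLeft_tensorMap (G H : EnrichedFunctor V A V) :
    vComp (tensorLeft h h' G) (tensorMap h' G H) =
      (β_ _ _).hom ≫ vComp (tensorMap h G H) (tensorLeft h h' H) :=
  (isColim_tensor h G).hom_ext fun a => by
    rw [vComp_assoc', unit_tensorLeft, comp_vComp_left, unit_tensorMap,
      braiding_naturality_left_assoc, ← comp_vComp_right, ← unit_tensorLeft h, comp_vComp_right,
      vComp_assoc', vComp_assoc', unit_tensorMap, comp_vComp_left, vComp_assoc]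
    simp [braiding_tensor_left_hom]

variable {K : Type v} [EnrichedCategory V K] {D : EnrichedFunctor V K (EnrichedFunctor V Aᵒᵖ V)}
  (hD : ∀ k, HasTensors (D.obj k))

/-- The `V`-functor `k ↦ D k * G`. -/
def tensorDiagram (G : EnrichedFunctor V A V) : EnrichedFunctor V K V where
  obj k := tensorObj (hD k) G
  map k k' := D.map k k' ≫ tensorLeft (hD k) (hD k') G
  map_id k := by rw [← Category.assoc, D.map_id, eId_tensorLeft]
  map_comp x y z := by
    rw [← Category.assoc, D.map_comp, Category.assoc, eComp_tensorLeft (hD x) (hD y) (hD z), ← comp_vComp]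
    rfl

/-- The `V`-functor `[A, V] → [K, V]`, `G ↦ (k ↦ D k * G)`. -/
def tensorDiagramFunctor :
    EnrichedFunctor V (EnrichedFunctor V A V) (EnrichedFunctor V K V) :=
  ofFamily (tensorDiagram hD) (fun G H k => tensorMap (hD k) G H)
    (fun G H k k' => by
      have e : vComp (D.map k k' ≫ tensorLeft (hD k) (hD k') G) (tensorMap (hD k') G H) =
          (β_ _ _).hom ≫ vComp (tensorMap (hD k) G H)
            (D.map k k' ≫ tensorLeft (hD k) (hD k') H) := by
        rw [comp_vComp_left, tensorLeft_tensorMap, braiding_naturality_left_assoc,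
          ← comp_vComp_right]
      exact (congrArg (fun t => (β_ _ _).hom ≫ t) e).trans
        (SymmetricCategory.symmetry_assoc _ _ _))
    (fun G k => (tensorFunctor (hD k)).map_id G)
    (fun G H L k => (tensorFunctor (hD k)).map_comp G H L)

lemma tensorDiagramFunctor_map_natProj (G H : EnrichedFunctor V A V) (k : K) :
    (tensorDiagramFunctor hD).map G H ≫ natProj (tensorDiagram hD G) (tensorDiagram hD H) k =
      tensorMap (hD k) G H :=
  ofFamily_map_natProj _ _ _ _ _ _ _ _

lemma tensorDiagramFunctor_comp_evalFunctor (k : K) :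
    (tensorDiagramFunctor hD).comp V (evalFunctor V k) = tensorFunctor (hD k) :=
  EnrichedFunctor.ext V (fun _ => rfl) (fun G H =>
    (Category.comp_id _).trans (tensorDiagramFunctor_map_natProj hD G H k))

end TensorLeft

/-! ### Flatness is independent of the choice of the colimits -/

section FlatCriterion

variable {V : Type u} [Category.{v} V] [MonoidalCategory V] [SymmetricCategory V]
  [MonoidalClosed V] [HasLimits V]
variable {A : Type v} [EnrichedCategory V A] {P : LimIndexes V}

/-- Two choices of the colimits `F * G`, `V`-functorial in `G`, are naturally isomorphic. -/
lemma exists_natIso_of_isColim {F : EnrichedFunctor V Aᵒᵖ V}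
    {T T' : EnrichedFunctor V (EnrichedFunctor V A V) V}
    {η : ∀ G : EnrichedFunctor V A V, Cocylinder F G (T.obj G)}
    {η' : ∀ G : EnrichedFunctor V A V, Cocylinder F G (T'.obj G)}
    (hη : ∀ G, IsColim F G (T.obj G) (η G)) (hη' : ∀ G, IsColim F G (T'.obj G) (η' G))
    (nat : ∀ G H a, vComp ((η G).app a) (T.map G H) =
      (β_ _ _).hom ≫ vComp (natProj G H a) ((η H).app a))
    (nat' : ∀ G H a, vComp ((η' G).app a) (T'.map G H) =
      (β_ _ _).hom ≫ vComp (natProj G H a) ((η' H).app a)) :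
    ∃ φ : ∀ G, T.obj G ≅ T'.obj G,
      ∀ G H, act T G H ≫ (φ H).hom = (φ G).hom ▷ _ ≫ act T' G H := by
  choose φ hφ using fun G => (hη G).exists_iso_V (hη' G)
  -- On the components of the unit, both functorial actions are given by the same formula in
  -- `natProj`, and `φ` matches the units.
  refine ⟨φ, fun G H => (hη G).ext_whiskerRight fun a => ?_⟩
  have e1 : eUncurry ((η G).app a) ▷ vHom V G H ≫ act T G H =
      (α_ _ _ _).hom ≫ eUncurry (vComp ((η G).app a) (T.map G H)) := by
    rw [eUncurry_vComp, Iso.hom_inv_id_assoc]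
    rfl
  have e2 : eUncurry ((η' G).app a) ▷ vHom V G H ≫ act T' G H =
      (α_ _ _ _).hom ≫ eUncurry (vComp ((η' G).app a) (T'.map G H)) := by
    rw [eUncurry_vComp, Iso.hom_inv_id_assoc]
    rfl
  rw [reassoc_of% e1, ← comp_whiskerRight_assoc, hφ, e2, nat, nat', eUncurry_comp, eUncurry_comp,
    eUncurry_vComp, eUncurry_vComp, ← hφ H a]
  simp only [Category.assoc]

/-- A presheaf `F` is flat when the colimits `F * G` can be chosen so as to form a `V`-functor
of `G` that preserves `P`-limits. -/
lemma flat_of_functor {F : EnrichedFunctor V Aᵒᵖ V}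
    (T : EnrichedFunctor V (EnrichedFunctor V A V) V)
    (η : ∀ G : EnrichedFunctor V A V, Cocylinder F G (T.obj G))
    (hη : ∀ G, IsColim F G (T.obj G) (η G))
    (nat : ∀ G H a, vComp ((η G).app a) (T.map G H) =
      (β_ _ _).hom ≫ vComp (natProj G H a) ((η H).app a))
    (pres : ∀ (K : Type v) [EnrichedCategory V K] (W : EnrichedFunctor V K V),
      P K W → ∀ L : EnrichedFunctor V K (EnrichedFunctor V A V), PreservesLim T W L) :
    Flat P A F := by
  have h : HasTensors F := fun G => ⟨T.obj G, η G, hη G⟩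
  -- `Flat` speaks of the chosen functor `tensorFunctor h`, so preservation is transported from `T`
  -- along the comparison isomorphism.
  obtain ⟨φ, hφ⟩ := exists_natIso_of_isColim (T' := tensorFunctor h) (η' := tensorUnit h) hη
    (isColim_tensor h) nat (unit_tensorMap h)
  exact ⟨h, fun K _ W hW L => (pres K W hW L).of_natIso φ hφ⟩

lemma Flat.hasTensors {F : EnrichedFunctor V Aᵒᵖ V} (h : Flat P A F) : HasTensors F := h.choose

lemma Flat.preservesLim {F : EnrichedFunctor V Aᵒᵖ V} (h : Flat P A F) (K : Type v)
    [EnrichedCategory V K] (W : EnrichedFunctor V K V) (hW : P K W)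
    (L : EnrichedFunctor V K (EnrichedFunctor V A V)) :
    PreservesLim (tensorFunctor h.hasTensors) W L := h.choose_spec K W hW L

end FlatCriterion

/-! ### Existence of pointwise colimits for tensorable weights -/

section Pointwise

variable {V : Type u} [Category.{v} V] [MonoidalCategory V] [SymmetricCategory V]
  [MonoidalClosed V] [HasLimits V]
variable {K : Type v} [EnrichedCategory V K] {B : Type v} [EnrichedCategory V B]

/-- The transpose `B → [K, V]` of a `V`-functor `K → [B, V]`. -/
def transpose (D : EnrichedFunctor V K (EnrichedFunctor V B V)) :
    EnrichedFunctor V B (EnrichedFunctor V K V) :=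
  ofFamily (fun b => D.comp V (evalFunctor V b)) (fun b b' k => (D.obj k).map b b')
    (fun b b' k k' => (congrArg (fun t => (β_ _ _).hom ≫ t)
      (isNat_comp_natProj (D.map k k') b b').symm).trans (SymmetricCategory.symmetry_assoc _ _ _))
    (fun b k => (D.obj k).map_id b) (fun b b' b'' k => (D.obj k).map_comp b b' b'')

lemma transpose_map_natProj (D : EnrichedFunctor V K (EnrichedFunctor V B V)) (b b' : B) (k : K) :
    (transpose D).map b b' ≫ natProj (D.comp V (evalFunctor V b)) (D.comp V (evalFunctor V b')) k =
      (D.obj k).map b b' :=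
  ofFamily_map_natProj _ _ _ _ _ _ _ _

/-- Colimits in `[B, V]` are computed pointwise. -/
lemma HasTensors.exists_pointwise_isColim {W : EnrichedFunctor V Kᵒᵖ V} (h : HasTensors W)
    (D : EnrichedFunctor V K (EnrichedFunctor V B V)) :
    ∃ (F : EnrichedFunctor V B V) (κ : Cocylinder W D F),
      ∀ b, IsColim W (D.comp V (evalFunctor V b)) (F.obj b) (κ.mapCyl (evalFunctor V b)) := by
  -- The colimit is `b ↦ W * (D - b)`. Its functoriality comes from `W * -`, and naturality of its
  -- unit in `b` is the equation characterizing `tensorMap`.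
  let F : EnrichedFunctor V B V := (transpose D).comp V (tensorFunctor h)
  let c : ∀ (k : K) (b : B), W.obj (op k) ⟶ vHom V ((D.obj k).obj b) (F.obj b) :=
    fun k b => (tensorUnit h (D.comp V (evalFunctor V b))).app k
  have hc : ∀ k, IsNat (D.obj k) F (c k) := by
    intro k b b'
    have e := unit_comp_tensorMap h (D.comp V (evalFunctor V b)) (D.comp V (evalFunctor V b')) k
      (X := vHom V b b') ((transpose D).map b b')
    refine Eq.trans ?_ e.symm
    exact congrArg (fun t => (β_ _ _).hom ≫
      vComp t ((tensorUnit h (D.comp V (evalFunctor V b'))).app k))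
        (transpose_map_natProj D b b' k).symm
  refine ⟨F, ⟨fun k => natLift (c k) (hc k), fun k k' => nat_hom_ext fun b => ?_⟩, fun b => ?_⟩
  · rw [vComp_natProj, natLift_proj, Category.assoc, natLift_proj]
    exact (tensorUnit h (D.comp V (evalFunctor V b))).naturality k k'
  · exact (isColim_tensor h (D.comp V (evalFunctor V b))).congr rfl
      fun k => heq_of_eq (natLift_proj (c k) (hc k) b).symm

end Pointwise

/-! ### Closure of flat presheaves under flat-indexed colimits -/

section Closure

variable {V : Type u} [Category.{v} V] [MonoidalCategory V] [SymmetricCategory V]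
  [MonoidalClosed V] [HasLimits V]
variable {K : Type v} [EnrichedCategory V K] {A : Type v} [EnrichedCategory V A]
variable {W : EnrichedFunctor V Kᵒᵖ V} {D : EnrichedFunctor V K (EnrichedFunctor V Aᵒᵖ V)}
  {F : EnrichedFunctor V Aᵒᵖ V} {κ : Cocylinder W D F}

/-- The components `D k a ⊗ W k ⟶ F a` of a cocylinder in `[Aᵒᵖ, V]`. -/
def Cocylinder.component (κ : Cocylinder W D F) (k : K) (a : A) :
    (D.obj k).obj (op a) ⊗ W.obj (op k) ⟶ F.obj (op a) :=
  eUncurry (κ.app k ≫ natProj _ _ (op a))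

lemma Cocylinder.component_balanced (κ : Cocylinder W D F) (k k' : K) (a : A) :
    (α_ _ _ _).inv ≫ eUncurry (D.map k k' ≫ natProj _ _ (op a)) ▷ W.obj (op k') ≫
      κ.component k' a = _ ◁ coact W k k' ≫ κ.component k a := by
  rw [component, ← eUncurry_vComp, ← vComp_natProj, κ.naturality, Category.assoc, eUncurry_comp,
    component]

lemma Cocylinder.coact_component (κ : Cocylinder W D F) (k : K) (a a' : A) :
    coact (D.obj k) a a' ▷ W.obj (op k) ≫ κ.component k a =
      (α_ _ _ _).hom ≫ vHom V a a' ◁ κ.component k a' ≫ coact F a a' :=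
  coact_eUncurry_natProj _ _ _

/-- The colimit of `D` indexed by `W` in `[Aᵒᵖ, V]` is pointwise. -/
def Cocylinder.Pointwise (κ : Cocylinder W D F) : Prop :=
  ∀ a, IsColim W (D.comp V (evalFunctor V a)) (F.obj a) (κ.mapCyl (evalFunctor V a))

namespace Cocylinder.Pointwise

lemma ext_whiskerRight (hκ : κ.Pointwise) {a : A} {X Y : V} {f g : F.obj (op a) ⊗ X ⟶ Y}
    (e : ∀ k, κ.component k a ▷ X ≫ f = κ.component k a ▷ X ≫ g) : f = g :=
  IsColim.ext_whiskerRight (hκ (op a)) e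

lemma ext_whiskerLeft (hκ : κ.Pointwise) {a : A} {X Y : V} {f g : X ⊗ F.obj (op a) ⟶ Y}
    (e : ∀ k, X ◁ κ.component k a ≫ f = X ◁ κ.component k a ≫ g) : f = g :=
  IsColim.ext_whiskerLeft (hκ (op a)) e

lemma exists_desc (hκ : κ.Pointwise) {a : A} {Y : V}
    (s : ∀ k, (D.obj k).obj (op a) ⊗ W.obj (op k) ⟶ Y)
    (hs : ∀ k k', (α_ _ _ _).inv ≫ eUncurry (D.map k k' ≫ natProj _ _ (op a)) ▷ W.obj (op k') ≫
      s k' = _ ◁ coact W k k' ≫ s k) :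
    ∃ f : F.obj (op a) ⟶ Y, ∀ k, κ.component k a ≫ f = s k :=
  (isColim_iff.1 (hκ (op a)) Y s hs).exists

end Cocylinder.Pointwise

section

variable (hW : HasTensors W) (hD : ∀ k, HasTensors (D.obj k)) (G H : EnrichedFunctor V A V)

/-- The object `W * (D - * G)`. -/
def iteratedTensor : V := tensorObj hW (tensorDiagram hD G)

/-- The unit `W k ⟶ [D k * G, W * (D - * G)]`. -/
def outerUnit (k : K) : W.obj (op k) ⟶ vHom V (tensorObj (hD k) G) (iteratedTensor hW hD G) :=
  (tensorUnit hW (tensorDiagram hD G)).app k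

lemma outerUnit_naturality (k k' : K) :
    vComp (D.map k k' ≫ tensorLeft (hD k) (hD k') G) (outerUnit hW hD G k') =
      coact W k k' ≫ outerUnit hW hD G k :=
  (tensorUnit hW (tensorDiagram hD G)).naturality k k'

lemma exists_outerUnit_desc {X Y : V}
    (r : ∀ k, W.obj (op k) ⊗ X ⟶ vHom V (tensorObj (hD k) G) Y)
    (hr : ∀ k k', vComp (D.map k k' ≫ tensorLeft (hD k) (hD k') G) (r k') =
      (α_ _ _ _).inv ≫ coact W k k' ▷ X ≫ r k) :
    ∃! t : X ⟶ vHom V (iteratedTensor hW hD G) Y, ∀ k, vComp (outerUnit hW hD G k) t = r k :=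
  isColim_tensor hW (tensorDiagram hD G) Y X ⟨r, hr⟩

/-- The action of `W * (D - * G)` on hom-objects. -/
def iteratedMap : vHom V G H ⟶ vHom V (iteratedTensor hW hD G) (iteratedTensor hW hD H) :=
  ((tensorDiagramFunctor hD).comp V (tensorFunctor hW)).map G H

lemma outerUnit_iteratedMap (k : K) :
    vComp (outerUnit hW hD G k) (iteratedMap hW hD G H) =
      (β_ _ _).hom ≫ vComp (tensorMap (hD k) G H) (outerUnit hW hD H k) :=
  (unit_comp_tensorMap hW (tensorDiagram hD G) (tensorDiagram hD H) k (X := vHom V G H)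
    ((tensorDiagramFunctor hD).map G H)).trans
    (congrArg (fun t => (β_ _ _).hom ≫ vComp t (outerUnit hW hD H k))
      (tensorDiagramFunctor_map_natProj hD G H k))

/-- The components `D k a ⊗ W k ⟶ [G a, W * (D - * G)]` of the unit of `F * G`. -/
def iteratedUnit (k : K) (a : A) :
    (D.obj k).obj (op a) ⊗ W.obj (op k) ⟶ vHom V (G.obj a) (iteratedTensor hW hD G) :=
  vComp ((tensorUnit (hD k) G).app a) (outerUnit hW hD G k)

lemma iteratedUnit_balanced (a : A) (k k' : K) :
    (α_ _ _ _).inv ≫ eUncurry (D.map k k' ≫ natProj _ _ (op a)) ▷ W.obj (op k') ≫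
      iteratedUnit hW hD G k' a = _ ◁ coact W k k' ≫ iteratedUnit hW hD G k a := by
  rw [iteratedUnit, iteratedUnit, ← comp_vComp_left, ← unit_comp_tensorLeft (hD k), ← vComp_assoc',
    outerUnit_naturality, comp_vComp_right]

/-- For fixed `a` the maps `iteratedUnit` are balanced in `k`, so they descend to the pointwise
colimit `F a`; naturality in `a` may be checked on the components, which are equivariant for the
action of `A`. -/
lemma exists_compositeUnit (hκ : κ.Pointwise) :
    ∃ η : Cocylinder F G (iteratedTensor hW hD G),
      ∀ k a, κ.component k a ≫ η.app a = iteratedUnit hW hD G k a := by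
  choose n hn using fun a => hκ.exists_desc (a := a) (fun k => iteratedUnit hW hD G k a)
    (iteratedUnit_balanced hW hD G a)
  refine ⟨⟨n, fun a a' => hκ.ext_whiskerLeft fun k => ?_⟩, fun k a => hn a k⟩
  have e := κ.coact_component k a a' =≫ n a
  rw [Category.assoc, hn, Category.assoc, Category.assoc, iteratedUnit] at e
  rw [← comp_vComp_right, hn, iteratedUnit, vComp_assoc', (tensorUnit (hD k) G).naturality,
    comp_vComp_left, e, Iso.inv_hom_id_assoc]

/-- The unit of the colimit `F * G ≅ W * (D - * G)`, for `F ≅ W * D`. -/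
def compositeUnit (hκ : κ.Pointwise) : Cocylinder F G (iteratedTensor hW hD G) :=
  (exists_compositeUnit hW hD G hκ).choose

lemma component_compositeUnit (hκ : κ.Pointwise) (k : K) (a : A) :
    κ.component k a ≫ (compositeUnit hW hD G hκ).app a = iteratedUnit hW hD G k a :=
  (exists_compositeUnit hW hD G hκ).choose_spec k a

/-- This is `(W * D) * G ≅ W * (D - * G)`, by interchange of colimits. A cofamily on `F`, restricted
along the components of `κ`, becomes one in `k` and `a` together; it is factored over `a` through
each `D k * G`, and the results over `k`. -/
lemma isColim_compositeUnit (hκ : κ.Pointwise) :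
    IsColim F G (iteratedTensor hW hD G) (compositeUnit hW hD G hκ) := by
  intro Y X σ
  have h1 : ∀ k, ∃ r : W.obj (op k) ⊗ X ⟶ vHom V (tensorObj (hD k) G) Y, ∀ a,
      vComp ((tensorUnit (hD k) G).app a) r =
        (α_ _ _ _).inv ≫ κ.component k a ▷ X ≫ σ.app a := fun k =>
    (isColim_tensor (hD k) G Y (W.obj (op k) ⊗ X)
      ⟨fun a => (α_ _ _ _).inv ≫ κ.component k a ▷ X ≫ σ.app a, fun a a' => by
        have e := congrArg (fun t => t ▷ X ≫ σ.app a) (κ.coact_component k a a')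
        simp only [comp_whiskerRight, Category.assoc] at e
        rw [comp_vComp_right, comp_vComp_right, σ.naturality,
          associator_inv_naturality_left_assoc, e]
        simp⟩).exists
  choose r hr using h1
  obtain ⟨t, ht, ht'⟩ := exists_outerUnit_desc hW hD G r fun k k' => by
    refine (isColim_tensor (hD k) G).hom_ext fun a => ?_
    have e := congrArg (fun t => t ▷ X ≫ σ.app a) (κ.component_balanced k k' a)
    simp only [comp_whiskerRight, Category.assoc] at e
    rw [vComp_assoc', unit_comp_tensorLeft, comp_vComp_left, comp_vComp_right, comp_vComp_right,
      hr, hr, associator_inv_naturality_middle_assoc, ← e]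
    simp
  -- Composition with the unit of `F * G`, restricted to a component of `F`, is composition with the
  -- outer unit followed by the inner one; existence and uniqueness of `t` both reduce to this.
  have key : ∀ (t : X ⟶ vHom V (iteratedTensor hW hD G) Y) (k : K) (a : A),
      κ.component k a ▷ X ≫ vComp ((compositeUnit hW hD G hκ).app a) t = (α_ _ _ _).hom ≫
        vComp ((tensorUnit (hD k) G).app a) (vComp (outerUnit hW hD G k) t) := by
    intro t k a
    rw [← comp_vComp_left, component_compositeUnit, iteratedUnit, vComp_assoc]
  refine ⟨t, fun a => hκ.ext_whiskerRight fun k => ?_, fun t' h' => ht' t' fun k => ?_⟩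
  · rw [key, ht, hr, Iso.hom_inv_id_assoc]
  · refine (isColim_tensor (hD k) G).hom_ext fun a => ?_
    rw [hr, ← h', key, Iso.inv_hom_id_assoc]

lemma compositeUnit_natural (hκ : κ.Pointwise) (a : A) :
    vComp ((compositeUnit hW hD G hκ).app a) (iteratedMap hW hD G H) =
      (β_ _ _).hom ≫ vComp (natProj G H a) ((compositeUnit hW hD H hκ).app a) := by
  refine hκ.ext_whiskerRight fun k => ?_
  rw [← comp_vComp_left, component_compositeUnit, braiding_naturality_left_assoc,
    ← comp_vComp_right, component_compositeUnit, iteratedUnit, iteratedUnit, vComp_assoc,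
    outerUnit_iteratedMap, comp_vComp_right, vComp_assoc', unit_tensorMap, comp_vComp_left,
    vComp_assoc]
  simp [braiding_tensor_left_hom]

end

variable {P : LimIndexes V}

/-- Flat presheaves are closed under flat-indexed colimits. -/
lemma flat_of_pointwise (hW : Flat P K W) (hD : ∀ k, Flat P A (D.obj k)) (hκ : κ.Pointwise) :
    Flat P A F :=
  flat_of_functor ((tensorDiagramFunctor fun k => (hD k).hasTensors).comp V
      (tensorFunctor hW.hasTensors))
    (fun G => compositeUnit hW.hasTensors (fun k => (hD k).hasTensors) G hκ)
    (fun G => isColim_compositeUnit hW.hasTensors (fun k => (hD k).hasTensors) G hκ)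
    (fun G H a => compositeUnit_natural hW.hasTensors (fun k => (hD k).hasTensors) G H hκ a)
    -- Limits in `[K, V]` are detected pointwise, and at `k` the first factor is `D k * -`; the
    -- second factor is `W * -`.
    (fun J _ Q hQ L => PreservesLim.comp (preservesLim_of_eval fun k => by
      rw [tensorDiagramFunctor_comp_evalFunctor]
      exact (hD k).preservesLim J Q hQ L) (hW.preservesLim J Q hQ _))

end Closure

/-! ### Flatness of representable presheaves -/

section Representable

variable {V : Type u} [Category.{v} V] [MonoidalCategory V] [SymmetricCategory V]
  [MonoidalClosed V] [HasLimits V]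
variable {A : Type v} [EnrichedCategory V A] {P : LimIndexes V}

/-- The isomorphism `A(b, a) ≅ F b` of a representation of a presheaf. -/
def Representation.coIso {F : EnrichedFunctor V Aᵒᵖ V} {a : A} (r : Representation F (op a))
    (b : A) : vHom V b a ≅ F.obj (op b) :=
  r.iso (op b)

lemma Representation.coact_coIso_inv {F : EnrichedFunctor V Aᵒᵖ V} {a : A}
    (r : Representation F (op a)) (b b' : A) :
    coact F b b' ≫ (r.coIso b).inv = vHom V b b' ◁ (r.coIso b').inv ≫ eComp V b b' a := by
  have h : act F (op b') (op b) ≫ (r.coIso b).inv =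
      (r.coIso b').inv ▷ vHom V b b' ≫ (β_ _ _).hom ≫ eComp V b b' a := r.inv_nat (op b') (op b)
  rw [coact_eq, Category.assoc, h, braiding_naturality_left_assoc,
    SymmetricCategory.symmetry_assoc]

/-- Representable presheaves are flat. -/
lemma Representation.flat {F : EnrichedFunctor V Aᵒᵖ V} {a : A} (r : Representation F (op a)) :
    Flat P A F := by
  -- By co-Yoneda `F * G` is `G a`, with unit `A(b, a) ⟶ [G b, G a]` the action of `G` on homs.
  refine flat_of_functor (evalFunctor V a) (fun G => ⟨fun b => (r.coIso b).inv ≫ G.map b a,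
    fun b b' => ?_⟩) (fun G Y X σ => ?_) (fun G H b => ?_)
    (fun K _ W _ L => preservesLim_evalFunctor a W L)
  · have h : vComp (G.map b b') ((r.coIso b').inv ≫ G.map b' a) =
        coact F b b' ≫ (r.coIso b).inv ≫ G.map b a := by
      have e : eComp V b b' a ≫ G.map b a = vComp (G.map b b') (G.map b' a) := G.map_comp b b' a
      rw [comp_vComp_right, ← e, reassoc_of% (r.coact_coIso_inv b b')]
    exact h
  · suffices h : ∃! f : X ⟶ vHom V (G.obj a) Y,
        ∀ b, vComp ((r.coIso b).inv ≫ G.map b a) f = σ.app b from h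
    -- Naturality determines the whole cofamily by `σ.app a` on the universal element of `F a`, the
    -- image of the identity of `a`.
    have hσ : ∀ b, (r.coIso b).hom ▷ X ≫ σ.app b = (vHom V b a ◁ ((λ_ X).inv ≫
        (eId V a ≫ (r.coIso a).hom) ▷ X)) ≫ vComp (G.map b a) (σ.app a) := by
      intro b
      have e : (ρ_ (vHom V b a)).inv ≫ vHom V b a ◁ (eId V a ≫ (r.coIso a).hom) ≫ coact F b a =
          (r.coIso b).hom := by
        rw [← Iso.comp_inv_eq_id]
        simp only [Category.assoc]
        rw [r.coact_coIso_inv]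
        simp only [← MonoidalCategory.whiskerLeft_comp_assoc, Category.assoc, Iso.hom_inv_id,
          Category.comp_id]
        exact e_comp_id V b a
      rw [σ.naturality, ← e]
      simp
    refine ⟨(λ_ X).inv ≫ (eId V a ≫ (r.coIso a).hom) ▷ X ≫ σ.app a, fun b => ?_, fun t ht => ?_⟩
    · rw [comp_vComp_left, ← Category.assoc (λ_ X).inv, comp_vComp_right, ← hσ,
        inv_hom_whiskerRight_assoc]
    · rw [← ht, comp_vComp_left, ← comp_whiskerRight_assoc, Category.assoc, Iso.hom_inv_id,
        Category.comp_id, ← comp_vComp_left, G.map_id, id_vComp, Iso.inv_hom_id_assoc]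
  · have e : vComp (G.map b a) (natProj G H a) =
      (β_ _ _).hom ≫ vComp (natProj G H b) (H.map b a) := by
      simpa using vComp_map_comp_natProj (𝟙 (vHom V G H)) b a
    suffices h : vComp ((r.coIso b).inv ≫ G.map b a) (natProj G H a) = (β_ _ _).hom ≫
        vComp (natProj G H b) ((r.coIso b).inv ≫ H.map b a) from h
    rw [comp_vComp_left, e, comp_vComp_right, braiding_naturality_left_assoc]

end Representable

/-! ### Transport of flatness along isomorphisms of index categories -/

section Reindex

variable {V : Type u} [Category.{v} V] [MonoidalCategory V] [SymmetricCategory V]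
  [MonoidalClosed V] [HasLimits V]
variable {A : Type v} [EnrichedCategory V A] {J : Type v} [EnrichedCategory V J]
  {P : LimIndexes V}

/-- Restriction along a `V`-functor `A → J`, as a `V`-functor `[J, V] → [A, V]`. -/
def restrictFunctor (y : EnrichedFunctor V A J) :
    EnrichedFunctor V (EnrichedFunctor V J V) (EnrichedFunctor V A V) :=
  ofFamily (fun G => y.comp V G) (fun G H a => natProj G H (y.obj a))
    (fun G H a a' => by
      have h : (β_ _ _).hom ≫ vComp (y.map a a' ≫ G.map _ _) (natProj G H (y.obj a')) =
          vComp (natProj G H (y.obj a)) (y.map a a' ≫ H.map _ _) := by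
        rw [comp_vComp_left, comp_vComp_right, ← natProj_isNat, braiding_naturality_right_assoc]
      exact h)
    (fun G a => eId_natProj G (y.obj a)) (fun G H L a => eComp_natProj G H L (y.obj a))

lemma restrictFunctor_map_natProj (y : EnrichedFunctor V A J) (G H : EnrichedFunctor V J V)
    (a : A) : (restrictFunctor y).map G H ≫ natProj (y.comp V G) (y.comp V H) a =
      natProj G H (y.obj a) :=
  ofFamily_map_natProj _ _ _ _ _ _ _ _

/-- Restriction followed by evaluation at `a` is evaluation at `y a`, which preserves all limits. -/
lemma preservesLim_restrictFunctor (y : EnrichedFunctor V A J) {K : Type w₁}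
    [EnrichedCategory V K] (W : EnrichedFunctor V K V)
    (L : EnrichedFunctor V K (EnrichedFunctor V J V)) : PreservesLim (restrictFunctor y) W L :=
  preservesLim_of_eval fun a => by
    have e : (restrictFunctor y).comp V (evalFunctor V a) = evalFunctor V (y.obj a) :=
      EnrichedFunctor.ext V (fun _ => rfl) (fun G H =>
        (Category.comp_id _).trans (restrictFunctor_map_natProj y G H a))
    rw [e]
    exact preservesLim_evalFunctor _ _ _

section

variable (y : EnrichedFunctor V A J) {F : EnrichedFunctor V Aᵒᵖ V} {F' : EnrichedFunctor V Jᵒᵖ V}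
  (φ : ∀ a, F.obj (op a) ≅ F'.obj (op (y.obj a)))

lemma exists_reindexed_cocylinder (hy : Function.Bijective y.obj)
    (hff : ∀ a b, IsIso (y.map a b))
    (hφ : ∀ a a', coact F a a' ≫ (φ a).hom = (y.map a a' ⊗ₘ (φ a').hom) ≫ coact F' _ _)
    {N : Type w₃} [EnrichedCategory V N] {G : EnrichedFunctor V J N} {c : N}
    (η : Cocylinder F (y.comp V G) c) :
    ∃ η' : Cocylinder F' G c, ∀ a, (φ a).hom ≫ η'.app (y.obj a) = η.app a := by
  -- An object `j` is only propositionally of the form `y a`. The component at `j` is therefore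
  -- specified for every such presentation, so that the one by reflexivity can be used afterwards.
  have h1 : ∀ j, ∃ x : F'.obj (op j) ⟶ vHom V (G.obj j) c, ∀ a (e : j = y.obj a),
      (φ a).hom ≫ (e ▸ x : F'.obj (op (y.obj a)) ⟶ vHom V (G.obj (y.obj a)) c) = η.app a := by
    intro j
    obtain ⟨a, rfl⟩ := hy.2 j
    refine ⟨(φ a).inv ≫ η.app a, fun a' e => ?_⟩
    obtain rfl := hy.1 e
    exact Iso.hom_inv_id_assoc _ _
  choose x hx using h1
  have hx' : ∀ a, (φ a).hom ≫ x (y.obj a) = η.app a := fun a => hx _ a rfl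
  refine ⟨⟨x, fun j j' => ?_⟩, hx'⟩
  obtain ⟨a, rfl⟩ := hy.2 j
  obtain ⟨a', rfl⟩ := hy.2 j'
  have := hff a a'
  rw [← cancel_epi (y.map a a' ⊗ₘ (φ a').hom), ← comp_vComp, hx', ← Category.assoc, ← hφ,
    Category.assoc, hx']
  exact η.naturality a a'

/-- A cofamily over `J` restricts along `y` to one over `A`, where it factors; as every object of
`J` is some `y a`, the factorization is valid over `J`. -/
lemma isColim_reindexed (hy : Function.Bijective y.obj)
    (hφ : ∀ a a', coact F a a' ≫ (φ a).hom = (y.map a a' ⊗ₘ (φ a').hom) ≫ coact F' _ _)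
    {N : Type w₃} [EnrichedCategory V N] {G : EnrichedFunctor V J N} {c : N}
    {η : Cocylinder F (y.comp V G) c} (hη : IsColim F (y.comp V G) c η) {η' : Cocylinder F' G c}
    (h : ∀ a, (φ a).hom ≫ η'.app (y.obj a) = η.app a) : IsColim F' G c η' := by
  intro m X σ
  obtain ⟨t, ht, ht'⟩ := hη m X ⟨fun a => (φ a).hom ▷ X ≫ σ.app (y.obj a), fun a a' => by
    have e : vComp (y.map a a' ≫ G.map _ _) ((φ a').hom ▷ X ≫ σ.app (y.obj a')) =
        (α_ _ _ _).inv ≫ coact F a a' ▷ X ≫ (φ a).hom ▷ X ≫ σ.app (y.obj a) := by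
      rw [← comp_whiskerRight_assoc, hφ, comp_vComp, σ.naturality]
      simp [MonoidalCategory.tensorHom_def]
    exact e⟩
  have key : ∀ (t : X ⟶ vHom V c m) (a : A), vComp (η'.app (y.obj a)) t = σ.app (y.obj a) ↔
      vComp (X := F.obj (op a)) (a := G.obj (y.obj a)) (η.app a) t =
        (φ a).hom ▷ X ≫ σ.app (y.obj a) := by
    intro t a
    rw [← h, comp_vComp_left, cancel_epi]
  refine ⟨t, fun j => ?_, fun t' h' => ht' t' fun a => (key t' a).1 (h' _)⟩
  obtain ⟨a, rfl⟩ := hy.2 j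
  exact (key t a).2 (ht a)

/-- Flatness is invariant under isomorphisms of presheaves over isomorphisms of `V`-categories. -/
lemma Flat.reindex (hy : Function.Bijective y.obj) (hff : ∀ a b, IsIso (y.map a b))
    (hφ : ∀ a a', coact F a a' ≫ (φ a).hom = (y.map a a' ⊗ₘ (φ a').hom) ≫ coact F' _ _)
    (hF : Flat P A F) : Flat P J F' := by
  choose η hη using fun G : EnrichedFunctor V J V =>
    exists_reindexed_cocylinder y φ hy hff hφ (tensorUnit hF.hasTensors (y.comp V G))
  have hη' : ∀ G, IsColim F' G (tensorObj hF.hasTensors (y.comp V G)) (η G) := fun G =>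
    isColim_reindexed y φ hy hφ (isColim_tensor hF.hasTensors (y.comp V G)) (hη G)
  refine flat_of_functor ((restrictFunctor y).comp V (tensorFunctor hF.hasTensors)) η hη'
    (fun G H j => ?_)
    fun K _ W hW L => (preservesLim_restrictFunctor y W L).comp (hF.preservesLim K W hW _)
  obtain ⟨a, rfl⟩ := hy.2 j
  have e := (unit_comp_tensorMap hF.hasTensors (y.comp V G) (y.comp V H) a (X := vHom V G H)
    ((restrictFunctor y).map G H)).trans (congrArg (fun t => (β_ _ _).hom ≫
      vComp t ((tensorUnit hF.hasTensors (y.comp V H)).app a)) (restrictFunctor_map_natProj y G H a))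
  -- The units over `A` are replaced by variables `u`, `u'`, typed by the values of `G` and `H` at
  -- `y a`; the required equation is then that of `e` with the isomorphism `φ a` cancelled.
  suffices h : ∀ (u : F.obj (op a) ⟶ vHom V (G.obj (y.obj a)) (tensorObj hF.hasTensors (y.comp V G)))
      (u' : F.obj (op a) ⟶ vHom V (H.obj (y.obj a)) (tensorObj hF.hasTensors (y.comp V H))),
      (φ a).hom ≫ (η G).app (y.obj a) = u → (φ a).hom ≫ (η H).app (y.obj a) = u' →
      ∀ t : vHom V G H ⟶ vHom V (tensorObj hF.hasTensors (y.comp V G))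
        (tensorObj hF.hasTensors (y.comp V H)),
      vComp u t = (β_ _ _).hom ≫ vComp (natProj G H (y.obj a)) u' →
      vComp ((η G).app (y.obj a)) t =
        (β_ _ _).hom ≫ vComp (natProj G H (y.obj a)) ((η H).app (y.obj a)) from
    h _ _ (hη G a) (hη H a) _ e
  rintro u u' rfl rfl t ht
  rw [comp_vComp_left, comp_vComp_right, ← braiding_naturality_left_assoc, cancel_epi] at ht
  exact ht

end

/-- Flatness is invariant under isomorphism. -/
lemma Flat.of_iso {F F' : EnrichedFunctor V Aᵒᵖ V} (φ : ∀ a, F.obj (op a) ≅ F'.obj (op a))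
    (hφ : ∀ a a', coact F a a' ≫ (φ a).hom = vHom V a a' ◁ (φ a').hom ≫ coact F' a a')
    (hF : Flat P A F) : Flat P A F' :=
  Flat.reindex (EnrichedFunctor.id V A) φ Function.bijective_id (fun _ _ => inferInstanceAs (IsIso (𝟙 _)))
    (fun a a' => (hφ a a').trans (congrArg (fun t => t ≫ _) (id_tensorHom _ _).symm)) hF

end Reindex

/-! ### From natural isomorphisms to isomorphisms in the presheaf category -/

section NaturalIsomorphisms

variable {V : Type u} [Category.{v} V] [MonoidalCategory V] [SymmetricCategory V]
  [MonoidalClosed V] [HasLimits V]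
variable {A : Type v} [EnrichedCategory V A]

/-- The element of `[Aᵒᵖ, V](F, F')` given by a `V`-natural family of morphisms. -/
def natElement {F F' : EnrichedFunctor V Aᵒᵖ V} (φ : ∀ a, F.obj (op a) ⟶ F'.obj (op a))
    (hφ : ∀ a a', coact F a a' ≫ φ a = vHom V a a' ◁ φ a' ≫ coact F' a a') :
    𝟙_ V ⟶ vHom V F F' :=
  natLift (fun a => eCurry ((ρ_ (F.obj (op a.unop))).hom ≫ φ a.unop))
    ((isNat_iff_coact _).2 fun a a' => by
      have h : coact F a a' ▷ 𝟙_ V ≫ (ρ_ _).hom ≫ φ a =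
          (α_ _ _ _).hom ≫ vHom V a a' ◁ ((ρ_ _).hom ≫ φ a') ≫ coact F' a a' := by
        rw [rightUnitor_naturality_assoc, hφ]
        simp
      rw [eUncurry_eCurry, eUncurry_eCurry]
      exact h)

lemma eUncurry_natElement {F F' : EnrichedFunctor V Aᵒᵖ V}
    (φ : ∀ a, F.obj (op a) ⟶ F'.obj (op a))
    (hφ : ∀ a a', coact F a a' ≫ φ a = vHom V a a' ◁ φ a' ≫ coact F' a a') (a : A) :
    eUncurry (natElement φ hφ ≫ natProj F F' (op a)) = (ρ_ _).hom ≫ φ a := by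
  rw [natElement, natLift_proj, eUncurry_eCurry]

lemma natElement_comp_eq_eId {F F' : EnrichedFunctor V Aᵒᵖ V}
    (φ : ∀ a, F.obj (op a) ⟶ F'.obj (op a))
    (hφ : ∀ a a', coact F a a' ≫ φ a = vHom V a a' ◁ φ a' ≫ coact F' a a')
    (ψ : ∀ a, F'.obj (op a) ⟶ F.obj (op a))
    (hψ : ∀ a a', coact F' a a' ≫ ψ a = vHom V a a' ◁ ψ a' ≫ coact F a a')
    (h : ∀ a, φ a ≫ ψ a = 𝟙 _) :
    (λ_ _).inv ≫ vComp (natElement φ hφ) (natElement ψ hψ) = eId V F :=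
  nat_hom_ext fun a => eUncurry_injective (by
    rw [Category.assoc, vComp_natProj, eId_natProj, eUncurry_eId, eUncurry_comp, eUncurry_vComp]
    have e1 := eUncurry_natElement φ hφ a.unop
    have e2 := eUncurry_natElement ψ hψ a.unop
    refine (congrArg₂ (fun s t => F.obj a ◁ (λ_ _).inv ≫ (α_ _ _ _).inv ≫ s ▷ 𝟙_ V ≫ t)
      e1 e2).trans ?_
    have e : F.obj (op a.unop) ◁ (λ_ _).inv ≫ (α_ _ _ _).inv ≫
        ((ρ_ (F.obj (op a.unop))).hom ≫ φ a.unop) ▷ 𝟙_ V ≫ (ρ_ _).hom ≫ ψ a.unop =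
        (ρ_ _).hom := by
      rw [rightUnitor_naturality_assoc, Category.assoc, h]
      simp
    exact e)

/-- The isomorphism in `[Aᵒᵖ, V]` given by a `V`-natural family of isomorphisms. -/
def EIso.ofNatIso {F F' : EnrichedFunctor V Aᵒᵖ V} (φ : ∀ a, F.obj (op a) ≅ F'.obj (op a))
    (hφ : ∀ a a', coact F a a' ≫ (φ a).hom = vHom V a a' ◁ (φ a').hom ≫ coact F' a a') :
    EIso V F F' :=
  have hψ : ∀ a a', coact F' a a' ≫ (φ a).inv = vHom V a a' ◁ (φ a').inv ≫ coact F a a' := by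
    intro a a'
    rw [Iso.comp_inv_eq, Category.assoc, hφ, ← MonoidalCategory.whiskerLeft_comp_assoc,
      Iso.inv_hom_id, MonoidalCategory.whiskerLeft_id, Category.id_comp]
  { hom := natElement (fun a => (φ a).hom) hφ
    inv := natElement (fun a => (φ a).inv) hψ
    hom_inv := natElement_comp_eq_eId _ hφ _ hψ fun a => (φ a).hom_inv_id
    inv_hom := natElement_comp_eq_eId _ hψ _ hφ fun a => (φ a).inv_hom_id }

end NaturalIsomorphisms

/-! ### The weight of a colimit of presentable objects is recovered from its vertex -/

section PresentableColimits

variable {V : Type u} [Category.{v} V] [MonoidalCategory V] [SymmetricCategory V]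
  [MonoidalClosed V]
variable {J : Type w₁} [EnrichedCategory V J] {M : Type w₂} [EnrichedCategory V M]
  {i : EnrichedFunctor V J M} {q : EnrichedFunctor V Jᵒᵖ V} {m : M} {η : Cocylinder q i m}

/-- The universal property of a colimit preserved by `M(x, -)`. -/
lemma IsColim.existsUnique_of_preserves (h : IsColim q i m η) {x : M}
    (hx : PreservesColim (homFrom (V := V) x) q i) {Y : V}
    (s : ∀ k, vHom V x (i.obj k) ⊗ q.obj (op k) ⟶ Y)
    (hs : ∀ k k', (α_ _ _ _).inv ≫ (vHom V x (i.obj k) ◁ i.map k k' ≫ eComp V _ _ _) ▷ _ ≫ s k' =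
      _ ◁ coact q k k' ≫ s k) :
    ∃! f : vHom V x m ⟶ Y, ∀ k, (vHom V x (i.obj k) ◁ η.app k ≫ eComp V _ _ _) ≫ f = s k := by
  have e : ∀ k, eUncurry ((η.mapCyl (homFrom (V := V) x)).app k) =
      vHom V x (i.obj k) ◁ η.app k ≫ eComp V x (i.obj k) m := fun k =>
    (eUncurry_comp_map (homFrom (V := V) x) (η.app k)).trans
      (congrArg (fun t => vHom V x (i.obj k) ◁ η.app k ≫ t) (act_homFrom x (i.obj k) m))
  have e' : ∀ k k', act (i.comp V (homFrom (V := V) x)) k k' =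
      vHom V x (i.obj k) ◁ i.map k k' ≫ eComp V x (i.obj k) (i.obj k') := fun k k' =>
    (act_functorComp i (homFrom (V := V) x) k k').trans
      (congrArg (fun t => vHom V x (i.obj k) ◁ i.map k k' ≫ t) (act_homFrom x _ _))
  obtain ⟨f, hf, hf'⟩ := isColim_iff.1 (hx m η h) Y s fun k k' =>
    (congrArg (fun t => (α_ _ _ _).inv ≫ t ▷ q.obj (op k') ≫ s k') (e' k k')).trans (hs k k')
  exact ⟨f, fun k => (congrArg (fun t => t ≫ f) (e k).symm).trans (hf k), fun g hg =>
    hf' g fun k => (congrArg (fun t => t ≫ g) (e k)).trans (hg k)⟩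

/-- The unit of a colimit `m = q * i` is invertible when `i` is fully faithful with values in
objects whose hom-functors preserve the colimit. -/
lemma IsColim.isIso_app (h : IsColim q i m η) (hi : FullyFaithful i) (j : J)
    (hj : PreservesColim (homFrom (V := V) (i.obj j)) q i) : IsIso (η.app j) := by
  have hi' : ∀ j k, IsIso (i.map j k) := hi
  have act_comp' : ∀ k k', eComp V (i.obj j) (i.obj k) (i.obj k') ≫ inv (i.map j k') =
      (inv (i.map j k) ⊗ₘ inv (i.map k k')) ≫ eComp V j k k' := by
    intro k k'
    rw [IsIso.comp_inv_eq, Category.assoc, i.map_comp, tensorHom_comp_tensorHom_assoc]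
    simp
  -- The inverse `M(i j, m) ⟶ q j` is defined on the colimit `q * M(i j, i-)`: its components turn
  -- `M(i j, i k)` back into `J(j, k)` and let it act on `q k`.
  obtain ⟨f, hf, -⟩ := h.existsUnique_of_preserves hj
    (fun k => inv (i.map j k) ▷ _ ≫ coact q j k) (fun k k' => by
      rw [← comp_whiskerRight_assoc, Category.assoc, act_comp', ← id_tensorHom,
        tensorHom_comp_tensorHom_assoc, IsIso.hom_inv_id, Category.id_comp, tensorHom_id,
        comp_whiskerRight, Category.assoc, coact_comp, whisker_exchange_assoc]
      simp)
  -- Only uniqueness is kept: an endomorphism of `M(i j, m)` that fixes the colimit unit is the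
  -- identity.
  obtain ⟨_, -, hu⟩ := h.existsUnique_of_preserves hj
    (fun k => vHom V (i.obj j) (i.obj k) ◁ η.app k ≫ eComp V _ _ _) (fun k k' => by
      have e : ∀ k, vHom V (i.obj j) (i.obj k) ◁ η.app k ≫ eComp V _ _ _ =
          vComp (𝟙 (vHom V (i.obj j) (i.obj k))) (η.app k) := fun k => by
        rw [vComp, id_tensorHom]
      have e' : vHom V (i.obj j) (i.obj k) ◁ i.map k k' ≫ eComp V _ _ _ =
          vComp (𝟙 (vHom V (i.obj j) (i.obj k))) (i.map k k') := by
        rw [vComp, id_tensorHom]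
      rw [e, e, e', ← comp_vComp_left, Category.comp_id, ← vComp_assoc', η.naturality,
        comp_vComp_right])
  refine ⟨f, ?_, (hu _ fun k => ?_).trans (hu _ fun k => ?_).symm⟩
  -- Inserting the identity of `i j` writes `η.app j` through the colimit component at `j`; there
  -- `f` is the action of an identity.
  · have e : η.app j ≫ f = (λ_ _).inv ≫ eId V (i.obj j) ▷ _ ≫
        (vHom V (i.obj j) (i.obj j) ◁ η.app j ≫ eComp V _ _ _) ≫ f := by
      rw [Category.assoc, ← whisker_exchange_assoc, ← leftUnitor_inv_naturality_assoc,
        e_id_comp_assoc]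
    rw [e, hf, ← i.map_id, ← comp_whiskerRight_assoc, Category.assoc, IsIso.hom_inv_id,
      Category.comp_id, coact_id, Iso.inv_hom_id]
  · rw [← Category.assoc, hf, Category.assoc, ← η.naturality]
    have : vComp (i.map j k) (η.app k) = i.map j k ▷ _ ≫ vHom V _ _ ◁ η.app k ≫ eComp V _ _ _ := by
      rw [vComp, MonoidalCategory.tensorHom_def, Category.assoc]
    rw [this, ← comp_whiskerRight_assoc, IsIso.inv_hom_id, id_whiskerRight, Category.id_comp]
  · exact Category.comp_id _

/-- A cocylinder with invertible components, as a family of isomorphisms `q ≅ M(i-, m)`. -/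
def Cocylinder.isoRestrictedHom (η : Cocylinder q i m) (h : ∀ j, IsIso (η.app j)) (j : J) :
    q.obj (op j) ≅ (restrictedHom i m).obj (op j) :=
  have := h j
  asIso (Y := vHom V (i.obj j) m) (η.app j)

lemma Cocylinder.coact_app (η : Cocylinder q i m) (j j' : J) :
    coact q j j' ≫ η.app j = vHom V j j' ◁ η.app j' ≫ coact (restrictedHom i m) j j' := by
  have h : coact q j j' ≫ η.app j = vHom V j j' ◁ η.app j' ≫ vComp (i.map j j') (𝟙 _) := by
    rw [← comp_vComp_right, Category.comp_id, η.naturality]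
  rw [coact_restrictedHom]
  exact h

end PresentableColimits

/-! ### Accessible categories are categories of flat presheaves -/

section AccessibleToFlat

variable {V : Type u} [Category.{v} V] [MonoidalCategory V] [SymmetricCategory V]
  [MonoidalClosed V] [HasLimits V]
variable {P : LimIndexes V} {M : Type w} [EnrichedCategory V M]

lemma fullyFaithful_inclusion {J : Type w₁} (g : J → M) :
    FullyFaithful (inclusion (V := V) g) := fun _ _ => inferInstanceAs (IsIso (𝟙 _))

/-- A `V`-functor with flat values, as a `V`-functor to the category of flat presheaves. -/
def toFlatCat {A : Type v} [EnrichedCategory V A]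
    (T : EnrichedFunctor V M (EnrichedFunctor V Aᵒᵖ V)) (hT : ∀ m, Flat P A (T.obj m)) :
    EnrichedFunctor V M (FlatCat P A) where
  obj m := ⟨T.obj m, hT m⟩
  map m m' := T.map m m'
  map_id m := T.map_id m
  map_comp m m' m'' := T.map_comp m m' m''

/-- An isomorphism of flat presheaves, in the category of flat presheaves. -/
def EIso.toFlatCat {A : Type v} [EnrichedCategory V A] {F F' : FlatCat P A}
    (e : EIso V F.1 F'.1) : EIso V F F' :=
  ⟨e.hom, e.inv, e.hom_inv, e.inv_hom⟩

lemma Accessible.exists_equivalentCats (h : Accessible (Flat P) M) :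
    ∃ (A : Type v) (_ : EnrichedCategory V A), EquivalentCats V M (FlatCat P A) := by
  obtain ⟨hM, J, g, hg, hd, hq⟩ := h
  -- Used twice: for the given presentations of objects of `M`, to see that `M(i-, m)` is flat, and
  -- for the colimit `F * i` of a flat `F`, to see that `F` is in the image.
  have hiso : ∀ {q : EnrichedFunctor V (Induced g)ᵒᵖ V} {m : M}
      {η : Cocylinder q (inclusion g) m}, Flat P (Induced g) q → IsColim q (inclusion g) m η →
      ∀ j, IsIso (η.app j) := fun {q m η} hF hη j =>
    hη.isIso_app (fullyFaithful_inclusion g) j (hg j (Induced g) q hF (inclusion g))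
  have hflat : ∀ m, Flat P (Induced g) ((restrictedYoneda (inclusion (V := V) g)).obj m) := by
    intro m
    obtain ⟨q, hF, η, hη⟩ := hq m
    exact Flat.of_iso (η.isoRestrictedHom (hiso hF hη)) η.coact_app hF
  refine ⟨Induced g, inferInstance, toFlatCat (restrictedYoneda (inclusion g)) hflat,
    fun x y => hd x y, ⟨fun F => ?_⟩⟩
  obtain ⟨m, η, hη⟩ := hM (Induced g) F.1 F.2 (inclusion g)
  let e : EIso V F.1 (restrictedHom (inclusion g) m) :=
    EIso.ofNatIso (η.isoRestrictedHom (hiso F.2 hη)) η.coact_app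
  exact ⟨ForgetEnrichment.of V m, ⟨(EIso.toFlatCat (F := F)
    (F' := ⟨restrictedHom (inclusion g) m, hflat m⟩) e).symm.toIso⟩⟩

end AccessibleToFlat

/-! ### Fully faithful functors reflect colimits and lift cocylinders -/

section Reflection

variable {V : Type u} [Category.{v} V] [MonoidalCategory V] [SymmetricCategory V]
  [MonoidalClosed V]
variable {K : Type w₁} [EnrichedCategory V K] {M : Type w₂} [EnrichedCategory V M]
  {N : Type w₃} [EnrichedCategory V N] {T : EnrichedFunctor V M N}
  {W : EnrichedFunctor V Kᵒᵖ V} {D : EnrichedFunctor V K M} {c : M}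

/-- Fully faithful `V`-functors reflect colimits. -/
lemma IsColim.of_fullyFaithful (hT : FullyFaithful T) {η : Cocylinder W D c}
    (h : IsColim W (D.comp V T) (T.obj c) (η.mapCyl T)) : IsColim W D c η := by
  have hT' : ∀ x y, IsIso (T.map x y) := hT
  intro m X σ
  have hσ : ∀ k k', vComp (D.map k k' ≫ T.map _ _) (σ.app k' ≫ T.map _ _) =
      (α_ _ _ _).inv ≫ coact W k k' ▷ X ≫ σ.app k ≫ T.map _ _ := by
    intro k k'
    rw [← map_vComp, σ.naturality, Category.assoc, Category.assoc]
  have key : ∀ (f : X ⟶ vHom V (T.obj c) (T.obj m)) k, vComp (η.app k) (f ≫ inv (T.map c m)) =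
      σ.app k ↔ vComp (η.app k ≫ T.map _ _) f = σ.app k ≫ T.map _ _ := by
    intro f k
    rw [← cancel_mono (T.map (D.obj k) m), map_vComp, Category.assoc, IsIso.inv_hom_id,
      Category.comp_id]
  obtain ⟨f, hf, hf'⟩ := h (T.obj m) X ⟨fun k => σ.app k ≫ T.map _ _, hσ⟩
  refine ⟨f ≫ inv (T.map c m), fun k => (key f k).2 (hf k), fun f' h' => ?_⟩
  rw [IsIso.eq_comp_inv]
  refine hf' _ fun k => (key _ k).1 ?_
  rw [Category.assoc, IsIso.hom_inv_id, Category.comp_id, h']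

lemma Cocylinder.exists_mapCyl_eq (hT : FullyFaithful T) (κ : Cocylinder W (D.comp V T) (T.obj c)) :
    ∃ η : Cocylinder W D c, η.mapCyl T = κ := by
  have hT' : ∀ x y, IsIso (T.map x y) := hT
  let κ' : ∀ k, W.obj (op k) ⟶ vHom V (T.obj (D.obj k)) (T.obj c) := κ.app
  have e : ∀ k, (κ' k ≫ inv (T.map (D.obj k) c)) ≫ T.map (D.obj k) c = κ' k := fun k => by
    rw [Category.assoc, IsIso.inv_hom_id, Category.comp_id]
  have hκ : ∀ k k', vComp (D.map k k') (κ' k' ≫ inv (T.map (D.obj k') c)) =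
      coact W k k' ≫ κ' k ≫ inv (T.map (D.obj k) c) := by
    intro k k'
    have h : vComp (D.map k k' ≫ T.map _ _) (κ' k') = coact W k k' ≫ κ' k :=
      κ.naturality k k'
    rw [← cancel_mono (T.map (D.obj k) c), map_vComp, e, Category.assoc, e, h]
  refine ⟨⟨fun k => κ' k ≫ inv (T.map (D.obj k) c), hκ⟩, ?_⟩
  cases κ with
  | mk app nat =>
    simp only [Cocylinder.mapCyl, Cocylinder.mk.injEq]
    funext k
    exact e k

end Reflection

/-! ### Density from canonical colimits -/

section Density

variable {V : Type u} [Category.{v} V] [MonoidalCategory V] [SymmetricCategory V]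
  [MonoidalClosed V]
variable {J : Type v} [EnrichedCategory V J] {M : Type w₂} [EnrichedCategory V M]

/-- The canonical cocylinder under `i` with vertex `m`. -/
def canonicalCocylinder (i : EnrichedFunctor V J M) (m : M) :
    Cocylinder (restrictedHom i m) i m where
  app j := 𝟙 (vHom V (i.obj j) m)
  naturality j j' := by
    rw [coact_restrictedHom]
    exact (Category.comp_id _).symm

lemma eUncurry_restrictedApp (i : EnrichedFunctor V J M) (m n : M) (j : J) :
    eUncurry (restrictedApp i m n (op j)) = vComp (𝟙 (vHom V (i.obj j) m)) (𝟙 (vHom V m n)) := by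
  refine (eUncurry_eCurry _).trans ?_
  rw [vComp, id_tensorHom_id, Category.id_comp]

variable [HasLimits V]

/-- `i` is dense when every object is the canonical colimit of objects of the form `i j`. -/
lemma dense_of_isColim {i : EnrichedFunctor V J M}
    (h : ∀ m, IsColim (restrictedHom i m) i m (canonicalCocylinder i m)) : Dense i := by
  intro m n
  have hnat : ∀ j j' : J, vComp (i.map j j') (eUncurry (A := vHom V (i.obj j') m)
        (B := vHom V (i.obj j') n) (natProj (restrictedHom i m) (restrictedHom i n) (op j'))) =
      (α_ _ _ _).inv ≫ coact (restrictedHom i m) j j' ▷ _ ≫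
        eUncurry (natProj (restrictedHom i m) (restrictedHom i n) (op j)) := by
    intro j j'
    have e := coact_eUncurry_natProj (𝟙 (vHom V (restrictedHom i m) (restrictedHom i n))) j j'
    rw [Category.id_comp, Category.id_comp] at e
    rw [e, Iso.inv_hom_id_assoc, coact_restrictedHom]
    exact ((congrArg (vComp (i.map j j')) (Category.comp_id _).symm).trans
      (comp_vComp_right _ _ _))
  -- The stage is the hom-object `[Jᵒᵖ, V](M(i-, m), M(i-, n))` itself: factoring its universal
  -- family of projections through the colimit `m` produces the inverse of the action on homs.
  obtain ⟨f, hf, -⟩ := h m n _ ⟨_, hnat⟩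
  replace hf : ∀ j, vComp (𝟙 (vHom V (i.obj j) m)) f = eUncurry (A := vHom V (i.obj j) m)
    (B := vHom V (i.obj j) n) (natProj (restrictedHom i m) (restrictedHom i n) (op j)) := hf
  have hr : ∀ j, (restrictedYoneda i).map m n ≫ natProj (restrictedHom i m) (restrictedHom i n) j =
    restrictedApp i m n j := natLift_proj _ (restrictedApp_isNat i m n)
  refine ⟨f, (h m).hom_ext fun j => ?_, nat_hom_ext fun j => eUncurry_injective ?_⟩
  · suffices e : vComp (𝟙 (vHom V (i.obj j) m)) ((restrictedYoneda i).map m n ≫ f) =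
        vComp (𝟙 (vHom V (i.obj j) m)) (𝟙 _) from e
    refine (comp_vComp_right _ _ _).trans ((congrArg (fun t => _ ◁ _ ≫ t) (hf j)).trans ?_)
    refine (eUncurry_comp _ _).symm.trans ((congrArg eUncurry (hr (op j))).trans ?_)
    exact eUncurry_restrictedApp i m n j
  · have e : eUncurry (f ≫ restrictedApp i m n j) =
        eUncurry (natProj (restrictedHom i m) (restrictedHom i n) j) := by
      rw [eUncurry_comp]
      refine (congrArg (fun t => vHom V (i.obj j.unop) m ◁ f ≫ t)
        (eUncurry_restrictedApp i m n j.unop)).trans ?_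
      exact (comp_vComp_right _ _ _).symm.trans ((congrArg (vComp _) (Category.comp_id f)).trans
        (hf j.unop))
    refine (congrArg eUncurry ((Category.assoc _ _ _).trans (congrArg (fun t => f ≫ t) (hr j)))).trans
      (e.trans ?_)
    exact congrArg eUncurry (Category.id_comp _).symm

end Density

/-! ### Components of presheaf morphisms, and transport of representations -/

section Components

variable {V : Type u} [Category.{v} V] [MonoidalCategory V] [SymmetricCategory V]
  [MonoidalClosed V] [HasLimits V]
variable {B : Type v} [EnrichedCategory V B]

/-- The component `F b ⟶ F' b` of an element of `[B, V](F, F')`. -/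
def natComponent {F F' : EnrichedFunctor V B V} (f : 𝟙_ V ⟶ vHom V F F') (b : B) :
    F.obj b ⟶ F'.obj b :=
  (ρ_ _).inv ≫ eUncurry (f ≫ natProj F F' b)

lemma natComponent_eId (F : EnrichedFunctor V B V) (b : B) :
    natComponent (eId V F) b = 𝟙 (F.obj b) := by
  rw [natComponent, eId_natProj, eUncurry_eId, Iso.inv_hom_id]

lemma natComponent_vComp {F F' F'' : EnrichedFunctor V B V} (f : 𝟙_ V ⟶ vHom V F F')
    (f' : 𝟙_ V ⟶ vHom V F' F'') (b : B) :
    natComponent ((λ_ _).inv ≫ vComp f f') b = natComponent f b ≫ natComponent f' b := by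
  rw [natComponent, natComponent, natComponent, Category.assoc, vComp_natProj, eUncurry_comp,
    eUncurry_vComp, Category.assoc, rightUnitor_inv_naturality_assoc]
  simp

lemma act_natComponent {F F' : EnrichedFunctor V B V} (f : 𝟙_ V ⟶ vHom V F F') (b b' : B) :
    act F b b' ≫ natComponent f b' = natComponent f b ▷ _ ≫ act F' b b' := by
  have h := congrArg eUncurry (isNat_comp_natProj f b b')
  have h1 : ∀ F : EnrichedFunctor V B V, eUncurry (F.map b b') = act F b b' := fun _ => rfl
  rw [eUncurry_comp, eUncurry_vComp, eUncurry_vComp, h1, h1] at h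
  have h' := F.obj b ◁ (λ_ _).inv ≫= h
  refine Eq.trans ?_ (h'.trans ?_)
  · simp [natComponent]
  · simp [natComponent]

/-- Transport of a representation along an isomorphism. -/
def Representation.ofEIso {F F' : EnrichedFunctor V B V} {b : B} (r : Representation F b)
    (e : EIso V F F') : Representation F' b where
  iso b' := r.iso b' ≪≫
    { hom := natComponent e.hom b'
      inv := natComponent e.inv b'
      hom_inv_id := by rw [← natComponent_vComp, e.hom_inv, natComponent_eId]
      inv_hom_id := by rw [← natComponent_vComp, e.inv_hom, natComponent_eId] }
  nat b' b'' := by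
    simp only [Iso.trans_hom, comp_whiskerRight, Category.assoc]
    rw [← act_natComponent, reassoc_of% (r.nat b' b'')]

end Components

/-! ### Categories of flat presheaves are accessible -/

section FlatToAccessible

variable {V : Type u} [Category.{v} V] [MonoidalCategory V] [SymmetricCategory V]
  [MonoidalClosed V] [HasLimits V]
variable {A : Type v} [EnrichedCategory V A] {M : Type w} [EnrichedCategory V M]
  {U : EnrichedFunctor V M (EnrichedFunctor V Aᵒᵖ V)}

section

variable {P : LimIndexes V} {K : Type v} [EnrichedCategory V K] {W : EnrichedFunctor V Kᵒᵖ V}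

/-- A pointwise colimit exists because `W` has all tensors; evaluation preserves it by construction,
hence every other colimit of the same diagram. -/
lemma HasTensors.preservesColim_evalFunctor {B : Type v} [EnrichedCategory V B]
    (hW : HasTensors W) (D : EnrichedFunctor V K (EnrichedFunctor V B V)) (b : B) :
    PreservesColim (evalFunctor V b) W D := by
  obtain ⟨F, κ, hκ⟩ := hW.exists_pointwise_isColim D
  exact (isColim_of_eval hκ).preservesColim (hκ b)

/-- A full subcategory `U` of `[Aᵒᵖ, V]` with objects the flat presheaves has flat-indexed
colimits, and `U` preserves them. -/
lemma exists_isColim_of_flat (hU : FullyFaithful U) (hflat : ∀ m, Flat P A (U.obj m))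
    (hess : ∀ F, Flat P A F → ∃ c, Nonempty (EIso V F (U.obj c))) (hW : Flat P K W)
    (D : EnrichedFunctor V K M) :
    ∃ (c : M) (η : Cocylinder W D c), IsColim W D c η ∧
      IsColim W (D.comp V U) (U.obj c) (η.mapCyl U) := by
  obtain ⟨F, κ, hκ⟩ := hW.hasTensors.exists_pointwise_isColim (D.comp V U)
  -- The presheaf colimit is again flat, hence comes from `M`; full faithfulness of `U` then lifts
  -- its cocylinder and reflects its universal property.
  obtain ⟨c, ⟨e⟩⟩ := hess F (flat_of_pointwise hW (fun k => hflat (D.obj k)) hκ)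
  have h : IsColim W (D.comp V U) (U.obj c) (κ.postcomp e.hom) :=
    (isColim_of_eval hκ).of_iso e fun _ => rfl
  obtain ⟨η, hη⟩ := Cocylinder.exists_mapCyl_eq hU (κ.postcomp e.hom)
  rw [← hη] at h
  exact ⟨c, η, h.of_fullyFaithful hU, h⟩

lemma preservesColim_of_flat (hU : FullyFaithful U) (hflat : ∀ m, Flat P A (U.obj m))
    (hess : ∀ F, Flat P A F → ∃ c, Nonempty (EIso V F (U.obj c))) (hW : Flat P K W)
    (D : EnrichedFunctor V K M) : PreservesColim U W D := by
  obtain ⟨c, η, h, h'⟩ := exists_isColim_of_flat hU hflat hess hW D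
  exact h.preservesColim h'

end

section

variable {g : A → M}

section

variable (hU : FullyFaithful U) (r : ∀ a, Representation (U.obj (g a)) (op a))

/-- The Yoneda isomorphism `M(g a, m) ≅ U m a`, when `U (g a)` is represented by `a`. -/
def evalIso (a : A) (m : M) : vHom V (g a) m ≅ (U.obj m).obj (op a) :=
  have := hU (g a) m
  { hom := (r a).eval (U.map (g a) m)
    inv := (r a).lift (𝟙 _) ≫ inv (U.map (g a) m)
    hom_inv_id := by
      have e : (r a).eval (U.map (g a) m) ≫ (r a).lift (𝟙 ((U.obj m).obj (op a))) =
          U.map (g a) m :=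
        (r a).eval_injective (by rw [(r a).eval_comp, (r a).eval_lift, Category.comp_id])
      rw [reassoc_of% e, IsIso.hom_inv_id]
    inv_hom_id := by
      rw [← (r a).eval_comp, Category.assoc, IsIso.inv_hom_id, Category.comp_id,
        (r a).eval_lift] }

lemma comp_evalIso {a : A} {m : M} {X : V} (f : X ⟶ vHom V (g a) m) :
    f ≫ (evalIso hU r a m).hom = (r a).eval (f ≫ U.map (g a) m) :=
  ((r a).eval_comp _ _).symm

lemma vComp_evalIso {a : A} {m n : M} {X Y : V} (f : X ⟶ vHom V (g a) m) (f' : Y ⟶ vHom V m n) :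
    vComp f f' ≫ (evalIso hU r a n).hom = (f ≫ (evalIso hU r a m).hom) ▷ Y ≫
      eUncurry ((f' ≫ U.map m n) ≫ natProj (U.obj m) (U.obj n) (op a)) := by
  rw [comp_evalIso, map_vComp, (r a).eval_vComp, comp_evalIso]

/-- The isomorphism `A(a, b) ≅ M(g a, g b)`. -/
def generatorIso (a b : A) : vHom V a b ≅ vHom V (g a) (g b) :=
  (r b).coIso a ≪≫ (evalIso hU r a (g b)).symm

lemma generatorIso_hom_evalIso (a b : A) :
    (generatorIso hU r a b).hom ≫ (evalIso hU r a (g b)).hom = ((r b).coIso a).hom := by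
  simp [generatorIso]

/-- Under the Yoneda isomorphisms, precomposition with maps of generators is the action of `A` on `U
m`. This one fact gives functoriality of `A → Induced g` and identifies `M(i-, m)` with `U m`. -/
lemma generatorIso_vComp {a b : A} {m : M} {X : V} (f : X ⟶ vHom V (g b) m) :
    vComp (generatorIso hU r a b).hom f ≫ (evalIso hU r a m).hom =
      vHom V a b ◁ (f ≫ (evalIso hU r b m).hom) ≫ coact (U.obj m) a b := by
  have h : eUncurry ((f ≫ U.map (g b) m) ≫ natProj (U.obj (g b)) (U.obj m) (op a)) =
      ((r b).coIso a).inv ▷ X ≫ (β_ (vHom V a b) X).hom ≫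
        (r b).eval (f ≫ U.map (g b) m) ▷ vHom V a b ≫ act (U.obj m) (op b) (op a) :=
    (r b).eUncurry_natProj _ (op a)
  rw [vComp_evalIso, generatorIso_hom_evalIso, h, hom_inv_whiskerRight_assoc, ← comp_evalIso hU,
    coact_eq, braiding_naturality_right_assoc]

/-- The fully faithful `V`-functor `A → M` given by the objects `g a`. -/
def generatorFunctor : EnrichedFunctor V A (Induced g) where
  -- `Induced g` has the same objects as `A`, even when `g` identifies some of them, so this functor
  -- is bijective on objects.
  obj a := a
  map a b := (generatorIso hU r a b).hom
  map_id a := by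
    have h : eId V a ≫ (generatorIso hU r a a).hom = eId V (g a) := by
      rw [← cancel_mono (evalIso hU r a (g a)).hom, Category.assoc, generatorIso_hom_evalIso,
        comp_evalIso, U.map_id, Representation.eval, eId_natProj, eUncurry_eId,
        rightUnitor_naturality, ← unitors_equal, Iso.inv_hom_id_assoc]
      rfl
    exact h
  map_comp a b c := by
    have h : eComp V a b c ≫ (generatorIso hU r a c).hom =
        vComp (generatorIso hU r a b).hom (generatorIso hU r b c).hom := by
      rw [← cancel_mono (evalIso hU r a (g c)).hom, generatorIso_vComp, Category.assoc,
        generatorIso_hom_evalIso, generatorIso_hom_evalIso,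
        ← cancel_mono ((r c).coIso a).inv, Category.assoc, Category.assoc,
        (r c).coact_coIso_inv, ← MonoidalCategory.whiskerLeft_comp_assoc]
      simp
    exact h

end

/-- The Yoneda isomorphisms identify `M(i-, m)` with the flat presheaf `U m`, over the isomorphism
`A → Induced g`. -/
lemma flat_restrictedHom (hU : FullyFaithful U) (r : ∀ a, Representation (U.obj (g a)) (op a))
    {P : LimIndexes V} {m : M} (hm : Flat P A (U.obj m)) :
    Flat P (Induced g) (restrictedHom (inclusion g) m) :=
  Flat.reindex (generatorFunctor hU r) (fun a => (evalIso hU r a m).symm) Function.bijective_id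
    (fun a b => inferInstanceAs (IsIso (generatorIso hU r a b).hom)) (fun a b => by
      have h : coact (U.obj m) a b ≫ (evalIso hU r a m).inv =
          ((generatorIso hU r a b).hom ⊗ₘ (evalIso hU r b m).inv) ≫ vComp (𝟙 _) (𝟙 _) := by
        rw [← comp_vComp, Category.comp_id, Category.comp_id, Iso.comp_inv_eq, generatorIso_vComp,
          Iso.inv_hom_id, MonoidalCategory.whiskerLeft_id, Category.id_comp]
      exact h.trans (congrArg (fun t => _ ≫ t)
        (coact_restrictedHom (inclusion g) m a b).symm)) hm

/-- By Yoneda `M(g a, -)` is `U` followed by evaluation at `a`, and both of these preserve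
flat-indexed colimits. -/
lemma presentable_of_representation (hU : FullyFaithful U) (r : ∀ a, Representation (U.obj (g a)) (op a))
    {P : LimIndexes V} (hflat : ∀ m, Flat P A (U.obj m))
    (hess : ∀ F, Flat P A F → ∃ c, Nonempty (EIso V F (U.obj c))) (a : A) :
    Presentable (Flat P) (g a) := by
  intro K _ W hW D
  refine PreservesColim.of_natIso (T := U.comp V (evalFunctor V (op a)))
    (fun m => (evalIso hU r a m).symm) (fun m n => ?_)
    ((preservesColim_of_flat hU hflat hess hW D).comp
      (hW.hasTensors.preservesColim_evalFunctor (D.comp V U) (op a)))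
  have h : eUncurry (U.map m n ≫ natProj (U.obj m) (U.obj n) (op a)) ≫ (evalIso hU r a n).inv =
      (evalIso hU r a m).inv ▷ vHom V m n ≫ eComp V (g a) m n := by
    have e := vComp_evalIso hU r (𝟙 (vHom V (g a) m)) (𝟙 (vHom V m n))
    rw [Category.id_comp, Category.id_comp, vComp, id_tensorHom_id, Category.id_comp] at e
    rw [Iso.comp_inv_eq, Category.assoc, e, inv_hom_whiskerRight_assoc]
  exact h.trans (congrArg (fun t => _ ≫ t) (act_homFrom (g a) m n).symm)

/-- Through the Yoneda isomorphisms, a cofamily of stage `X` on `M(i-, m)` with vertex `m'` is a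
natural family `U m a ⊗ X ⟶ U m' a`, that is, an element of `[Aᵒᵖ, V](U m, U m')`; since `U` is
fully faithful, this is an element of `M(m, m')`. -/
lemma isColim_canonicalCocylinder (hU : FullyFaithful U) (r : ∀ a, Representation (U.obj (g a)) (op a)) (m : M) :
    IsColim (restrictedHom (inclusion g) m) (inclusion g) m
      (canonicalCocylinder (inclusion (V := V) g) m) := by
  intro m' X σ
  have hU' : ∀ x y, IsIso (U.map x y) := hU
  let s : ∀ a : A, vHom V (g a) m ⊗ X ⟶ vHom V (g a) m' := σ.app
  have hs : ∀ a a' : A, vComp (generatorIso hU r a a').hom (s a') =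
      (α_ _ _ _).inv ≫ vComp (generatorIso hU r a a').hom (𝟙 (vHom V (g a') m)) ▷ X ≫ s a := by
    intro a a'
    have h : vComp (𝟙 (vHom V (g a) (g a'))) (s a') =
        (α_ _ _ _).inv ≫ vComp (𝟙 (vHom V (g a) (g a'))) (𝟙 (vHom V (g a') m)) ▷ X ≫ s a :=
      (σ.naturality a a').trans (congrArg (fun t => (α_ _ _ _).inv ≫ t ▷ X ≫ s a)
        (coact_restrictedHom (inclusion g) m a a'))
    rw [← Category.comp_id (generatorIso hU r a a').hom, comp_vComp_left, comp_vComp_left, h,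
      comp_whiskerRight_assoc, associator_inv_naturality_left_assoc]
  let t : ∀ a : A, (U.obj m).obj (op a) ⊗ X ⟶ (U.obj m').obj (op a) := fun a =>
    (evalIso hU r a m).inv ▷ X ≫ s a ≫ (evalIso hU r a m').hom
  have ht : ∀ a a' : A, coact (U.obj m) a a' ▷ X ≫ t a =
      (α_ _ _ _).hom ≫ vHom V a a' ◁ t a' ≫ coact (U.obj m') a a' := by
    intro a a'
    have e : coact (U.obj m) a a' ≫ (evalIso hU r a m).inv =
        vHom V a a' ◁ (evalIso hU r a' m).inv ≫
          vComp (generatorIso hU r a a').hom (𝟙 (vHom V (g a') m)) := by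
      rw [← comp_vComp_right, Category.comp_id, Iso.comp_inv_eq, generatorIso_vComp,
        Iso.inv_hom_id, MonoidalCategory.whiskerLeft_id, Category.id_comp]
    have e' := hs a a' =≫ (evalIso hU r a m').hom
    rw [generatorIso_vComp, Category.assoc, Category.assoc, Iso.eq_inv_comp] at e'
    simp only [t, MonoidalCategory.whiskerLeft_comp, Category.assoc] at e' ⊢
    rw [← comp_whiskerRight_assoc, e, comp_whiskerRight_assoc, ← e']
    simp
  -- A map `f` factors the cofamily exactly when `U f` has components `t`, so existence and
  -- uniqueness both follow from invertibility of `U` on homs.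
  have key : ∀ f : X ⟶ vHom V m m', (∀ a, vComp (𝟙 (vHom V (g a) m)) f = s a) ↔
      ∀ a : A, eUncurry ((f ≫ U.map m m') ≫ natProj (U.obj m) (U.obj m') (op a)) = t a := by
    intro f
    refine forall_congr' fun a => ?_
    rw [← cancel_mono (evalIso hU r a m').hom, vComp_evalIso, Category.id_comp,
      ← cancel_epi ((evalIso hU r a m).hom ▷ X), hom_inv_whiskerRight_assoc]
  have hnat : IsNat (U.obj m) (U.obj m') fun a => eCurry (t a.unop) :=
    (isNat_iff_coact _).2 fun a a' => by
      rw [eUncurry_eCurry, eUncurry_eCurry]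
      exact ht a a'
  refine ⟨natLift _ hnat ≫ inv (U.map m m'), (key _).2 fun a => ?_, fun f hf => ?_⟩
  · rw [Category.assoc (natLift _ hnat), IsIso.inv_hom_id, Category.comp_id, natLift_proj,
      eUncurry_eCurry]
  · rw [IsIso.eq_comp_inv]
    refine nat_hom_ext fun a => eUncurry_injective ?_
    rw [natLift_proj, eUncurry_eCurry]
    exact (key f).1 hf a.unop

end

lemma accessible_of_equivalentCats {P : LimIndexes V} (h : EquivalentCats V M (FlatCat P A)) :
    Accessible (Flat P) M := by
  obtain ⟨T, hT, hT'⟩ := h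
  -- The equivalence enters only through `U`: it is fully faithful, has flat values, and reaches
  -- every flat presheaf up to isomorphism, so no inverse equivalence is needed.
  let U : EnrichedFunctor V M (EnrichedFunctor V Aᵒᵖ V) := T.comp V (inclusion Subtype.val)
  have hU : FullyFaithful U := fun x y => by
    have := hT x y
    exact inferInstanceAs (IsIso (T.map x y ≫ 𝟙 _))
  have hflat : ∀ m, Flat P A (U.obj m) := fun m => (T.obj m).2
  have hess : ∀ F, Flat P A F → ∃ c, Nonempty (EIso V F (U.obj c)) := by
    intro F hF
    let x : ForgetEnrichment V (FlatCat P A) := ForgetEnrichment.of V ⟨F, hF⟩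
    obtain ⟨c, ⟨e⟩⟩ := hT'.mem_essImage x
    exact ⟨c, ⟨((EIso.ofIso e).symm).map (inclusion Subtype.val)⟩⟩
  -- The generators are objects of `M` corresponding to the representables, which are flat.
  choose g hg using fun a : A => hess (homFrom (V := V) (op a))
    (Representation.flat (homFromRepresentation (V := V) (op a)))
  let r : ∀ a, Representation (U.obj (g a)) (op a) := fun a =>
    (homFromRepresentation (V := V) (op a)).ofEIso (hg a).some
  have hcan := isColim_canonicalCocylinder hU r
  exact ⟨fun K _ W hW D => (exists_isColim_of_flat hU hflat hess hW D).imp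
      fun c ⟨η, h, _⟩ => ⟨η, h⟩,
    A, g, presentable_of_representation hU r hflat hess, dense_of_isColim hcan,
    -- The weight presenting `m` is the canonical one, `M(i-, m)`.
    fun m => ⟨_, flat_restrictedHom hU r (hflat m), _, hcan m⟩⟩

end FlatToAccessible

end EnrichedFlat

end

theorem theorem2p14 {V : Type u} [Category.{v} V] [MonoidalCategory V] [SymmetricCategory V]
    [MonoidalClosed V] [HasLimits V] (P : EnrichedFlat.LimIndexes V)
    {M : Type w} [EnrichedCategory V M] :
    EnrichedFlat.Accessible (EnrichedFlat.Flat P) M ↔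
      ∃ (A : Type v) (_ : EnrichedCategory V A),
        EnrichedFlat.EquivalentCats V M (EnrichedFlat.FlatCat P A) :=
  ⟨fun h => h.exists_equivalentCats, fun ⟨_, _, h⟩ => EnrichedFlat.accessible_of_equivalentCats h⟩
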